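/- **Theorem.** An instance of *Reachable Assignment* consists of a set $N$ of $n$ agents, a set $X$ of $n$ objects, for every agent $i\in N$ a preference list $\succ_i$ (a strict linear ordering of a non-empty subset $X_i\subseteq X$), a graph $G$ with vertex set $N$, an initial assignment $\sigma_0$ and a target assignment $\sigma$, where an assignment is a bijection $N\to X$. A *rational swap* turns an assignment $\rho$ into the assignment obtained from it by letting two agents $i,j$ that are adjacent in $G$ exchange their objects, and it is permitted only if $\rho(j)\succ_i\rho(i)$ and $\rho(i)\succ_j\rho(j)$. The question is whether $\sigma$ can be reached from $\sigma_0$ by a finite (possibly empty) sequence of rational swaps. Reachable Assignment restricted to instances whose graph $G$ is a cycle on $n\ge 3$ vertices is decidable in $\mathcal{O}(n^3)$ time. That is, there are a single program for the word RAM (unit cost per elementary operation on a word) and constants $c,\kappa$ such that, for every $n\ge 3$, every such instance with $n$ agents, and every word length of at least $\kappa$ times the number of binary digits of $n$, the program halts after at most $c\,n^3$ steps with the correct answer. Here agents and objects are numbered $0,\dots,n-1$ (agents not necessarily in the order along the cycle), and the input consists of $n$, the arrays of $\sigma_0$ and $\sigma$, the preference lists with their lengths, and the adjacency matrix of $G$.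 -/

import Mathlib

namespace ReachableAssignment

/-! ### The problem -/

/-- An instance of Reachable Assignment with `n` agents and `n` objects, both numbered
`0, …, n - 1`: a graph on the agents, for every agent a preference list (a strict ordering of a
non-empty subset of the objects, most preferred object first), an initial assignment and a target
assignment (bijections from agents to objects). -/
structure Inst (n : ℕ) where
  graph : SimpleGraph (Fin n)
  pref : Fin n → List (Fin n)
  pref_nodup : ∀ i, (pref i).Nodup
  pref_ne_nil : ∀ i, pref i ≠ []
  init : Fin n ≃ Fin n
  target : Fin n ≃ Fin n

/-- Agent `i` prefers object `a` to object `b`: both are on the list of `i`, and `a` comes first. -/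
def Inst.Prefers {n : ℕ} (I : Inst n) (i a b : Fin n) : Prop :=
  a ∈ I.pref i ∧ b ∈ I.pref i ∧ (I.pref i).idxOf a < (I.pref i).idxOf b

/-- `τ` arises from the assignment `ρ` by one rational swap: two adjacent agents exchange the
objects they hold under `ρ`, and both prefer what they receive to what they give away. -/
def Inst.RationalSwap {n : ℕ} (I : Inst n) (ρ τ : Fin n ≃ Fin n) : Prop :=
  ∃ i j : Fin n, I.graph.Adj i j ∧ I.Prefers i (ρ j) (ρ i) ∧ I.Prefers j (ρ i) (ρ j) ∧
    τ = (Equiv.swap i j).trans ρ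

/-- The target assignment is reachable from the initial one by a (possibly empty) sequence of
rational swaps. -/
def Inst.IsYes {n : ℕ} (I : Inst n) : Prop :=
  Relation.ReflTransGen I.RationalSwap I.init I.target

/-- The graph of the instance is a cycle through all `n` agents (to be used for `3 ≤ n`); the
agents need not be numbered in the order of the cycle. -/
def Inst.OnCycle {n : ℕ} (I : Inst n) : Prop :=
  Nonempty (I.graph ≃g SimpleGraph.cycleGraph n)

/-! ### The machine model: a word RAM with words of `w` bits

A program is a fixed finite term; it uses finitely many word variables and finitely many arrays of
words. Every elementary operation (constant, variable access, array access, arithmetic operation,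
comparison, store, branch) takes one step, and every number that is computed is reduced
modulo `2 ^ w`. -/

/-- The unit-cost word operations. -/
inductive Op where
  | add | sub | mul | div | mod | lt | eq

/-- The value of a word operation on `w`-bit words. Subtraction is truncated at `0`, division by
`0` gives `0`, `a mod 0` is `a`, and comparisons give `1` or `0`. -/
def Op.eval (w : ℕ) : Op → ℕ → ℕ → ℕ
  | .add, a, b => (a + b) % 2 ^ w
  | .sub, a, b => a - b
  | .mul, a, b => (a * b) % 2 ^ w
  | .div, a, b => a / b
  | .mod, a, b => a % b
  | .lt, a, b => (if a < b then 1 else 0) % 2 ^ w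
  | .eq, a, b => (if a = b then 1 else 0) % 2 ^ w

/-- The memory: word variables and arrays of words, both indexed by their names. -/
structure Store where
  var : ℕ → ℕ
  arr : ℕ → ℕ → ℕ

def Store.setVar (s : Store) (x v : ℕ) : Store :=
  { s with var := Function.update s.var x v }

def Store.setArr (s : Store) (a k v : ℕ) : Store :=
  { s with arr := Function.update s.arr a (Function.update (s.arr a) k v) }

/-- Expressions: constants, variables, array entries, and word operations. -/
inductive Expr where
  | const (k : ℕ)
  | var (x : ℕ)
  | get (a : ℕ) (idx : Expr)
  | op (o : Op) (e₁ e₂ : Expr)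

def Expr.eval (w : ℕ) (s : Store) : Expr → ℕ
  | .const k => k % 2 ^ w
  | .var x => s.var x
  | .get a idx => s.arr a (idx.eval w s)
  | .op o e₁ e₂ => o.eval w (e₁.eval w s) (e₂.eval w s)

/-- The number of steps that the evaluation of an expression takes. -/
def Expr.cost : Expr → ℕ
  | .const _ => 1
  | .var _ => 1
  | .get _ idx => idx.cost + 1
  | .op _ e₁ e₂ => e₁.cost + e₂.cost + 1

/-- Programs; a test succeeds when its value is not `0`. -/
inductive Prog where
  | skip
  | assign (x : ℕ) (e : Expr)
  | put (a : ℕ) (idx e : Expr)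
  | seq (p q : Prog)
  | ite (b : Expr) (p q : Prog)
  | loop (b : Expr) (p : Prog)

/-- `Exec w p s t s'`: on `w`-bit words, the program `p`, started with memory `s`, halts after
exactly `t` steps with memory `s'`. -/
inductive Exec (w : ℕ) : Prog → Store → ℕ → Store → Prop
  | skip (s : Store) : Exec w .skip s 1 s
  | assign (s : Store) (x : ℕ) (e : Expr) :
      Exec w (.assign x e) s (e.cost + 1) (s.setVar x (e.eval w s))
  | put (s : Store) (a : ℕ) (idx e : Expr) :
      Exec w (.put a idx e) s (idx.cost + e.cost + 1) (s.setArr a (idx.eval w s) (e.eval w s))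
  | seq {p q : Prog} {s s₁ s₂ : Store} {t₁ t₂ : ℕ} :
      Exec w p s t₁ s₁ → Exec w q s₁ t₂ s₂ → Exec w (.seq p q) s (t₁ + t₂) s₂
  | ite_true {b : Expr} {p q : Prog} {s s' : Store} {t : ℕ} :
      b.eval w s ≠ 0 → Exec w p s t s' → Exec w (.ite b p q) s (b.cost + 1 + t) s'
  | ite_false {b : Expr} {p q : Prog} {s s' : Store} {t : ℕ} :
      b.eval w s = 0 → Exec w q s t s' → Exec w (.ite b p q) s (b.cost + 1 + t) s'
  | loop_done {b : Expr} {p : Prog} {s : Store} :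
      b.eval w s = 0 → Exec w (.loop b p) s (b.cost + 1) s
  | loop_step {b : Expr} {p : Prog} {s s₁ s₂ : Store} {t₁ t₂ : ℕ} :
      b.eval w s ≠ 0 → Exec w p s t₁ s₁ → Exec w (.loop b p) s₁ t₂ s₂ →
        Exec w (.loop b p) s (b.cost + 1 + t₁ + t₂) s₂

/-- The machine is deterministic: halting time and final memory are determined by the input. -/
theorem Exec.deterministic {w : ℕ} {p : Prog} {s s₁ s₂ : Store} {t₁ t₂ : ℕ}
    (h₁ : Exec w p s t₁ s₁) (h₂ : Exec w p s t₂ s₂) : t₁ = t₂ ∧ s₁ = s₂ := by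
  induction h₁ generalizing t₂ s₂ with
  | skip | assign | put => cases h₂; exact ⟨rfl, rfl⟩
  | seq _ _ ih₁ ih₂ =>
    cases h₂ with
    | seq a b =>
      obtain ⟨rfl, rfl⟩ := ih₁ a
      obtain ⟨rfl, rfl⟩ := ih₂ b
      exact ⟨rfl, rfl⟩
  | ite_true hb _ ih | ite_false hb _ ih =>
    cases h₂ with
    | ite_true hb' a => first | exact absurd hb hb' | (obtain ⟨rfl, rfl⟩ := ih a; exact ⟨rfl, rfl⟩)
    | ite_false hb' a => first | exact absurd hb' hb | (obtain ⟨rfl, rfl⟩ := ih a; exact ⟨rfl, rfl⟩)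
  | loop_done hb =>
    cases h₂ with
    | loop_done => exact ⟨rfl, rfl⟩
    | loop_step hb' => exact absurd hb hb'
  | loop_step hb _ _ ih₁ ih₂ =>
    cases h₂ with
    | loop_done hb' => exact absurd hb' hb
    | loop_step _ a b =>
      obtain ⟨rfl, rfl⟩ := ih₁ a
      obtain ⟨rfl, rfl⟩ := ih₂ b
      exact ⟨rfl, rfl⟩

/-! ### The input format -/

/-- An array that holds `f 0, …, f (n - 1)`, and `0` elsewhere. -/
def vec (n : ℕ) (f : Fin n → ℕ) (k : ℕ) : ℕ :=
  if h : k < n then f ⟨k, h⟩ else 0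

/-- An array that holds an `n × n` table row by row (`f i j` in position `i * n + j`), and `0`
elsewhere. -/
def table (n : ℕ) (f : Fin n → Fin n → ℕ) (k : ℕ) : ℕ :=
  if h : k < n * n then
    f ⟨k / n, Nat.div_lt_of_lt_mul h⟩
      ⟨k % n, Nat.mod_lt k (Nat.pos_of_ne_zero (by rintro rfl; simp at h))⟩
  else 0

open Classical in
/-- The initial memory on input `I`. Variable `0` holds `n`. Array `0` holds the initial assignment,
array `1` the target assignment, array `2` the lengths of the preference lists, array `3` the
preference lists (row `i` lists the objects on the list of agent `i`, most preferred first, padded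
with `0`), array `4` the adjacency matrix of the graph. All other words are `0`. -/
noncomputable def Inst.encode {n : ℕ} (I : Inst n) : Store where
  var x := if x = 0 then n else 0
  arr a :=
    if a = 0 then vec n fun i => (I.init i : ℕ)
    else if a = 1 then vec n fun i => (I.target i : ℕ)
    else if a = 2 then vec n fun i => (I.pref i).length
    else if a = 3 then table n fun i k => ((I.pref i).map Fin.val).getD k 0
    else if a = 4 then table n fun i j => if I.graph.Adj i j then 1 else 0
    else fun _ => 0

end ReachableAssignment

/-! ### The cycle unrolled to the integers -/

namespace ReachableAssignment

/-! Unroll the cycle to the integers: site `i` belongs to agent `c i`, and in a sequence of swaps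
every object travels a signed distance `δ`. An agent never gets back an object that it gave away,
because its holdings only improve. Hence no object changes direction or goes all the way round, and
the target leaves object `k` two options: `D k` sites clockwise or `n - D k` sites
counter-clockwise. Each swap moves one object in either direction, so the displacements sum to `0`
and the number of counter-clockwise objects must be `m = (∑ D k) / n`.

Objects with the same direction are never exchanged. When a clockwise object from site `a` meets a
counter-clockwise object from site `b > a`, it has passed exactly the counter-clockwise objects
between them. If `N` counts the counter-clockwise objects from left to right, the exchange therefore
takes place between `E` and `E + 1` with `E = a - N a + N b`, whatever the order of the swaps.

Sufficiency (`Plan.reachable`). Suppose that the displacements sum to `0`, and that every pair whose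
destinations are in the wrong order consists of a clockwise and a counter-clockwise object and may
be exchanged at its edge `E`. Then bubble sort works: a neighbouring pair in the wrong order is
already at its edge, exchanging it changes no `E` because `a - N a` and `N b` are preserved, and `∑
δ ^ 2` drops. When no such neighbours are left, `δ` is nondecreasing along a periodic sequence,
hence constant, hence `0`.

Necessity (`Future.exists_of_reachable`). By induction on the sequence, every actual sequence of
swaps has this form. Moreover, the agents that see both objects of an exchange prefer the
counter-clockwise one up to `E` and the clockwise one beyond `E`, since each agent prefers what
comes later.

If `N k` were a known function of the direction of `k` alone, choosing the directions would be a
two-satisfiability problem. To achieve this, guess neighbours of which the left one does not move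
counter-clockwise and the right one does; they exist unless nothing has to move. There are `n`
guesses, and a rotation turns the pair into the objects `0` and `1`. A counter-clockwise object `k`
either meets object `0`, exactly at the edge `N k`, which the preferences determine uniquely; or it
does not, and then the counter-clockwise objects from `k` on are recognised by their destinations.
Clockwise objects are treated likewise by means of the translate of object `1` at site `n + 1`. The
resulting claims `cl` satisfy `ClaimSpec`, and `Future.exists_consistent` shows that a correct guess
gives a solvable instance. Conversely, the clauses themselves force the selected claims to be prefix
counts up to a constant, so `Consistent.isYes` accepts any solution without trusting the guess.

A guess costs `O(n ^ 2)`: `4 * n ^ 2` clauses are tested in constant time each, and the dense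
two-satisfiability instance is solved by propagating both values of a variable in alternation. The
work is charged to the variables that the successful side eliminates (`runs_trial`, `runs_solver`).
The rest is the verification of the program. -/

/-- `c` enumerates the agents along the cycle `G`, periodically. -/
structure CycOrder {n : ℕ} (G : SimpleGraph (Fin n)) (c : ℤ → Fin n) : Prop where
  eq_iff : ∀ i j, c i = c j ↔ (n : ℤ) ∣ i - j
  surj : Function.Surjective c
  adj_iff : ∀ i j, G.Adj (c i) (c j) ↔ (n : ℤ) ∣ j - i - 1 ∨ (n : ℤ) ∣ i - j - 1

theorem Inst.Prefers.trans {n : ℕ} {I : Inst n} {i a b d : Fin n}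
    (h₁ : I.Prefers i a b) (h₂ : I.Prefers i b d) : I.Prefers i a d :=
  ⟨h₁.1, h₂.2.1, h₁.2.2.trans h₂.2.2⟩

theorem Inst.Prefers.asymm {n : ℕ} {I : Inst n} {i a b : Fin n}
    (h₁ : I.Prefers i a b) (h₂ : I.Prefers i b a) : False :=
  absurd h₁.2.2 h₂.2.2.asymm

namespace CycOrder

variable {n : ℕ} {G : SimpleGraph (Fin n)} {c : ℤ → Fin n}

/-- Used to move a guessed pair of neighbours to the sites `0` and `1`. -/
theorem shift (h : CycOrder G c) (k : ℤ) : CycOrder G fun i => c (k + i) where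
  eq_iff i j := by rw [h.eq_iff]; ring_nf
  surj v := by
    obtain ⟨i, rfl⟩ := h.surj v
    exact ⟨i - k, by simp⟩
  adj_iff i j := by rw [h.adj_iff]; ring_nf

theorem congr (h : CycOrder G c) {i j : ℤ} (e : c i = c j) (k : ℤ) : c (i + k) = c (j + k) := by
  rw [h.eq_iff] at e ⊢; simpa using e

theorem pred_eq (h : CycOrder G c) {i j : ℤ} (e : c j = c (i + 1)) : c (j - 1) = c i := by
  rw [h.eq_iff] at e ⊢
  convert e using 1; ring

theorem add_period (h : CycOrder G c) (i : ℤ) : c (i + n) = c i := by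
  rw [h.eq_iff]; simp

theorem add_mul_period (h : CycOrder G c) (i j : ℤ) : c (i + n * j) = c i := by
  rw [h.eq_iff]; simp

theorem emod (h : CycOrder G c) (i : ℤ) : c (i % n) = c i := by
  rw [h.eq_iff, ← neg_sub, Int.dvd_neg]; exact Int.dvd_self_sub_emod

theorem succ_ne (h : CycOrder G c) (hn : 2 ≤ n) (i : ℤ) : c i ≠ c (i + 1) := by
  intro e
  rw [h.eq_iff, show i - (i + 1) = -1 by ring, Int.dvd_neg] at e
  have := Int.le_of_dvd one_pos e
  omega

theorem adj_succ (h : CycOrder G c) (i : ℤ) : G.Adj (c i) (c (i + 1)) :=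
  (h.adj_iff _ _).2 (.inl (by simp))

end CycOrder

/-! ### Effect of one exchange on sites, displacements and counts -/

/-- Site `j` after the exchange of the neighbouring sites `i` and `i + 1` (and their translates). -/
def siteSwap {n : ℕ} (c : ℤ → Fin n) (i j : ℤ) : ℤ :=
  j + (if c j = c i then 1 else 0) - (if c j = c (i + 1) then 1 else 0)

/-- Displacements after the exchange of the objects at the sites `i` and `i + 1`. -/
def dispSwap {n : ℕ} (c : ℤ → Fin n) (i : ℤ) (δ : Fin n → ℤ) (v : Fin n) : ℤ :=
  δ (Equiv.swap (c i) (c (i + 1)) v) + (if v = c i then 1 else 0) -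
    (if v = c (i + 1) then 1 else 0)

/-- `N` counts the sites labelled `true` from left to right. -/
def Counts {n : ℕ} (c : ℤ → Fin n) (d : Fin n → Bool) (N : ℤ → ℤ) : Prop :=
  ∀ i, N (i + 1) = N i + if d (c i) then 1 else 0

def countSwap {n : ℕ} (c : ℤ → Fin n) (i : ℤ) (N : ℤ → ℤ) (j : ℤ) : ℤ :=
  N j + if c j = c (i + 1) then 1 else 0

section swap

variable {n : ℕ} {G : SimpleGraph (Fin n)} {c : ℤ → Fin n}

theorem siteSwap_left (h : CycOrder G c) (hn : 2 ≤ n) {i j : ℤ} (e : c j = c i) :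
    siteSwap c i j = j + 1 := by
  simp [siteSwap, e, h.succ_ne hn i]

theorem siteSwap_right (h : CycOrder G c) (hn : 2 ≤ n) {i j : ℤ} (e : c j = c (i + 1)) :
    siteSwap c i j = j - 1 := by
  simp [siteSwap, e, (h.succ_ne hn i).symm]

theorem siteSwap_of_ne {i j : ℤ} (e : c j ≠ c i) (e' : c j ≠ c (i + 1)) :
    siteSwap c i j = j := by
  simp [siteSwap, e, e']

theorem apply_siteSwap (h : CycOrder G c) (hn : 2 ≤ n) (i j : ℤ) :
    c (siteSwap c i j) = Equiv.swap (c i) (c (i + 1)) (c j) := by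
  by_cases e : c j = c i
  · rw [siteSwap_left h hn e, e, Equiv.swap_apply_left]; exact h.congr e 1
  by_cases e' : c j = c (i + 1)
  · rw [siteSwap_right h hn e', e', Equiv.swap_apply_right]
    exact h.pred_eq e'
  rw [siteSwap_of_ne e e', Equiv.swap_apply_of_ne_of_ne e e']

theorem siteSwap_siteSwap (h : CycOrder G c) (hn : 2 ≤ n) (i j : ℤ) :
    siteSwap c i (siteSwap c i j) = j := by
  have hc := apply_siteSwap h hn i j
  by_cases e : c j = c i
  · rw [e, Equiv.swap_apply_left] at hc
    rw [siteSwap_right h hn hc, siteSwap_left h hn e]; ring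
  by_cases e' : c j = c (i + 1)
  · rw [e', Equiv.swap_apply_right] at hc
    rw [siteSwap_left h hn hc, siteSwap_right h hn e']; ring
  rw [siteSwap_of_ne e e', siteSwap_of_ne e e']

/-- Sites move by at most one, so only the two sites of an exchanged pair change their order. -/
theorem siteSwap_lt (h : CycOrder G c) (hn : 2 ≤ n) (i : ℤ) {a b : ℤ} (hab : a < b) :
    siteSwap c i a < siteSwap c i b ∨ c a = c i ∧ b = a + 1 := by
  by_cases ea : c a = c i
  · by_cases hb : b = a + 1
    · exact .inr ⟨ea, hb⟩
    left
    rw [siteSwap_left h hn ea]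
    by_cases eb : c b = c (i + 1)
    · rw [siteSwap_right h hn eb]
      by_cases hb2 : b = a + 2
      · exfalso
        have h1 := h.congr ea 1
        rw [← eb, hb2] at h1
        exact h.succ_ne hn (a + 1) (by rw [h1]; ring_nf)
      · omega
    · unfold siteSwap; split_ifs <;> omega
  · left
    by_cases eb : c b = c (i + 1)
    · have hb : b ≠ a + 1 := by
        rintro rfl
        exact ea (by simpa using h.congr eb (-1))
      rw [siteSwap_right h hn eb]
      unfold siteSwap; split_ifs <;> omega
    · unfold siteSwap; split_ifs <;> omega

/-- The object now at `j` was at `siteSwap c i j` before; an exchange leaves its destination alone.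
-/
theorem add_dispSwap (h : CycOrder G c) (hn : 2 ≤ n) (i j : ℤ) (δ : Fin n → ℤ) :
    j + dispSwap c i δ (c j) = siteSwap c i j + δ (c (siteSwap c i j)) := by
  rw [apply_siteSwap h hn]; unfold siteSwap dispSwap; ring

theorem sum_dispSwap (c : ℤ → Fin n) (i : ℤ) (δ : Fin n → ℤ) :
    ∑ v, dispSwap c i δ v = ∑ v, δ v := by
  simp only [dispSwap, Finset.sum_sub_distrib, Finset.sum_add_distrib]
  rw [Equiv.sum_comp (Equiv.swap (c i) (c (i + 1))) δ]
  simp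

theorem counts_swap (h : CycOrder G c) (hn : 2 ≤ n) {i : ℤ} {d : Fin n → Bool} {N : ℤ → ℤ}
    (hN : Counts c d N) (h0 : d (c i) = false) (h1 : d (c (i + 1)) = true) :
    Counts c (d ∘ Equiv.swap (c i) (c (i + 1))) (countSwap c i N) := by
  intro j
  have hj := hN j
  unfold countSwap
  by_cases e : c j = c i
  · have e1 := h.congr e 1
    have : c j ≠ c (i + 1) := e ▸ h.succ_ne hn i
    simp [e, e1, h1] at hj ⊢
    simp [h0] at hj
    rw [if_neg (h.succ_ne hn i)]; omega
  have e1 : c (j + 1) ≠ c (i + 1) := fun e' => e (by simpa using h.congr e' (-1))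
  by_cases e' : c j = c (i + 1)
  · simp [e', h0, h1] at hj ⊢
    rw [if_neg e1]; omega
  · simp [e1, e', Equiv.swap_apply_of_ne_of_ne e e', hj]

/-- A clockwise object that takes part in the exchange advances by one site and gets past one
counter-clockwise object, so the two changes cancel. With `countSwap_eq` this makes the meeting edge
`a - N a + N b` of every pair invariant. -/
theorem sub_countSwap (h : CycOrder G c) (hn : 2 ≤ n) {i : ℤ} {d : Fin n → Bool} {N : ℤ → ℤ}
    (hN : Counts c d N) (h0 : d (c i) = false) (h1 : d (c (i + 1)) = true) {a : ℤ}
    (ha : d (c (siteSwap c i a)) = false) :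
    a - countSwap c i N a = siteSwap c i a - N (siteSwap c i a) := by
  rw [apply_siteSwap h hn] at ha
  unfold countSwap
  by_cases e : c a = c i
  · rw [e, Equiv.swap_apply_left, h1] at ha; simp at ha
  by_cases e' : c a = c (i + 1)
  · rw [siteSwap_right h hn e', if_pos e']
    have h2 := hN (a - 1)
    have h3 : c (a - 1) = c i := h.pred_eq e'
    rw [h3, h0] at h2
    simp at h2
    omega
  · rw [siteSwap_of_ne e e', if_neg e']; simp

/-- A counter-clockwise object only passes clockwise ones, which are not counted. -/
theorem countSwap_eq (h : CycOrder G c) (hn : 2 ≤ n) {i : ℤ} {d : Fin n → Bool} {N : ℤ → ℤ}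
    (hN : Counts c d N) (h0 : d (c i) = false) {b : ℤ}
    (hb : d (c (siteSwap c i b)) = true) :
    countSwap c i N b = N (siteSwap c i b) := by
  rw [apply_siteSwap h hn] at hb
  unfold countSwap
  by_cases e : c b = c i
  · have h2 := hN b
    rw [e, h0] at h2
    have : c b ≠ c (i + 1) := e ▸ h.succ_ne hn i
    rw [siteSwap_left h hn e, if_neg this, h2]; simp
  by_cases e' : c b = c (i + 1)
  · rw [e', Equiv.swap_apply_right, h0] at hb; simp at hb
  · rw [siteSwap_of_ne e e', if_neg e']; simp

end swap

/-! ### Sufficiency: a plan is carried out by bubble sort -/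

/-- A plan for the assignment `ρ`: the object at site `i` is to move to site `i + δ (c i)`, `d` marks
the sites whose objects move counter-clockwise, and every exchange that has to happen is rational
at the edge where it will happen. -/
structure Plan {n : ℕ} (I : Inst n) (c : ℤ → Fin n) (ρ : Fin n ≃ Fin n) (δ : Fin n → ℤ)
    (d : Fin n → Bool) (N : ℤ → ℤ) : Prop where
  counts : Counts c d N
  target : ∀ i, I.target (c (i + δ (c i))) = ρ (c i)
  inv : ∀ a b, a < b → b + δ (c b) < a + δ (c a) → d (c a) = false ∧ d (c b) = true ∧
    I.Prefers (c (a - N a + N b)) (ρ (c b)) (ρ (c a)) ∧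
    I.Prefers (c (a - N a + N b + 1)) (ρ (c a)) (ρ (c b))
  sum : ∑ v, δ v = 0

namespace Plan

variable {n : ℕ} {I : Inst n} {c : ℤ → Fin n} {ρ : Fin n ≃ Fin n} {δ : Fin n → ℤ}
  {d : Fin n → Bool} {N : ℤ → ℤ}

/-- Equal destinations mean equal objects, hence the same agent at present, hence the same
displacement. -/
theorem injective (P : Plan I c ρ δ d N) {i j : ℤ}
    (h : i + δ (c i) = j + δ (c j)) : i = j := by
  have h1 := P.target i
  rw [h, P.target j] at h1
  have h2 := ρ.injective h1
  rw [h2] at h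
  linarith

/-- If neighbours are never in the wrong order, `δ` is nondecreasing from site to site. Being
periodic it is constant, and its sum is `0`. -/
theorem eq_target (hc : CycOrder I.graph c) (hn : 2 ≤ n) (P : Plan I c ρ δ d N)
    (h : ∀ i, i + δ (c i) ≤ i + 1 + δ (c (i + 1))) : ρ = I.target := by
  have hlt : ∀ i, δ (c i) ≤ δ (c (i + 1)) := fun i => by
    have := fun e => P.injective (i := i) (j := i + 1) e
    have := h i
    omega
  have hmono : ∀ (k : ℕ) i, δ (c i) ≤ δ (c (i + k)) := by
    intro k
    induction k with
    | zero => simp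
    | succ k ih =>
      intro i
      push_cast
      rw [← add_assoc]
      exact (ih i).trans (hlt _)
  have hconst : ∀ i j, δ (c i) ≤ δ (c j) := by
    intro i j
    -- Some translate of `j` lies at or after `i`, so monotonicity compares any two agents in both
    -- directions.
    have h1 := hmono ((j - i) % n).toNat i
    have hn0 : (n : ℤ) ≠ 0 := by omega
    rw [Int.toNat_of_nonneg (Int.emod_nonneg _ hn0)] at h1
    have : c (i + (j - i) % n) = c j := by
      rw [hc.eq_iff]
      have := Int.dvd_self_sub_emod (x := j - i) (m := (n : ℤ))
      rw [← Int.dvd_neg]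
      convert this using 1; ring
    rwa [this] at h1
  have hz : ∀ v, δ v = 0 := by
    intro v
    have hs : ∑ u, δ u = ∑ _u : Fin n, δ v := by
      apply Finset.sum_congr rfl
      intro u _
      obtain ⟨i, rfl⟩ := hc.surj u
      obtain ⟨j, rfl⟩ := hc.surj v
      exact le_antisymm (hconst _ _) (hconst _ _)
    rw [P.sum] at hs
    simp at hs
    omega
  ext v
  obtain ⟨i, rfl⟩ := hc.surj v
  rw [← P.target i, hz]; simp

/-- All destinations, the labels carried by the objects and all meeting edges survive the exchange,
and the only pair that changes its order is no longer in the wrong order. -/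
theorem swap (hc : CycOrder I.graph c) (hn : 2 ≤ n) (P : Plan I c ρ δ d N) {i : ℤ}
    (h : i + 1 + δ (c (i + 1)) < i + δ (c i)) :
    Plan I c ((Equiv.swap (c i) (c (i + 1))).trans ρ) (dispSwap c i δ)
      (d ∘ Equiv.swap (c i) (c (i + 1))) (countSwap c i N) := by
  obtain ⟨h0, h1, -⟩ := P.inv i (i + 1) (by omega) h
  refine ⟨counts_swap hc hn P.counts h0 h1, fun j => ?_, fun a b hab hg => ?_, ?_⟩
  · rw [add_dispSwap hc hn, P.target, apply_siteSwap hc hn]; rfl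
  · rw [add_dispSwap hc hn, add_dispSwap hc hn] at hg
    rcases siteSwap_lt hc hn i hab with hlt | ⟨e, rfl⟩
    · obtain ⟨ha, hb, hp⟩ := P.inv _ _ hlt hg
      rw [← sub_countSwap hc hn P.counts h0 h1 ha, ← countSwap_eq hc hn P.counts h0 hb] at hp
      simp only [apply_siteSwap hc hn] at ha hb hp
      exact ⟨ha, hb, hp⟩
    -- This is the exchanged pair: to be in the wrong order now, it would have had to be in the
    -- right order before.
    · exfalso
      have e1 := hc.congr e 1
      rw [siteSwap_left hc hn e, siteSwap_right hc hn e1, e1] at hg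
      have : c (a + 1 - 1) = c i := by simpa using e
      rw [this] at hg
      linarith
  · rw [sum_dispSwap, P.sum]

/-- The displacements `p` and `q` of the pair become `p - 1` and `q + 1`, which changes the sum by
`2 * (q - p + 1)`; this is negative since `q + 1 < p`. -/
theorem sum_sq_lt (hc : CycOrder I.graph c) (hn : 2 ≤ n) {i : ℤ}
    (h : i + 1 + δ (c (i + 1)) < i + δ (c i)) :
    ∑ v, dispSwap c i δ v ^ 2 < ∑ v, δ v ^ 2 := by
  have hne := hc.succ_ne hn i
  have key : ∀ v, dispSwap c i δ v ^ 2 = δ (Equiv.swap (c i) (c (i + 1)) v) ^ 2 +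
      ((if v = c i then 2 * δ (c (i + 1)) + 1 else 0) +
        (if v = c (i + 1) then 1 - 2 * δ (c i) else 0)) := by
    intro v
    unfold dispSwap
    by_cases e : v = c i
    · subst e; simp [hne]; ring
    by_cases e' : v = c (i + 1)
    · subst e'; simp [hne.symm]; ring
    · simp [e, e']
  simp only [key, Finset.sum_add_distrib]
  rw [Equiv.sum_comp (Equiv.swap (c i) (c (i + 1))) fun v => δ v ^ 2]
  simp
  linarith

theorem reachable (hc : CycOrder I.graph c) (hn : 2 ≤ n) (P : Plan I c ρ δ d N) :
    Relation.ReflTransGen I.RationalSwap ρ I.target := by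
  induction hk : (∑ v, δ v ^ 2).toNat using Nat.strong_induction_on generalizing ρ δ d N with
  | _ k ih =>
  by_cases h : ∀ i, i + δ (c i) ≤ i + 1 + δ (c (i + 1))
  · rw [P.eq_target hc hn h]
  · push Not at h
    obtain ⟨i, hi⟩ := h
    have hlt := sum_sq_lt hc hn hi
    have hnn : 0 ≤ ∑ v, dispSwap c i δ v ^ 2 := Finset.sum_nonneg fun _ _ => sq_nonneg _
    refine .head ?_ (ih _ (by omega) (P.swap hc hn hi) rfl)
    obtain ⟨h0, -, h2, h3⟩ := P.inv i (i + 1) (by omega) hi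
    -- No counter-clockwise object lies between neighbours, so their meeting edge is the one where
    -- they are.
    have : i - N i + N (i + 1) = i := by rw [P.counts i, h0]; simp
    rw [this] at h2 h3
    exact ⟨c i, c (i + 1), hc.adj_succ i, h2, h3, rfl⟩

end Plan

/-! ### Necessity: the form of every sequence of swaps -/

/-- What a sequence of rational swaps from `ρ` to the target looks like: `δ` records by how many
sites every object moves. Agents prefer their future objects to the present one; two objects that
have to pass each other do so at a determined edge, and agents on either side of that edge that
see both objects have opposite preferences between them. -/
structure Future {n : ℕ} (I : Inst n) (c : ℤ → Fin n) (ρ : Fin n ≃ Fin n) (δ : Fin n → ℤ) :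
    Prop where
  target : ∀ i, I.target (c (i + δ (c i))) = ρ (c i)
  sum : ∑ v, δ v = 0
  lt : ∀ v, δ v < n
  gt : ∀ v, -n < δ v
  visit : ∀ j x, (j < x ∧ x ≤ j + δ (c j) ∨ x < j ∧ j + δ (c j) ≤ x) →
    I.Prefers (c x) (ρ (c j)) (ρ (c x))
  -- All labellings compatible with the signs are admitted: an object that is at rest from now on
  -- may have arrived by a move in either direction, and a prepended swap then dictates its label.
  inv : ∀ d N, Counts c d N → (∀ v, 0 < δ v → d v = false) → (∀ v, δ v < 0 → d v = true) →
    ∀ a b, a < b → b + δ (c b) < a + δ (c a) → d (c a) = false ∧ d (c b) = true ∧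
      ∃ E, E = a - N a + N b ∧ a ≤ E ∧ b + δ (c b) ≤ E ∧ E + 1 ≤ b ∧ E + 1 ≤ a + δ (c a) ∧
      (∀ x, a ≤ x → b + δ (c b) ≤ x → x ≤ E → I.Prefers (c x) (ρ (c b)) (ρ (c a))) ∧
      (∀ x, E + 1 ≤ x → x ≤ b → x ≤ a + δ (c a) → I.Prefers (c x) (ρ (c a)) (ρ (c b)))

namespace Future

variable {n : ℕ} {I : Inst n} {c : ℤ → Fin n} {ρ : Fin n ≃ Fin n}

theorem refl (hn : 2 ≤ n) : Future I c I.target 0 where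
  target i := by simp
  sum := by simp
  lt v := by simp; omega
  gt v := by simp; omega
  visit j x h := by simp at h; omega
  inv d N _ _ _ a b h h' := by simp at h'; omega

/-- Induction step for prepending a swap. The field `visit` for the later swaps forbids the two
objects to return, which fixes their directions and bounds their displacements; all other pairs keep
their meeting edge. -/
theorem cons (hc : CycOrder I.graph c) (hn : 2 ≤ n) {i : ℤ} {δ' : Fin n → ℤ}
    (h0 : I.Prefers (c i) (ρ (c (i + 1))) (ρ (c i)))
    (h1 : I.Prefers (c (i + 1)) (ρ (c i)) (ρ (c (i + 1))))
    (F : Future I c ((Equiv.swap (c i) (c (i + 1))).trans ρ) δ') :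
    Future I c ρ (dispSwap c i δ') := by
  have hne := hc.succ_ne hn i
  set u := c i with hu
  set v := c (i + 1) with hv
  have hdu : dispSwap c i δ' u = δ' v + 1 := by
    simp [dispSwap, ← hu, ← hv, hne]
  have hdv : dispSwap c i δ' v = δ' u - 1 := by
    simp [dispSwap, ← hu, ← hv, hne.symm]
  have hdw : ∀ w, w ≠ u → w ≠ v → dispSwap c i δ' w = δ' w := by
    intro w e e'
    simp [dispSwap, ← hu, ← hv, e, e', Equiv.swap_apply_of_ne_of_ne e e']
  have hg := fun j => add_dispSwap hc hn i j δ'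
  have hρ : ∀ j, ρ (c j) = ((Equiv.swap u v).trans ρ) (c (siteSwap c i j)) := by
    intro j
    rw [apply_siteSwap hc hn, ← hu, ← hv]; simp
  -- The object that has just left `u` cannot come back: `u` would have to prefer it to what it was
  -- exchanged for. The next bound excludes a return the long way round, and the same holds for the
  -- object that has left `v`.
  have hv0 : 0 ≤ δ' v := by
    by_contra hlt
    have := F.visit (i + 1) i (.inr ⟨by omega, by rw [← hv]; omega⟩)
    simp [← hu, ← hv] at this
    exact h0.asymm this
  have hvn : δ' v + 1 < n := by
    by_contra hlt
    have := F.visit (i + 1) (i + n) (.inl ⟨by omega, by rw [← hv]; omega⟩)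
    simp [hc.add_period, ← hu, ← hv] at this
    exact h0.asymm this
  have hu0 : δ' u ≤ 0 := by
    by_contra hlt
    have := F.visit i (i + 1) (.inl ⟨by omega, by rw [← hu]; omega⟩)
    simp [← hu, ← hv] at this
    exact h1.asymm this
  have hun : -n < δ' u - 1 := by
    by_contra hlt
    have e : c (i + 1 - n) = v := by rw [hv, hc.eq_iff]; simp
    have := F.visit i (i + 1 - n) (.inr ⟨by omega, by rw [← hu]; omega⟩)
    simp [e, ← hu] at this
    exact h1.asymm this
  have hvisit : ∀ j x, (j < x ∧ x ≤ j + dispSwap c i δ' (c j) ∨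
      x < j ∧ j + dispSwap c i δ' (c j) ≤ x) → I.Prefers (c x) (ρ (c j)) (ρ (c x)) := by
    intro j x hx
    have himp : c x = u ∨ c x = v →
        I.Prefers (c x) (((Equiv.swap u v).trans ρ) (c x)) (ρ (c x)) := by
      rintro (e | e) <;> rw [e] <;> simpa
    -- Either `x` is reached by the first swap itself, and is then one of the two swapping agents,
    -- or it is visited during the rest of the journey.
    have hcase : (siteSwap c i j = x ∧ (c x = u ∨ c x = v)) ∨
        (siteSwap c i j < x ∧ x ≤ j + dispSwap c i δ' (c j) ∨
          x < siteSwap c i j ∧ j + dispSwap c i δ' (c j) ≤ x) := by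
      by_cases e : c j = u
      · rw [e, hdu] at hx
        rw [siteSwap_left hc hn e, e, hdu]
        by_cases ex : j + 1 = x
        · exact .inl ⟨ex, .inr (ex ▸ hc.congr e 1)⟩
        · right; omega
      by_cases e' : c j = v
      · rw [e', hdv] at hx
        rw [siteSwap_right hc hn e', e', hdv]
        by_cases ex : j - 1 = x
        · exact .inl ⟨ex, .inl (ex ▸ hc.pred_eq e')⟩
        · right; omega
      · rw [siteSwap_of_ne e e']; exact .inr hx
    rcases hcase with ⟨e, hx'⟩ | h
    · rw [hρ j, e]; exact himp hx'
    · rw [hg] at h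
      have h3 := F.visit _ _ h
      rw [← hρ] at h3
      by_cases hx' : c x = u ∨ c x = v
      · exact h3.trans (himp hx')
      · push Not at hx'
        simpa [Equiv.swap_apply_of_ne_of_ne hx'.1 hx'.2] using h3
  refine ⟨fun j => ?_, ?_, fun w => ?_, fun w => ?_, hvisit, ?_⟩
  · rw [hg, F.target, hρ]
  · rw [sum_dispSwap, F.sum]
  · by_cases e : w = u
    · rw [e, hdu]; exact hvn
    by_cases e' : w = v
    · rw [e', hdv]; omega
    · rw [hdw w e e']; exact F.lt w
  · by_cases e : w = u
    · rw [e, hdu]; omega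
    by_cases e' : w = v
    · rw [e', hdv]; exact hun
    · rw [hdw w e e']; exact F.gt w
  intro d N hN hpos hneg a b hab hgab
  have du : d u = false := hpos u (by omega)
  have dv : d v = true := hneg v (by omega)
  rcases siteSwap_lt hc hn i hab with hlt | ⟨e, rfl⟩
  · have hgab' := hgab
    rw [hg, hg] at hgab'
    obtain ⟨ha, hb, E, hE, h2, h3, h4, h5, h6, h7⟩ :=
      -- The labels travel with the objects; an object at rest after the swap receives the label of
      -- its first move.
      F.inv (d ∘ Equiv.swap u v) _ (counts_swap hc hn hN du dv) (fun w hw => by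
        by_cases e : w = u
        · rw [e] at hw; omega
        by_cases e' : w = v
        · rw [e']; simpa
        · simpa [Equiv.swap_apply_of_ne_of_ne e e'] using hpos w (by rwa [hdw w e e']))
      (fun w hw => by
        by_cases e : w = u
        · rw [e]; simpa
        by_cases e' : w = v
        · rw [e'] at hw; omega
        · simpa [Equiv.swap_apply_of_ne_of_ne e e'] using hneg w (by rwa [hdw w e e']))
        _ _ hlt hgab'
    rw [apply_siteSwap hc hn] at ha hb
    simp [← hu, ← hv] at ha hb
    rw [sub_countSwap hc hn hN du dv (by rwa [siteSwap_siteSwap hc hn]),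
      countSwap_eq hc hn hN du (by rwa [siteSwap_siteSwap hc hn]),
      siteSwap_siteSwap hc hn, siteSwap_siteSwap hc hn] at hE
    rw [← hg] at h3 h5 h6 h7
    rw [← hρ, ← hρ] at h6 h7
    have hta : a ≤ siteSwap c i a ∧ siteSwap c i a ≤ a + 1 := by
      by_cases e' : c a = v
      · rw [e', dv] at ha; simp at ha
      · unfold siteSwap; rw [← hv, if_neg e']; split_ifs <;> omega
    have htb : siteSwap c i b ≤ b ∧ b ≤ siteSwap c i b + 1 := by
      by_cases e' : c b = u
      · rw [e', du] at hb; simp at hb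
      · unfold siteSwap; rw [← hu, if_neg e']; split_ifs <;> omega
    refine ⟨ha, hb, E, hE, by omega, h3, by omega, h5, fun x hx hx2 hx3 => ?_,
      fun x hx hx2 hx3 => ?_⟩
    -- The one agent not covered by the remaining swaps is the one at `a`, which holds the clockwise
    -- object at present and is still to be visited by the other.
    · rcases eq_or_lt_of_le hx with rfl | hx
      · exact hvisit b a (.inr ⟨hab, hx2⟩)
      · exact h6 x (by omega) hx2 hx3
    · rcases eq_or_lt_of_le hx2 with rfl | hx2
      · exact hvisit a x (.inl ⟨hab, hx3⟩)
      · exact h7 x hx (by omega) hx3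
  · have e1 : c (a + 1) = v := hc.congr e 1
    have hNa := hN a
    rw [e, ← hu, du] at hNa
    simp at hNa
    rw [e1, e, hdu, hdv]
    refine ⟨du, dv, a, by omega, by omega, by omega, by omega, by omega, fun x hx _ hx' => ?_,
      fun x hx hx' _ => ?_⟩
    · obtain rfl : x = a := by omega
      rw [e]; exact h0
    · obtain rfl : x = a + 1 := by omega
      rw [e1]; exact h1

/-- Induction from the end of the sequence; a swap between adjacent agents is oriented so that it
exchanges the sites `i` and `i + 1`. -/
theorem exists_of_reachable (hc : CycOrder I.graph c) (hn : 2 ≤ n)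
    (h : Relation.ReflTransGen I.RationalSwap ρ I.target) : ∃ δ, Future I c ρ δ := by
  induction h using Relation.ReflTransGen.head_induction_on with
  | refl => exact ⟨0, refl hn⟩
  | head h _ ih =>
    obtain ⟨u, v, hadj, h0, h1, rfl⟩ := h
    obtain ⟨δ', F⟩ := ih
    obtain ⟨i, rfl⟩ := hc.surj u
    obtain ⟨j, rfl⟩ := hc.surj v
    rcases (hc.adj_iff i j).1 hadj with h | h
    · have : c j = c (i + 1) := by rw [hc.eq_iff]; convert h using 1; ring
      rw [this] at h0 h1 F
      exact ⟨_, F.cons hc hn h0 h1⟩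
    · have : c i = c (j + 1) := by rw [hc.eq_iff]; convert h using 1; ring
      rw [this] at h0 h1 F
      rw [Equiv.swap_comm] at F
      exact ⟨_, F.cons hc hn h1 h0⟩

end Future

/-! ### The two-satisfiability instance of a guess

Objects are named by their initial position `k < n` on the cycle. Object `k` has to advance by
`D k` positions clockwise, or by `n - D k` counter-clockwise, `R x k` is its rank for the agent at
position `x` (`0` if it is not on the list), and `cl (2 * k + d)` is the claimed number of
counter-clockwise objects at positions before `k`, for either direction `d` of `k`. -/

/-- Across the edge from `E` to `E + 1` the clockwise object `r` and the counter-clockwise object `q`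
can be exchanged. -/
def EdgeOk (n : ℕ) (R : ℕ → ℕ → ℕ) (E r q : ℕ) : Prop :=
  (0 < R (E % n) q ∧ R (E % n) q < R (E % n) r) ∧
    (0 < R ((E + 1) % n) r ∧ R ((E + 1) % n) r < R ((E + 1) % n) q)

/-- Direction `d` for object `k` and direction `e` for object `l` (where `k < l`) exclude each
other. -/
def Clash (n : ℕ) (D : ℕ → ℕ) (R : ℕ → ℕ → ℕ) (m : ℕ) (cl : ℕ → ℕ) (k d l e : ℕ) : Prop :=
  (d = e ∧ ¬ (k + D k < l + D l ∧ l + D l < k + D k + n)) ∨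
  -- This and the next three cases are the possible meetings of a clockwise object with translates
  -- of a counter-clockwise one: `k` with `l` and `l + n`, or `l` with `k + n` and `k + 2 * n`. Each
  -- further turn adds `m` counter-clockwise objects. The term `2 * n` keeps the truncated
  -- subtraction exact and vanishes modulo `n`.
  (d = 0 ∧ e = 1 ∧ l + D l < k + D k + n ∧
    ¬ EdgeOk n R (k + cl (2 * l + 1) + 2 * n - cl (2 * k)) k l) ∨
  (d = 0 ∧ e = 1 ∧ l + D l < k + D k ∧
    ¬ EdgeOk n R (k + cl (2 * l + 1) + 2 * n - cl (2 * k) + m) k l) ∨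
  (d = 1 ∧ e = 0 ∧ k + D k < l + D l ∧
    ¬ EdgeOk n R (l + cl (2 * k + 1) + 2 * n - cl (2 * l) + m) l k) ∨
  (d = 1 ∧ e = 0 ∧ k + D k + n < l + D l ∧
    ¬ EdgeOk n R (l + cl (2 * k + 1) + 2 * n - cl (2 * l) + 2 * m) l k) ∨
  -- The last two cases link the claims of neighbours around the cycle, so that claims chosen
  -- without a clash are prefix counts up to a common constant.
  (l = k + 1 ∧ cl (2 * k + d) + d ≠ cl (2 * l + e)) ∨
  (k = 0 ∧ l + 1 = n ∧ cl (2 * l + e) + e ≠ cl (2 * k + d) + m)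

/-- A choice of directions without clashes. -/
def Consistent (n : ℕ) (D : ℕ → ℕ) (R : ℕ → ℕ → ℕ) (m : ℕ) (cl : ℕ → ℕ) (x : ℕ → ℕ) : Prop :=
  (∀ k < n, x k < 2) ∧ ∀ l < n, ∀ k < l, ¬ Clash n D R m cl k (x k) l (x l)

/-- `j` may be the edge where the clockwise object `0` and the counter-clockwise object `k` meet. -/
def MeetsFirst (n : ℕ) (D : ℕ → ℕ) (R : ℕ → ℕ → ℕ) (k j : ℕ) : Prop :=
  j < D 0 ∧ k + D k ≤ j + n ∧ j + 1 ≤ k ∧ EdgeOk n R j 0 k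

/-- `E` may be the edge where the clockwise object `k` and the counter-clockwise object `1` meet. -/
def MeetsSecond (n : ℕ) (D : ℕ → ℕ) (R : ℕ → ℕ → ℕ) (k E : ℕ) : Prop :=
  k ≤ E ∧ 1 + D 1 ≤ E ∧ E + 1 ≤ k + D k ∧ E ≤ n ∧ EdgeOk n R E k 1

/-- The claims that are forced when object `0` moves clockwise and object `1` counter-clockwise. -/
structure ClaimSpec (n : ℕ) (D : ℕ → ℕ) (R : ℕ → ℕ → ℕ) (m : ℕ) (cl : ℕ → ℕ) : Prop where
  le : ∀ u < 2 * n, cl u ≤ 2 * n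
  zero : cl 0 = 0
  odd_far : ∀ k, 1 ≤ k → k < n → n + D 0 < k + D k →
    cl (2 * k + 1) = m - {l ∈ Finset.Ico k n | n + D 0 < l + D l}.card
  odd_near : ∀ k, 1 ≤ k → k < n → ¬ n + D 0 < k + D k → ∀ j, MeetsFirst n D R k j →
    (∀ j', MeetsFirst n D R k j' → j' = j) → cl (2 * k + 1) = j
  even_far : ∀ k, 2 ≤ k → k < n → k + D k < 1 + D 1 →
    cl (2 * k) = 1 + {l ∈ Finset.Ico 2 k | ¬ l + D l < 1 + D 1}.card
  even_near : ∀ k, 2 ≤ k → k < n → ¬ k + D k < 1 + D 1 → ∀ E, MeetsSecond n D R k E →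
    (∀ E', MeetsSecond n D R k E' → E' = E) → cl (2 * k) = k + m - E

/-- `D` lists the clockwise distances from the initial to the target positions. -/
def IsDisp {n : ℕ} (I : Inst n) (c : ℤ → Fin n) (D : ℕ → ℕ) : Prop :=
  ∀ k < n, D k < n ∧ I.target (c ((k : ℤ) + D k)) = I.init (c k)

open Classical in
/-- `R` lists the ranks of the objects for the agents, both by position. -/
def IsRank {n : ℕ} (I : Inst n) (c : ℤ → Fin n) (R : ℕ → ℕ → ℕ) : Prop :=
  ∀ x < n, ∀ l < n, R x l = if I.init (c l) ∈ I.pref (c x) then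
    (I.pref (c x)).idxOf (I.init (c l)) + 1 else 0

/-! ### Consistent directions give a sequence of swaps -/

section

variable {n : ℕ} {I : Inst n} {c : ℤ → Fin n} {D : ℕ → ℕ} {R : ℕ → ℕ → ℕ} {m : ℕ}
  {cl : ℕ → ℕ} {x : ℕ → ℕ}

theorem IsRank.prefers_iff (hR : IsRank I c R) {y a b : ℕ} (hy : y < n) (ha : a < n)
    (hb : b < n) : 0 < R y a ∧ R y a < R y b ↔
      I.Prefers (c y) (I.init (c a)) (I.init (c b)) := by
  rw [hR y hy a ha, hR y hy b hb]
  unfold Inst.Prefers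
  split_ifs <;> simp [*]

theorem edgeOk_iff (hc : CycOrder I.graph c) (hR : IsRank I c R) {E r q : ℕ} (hr : r < n)
    (hq : q < n) : EdgeOk n R E r q ↔
      I.Prefers (c E) (I.init (c q)) (I.init (c r)) ∧
      I.Prefers (c ((E : ℤ) + 1)) (I.init (c r)) (I.init (c q)) := by
  have hn : 0 < n := by omega
  unfold EdgeOk
  rw [hR.prefers_iff (Nat.mod_lt _ hn) hq hr, hR.prefers_iff (Nat.mod_lt _ hn) hr hq]
  push_cast
  rw [hc.emod, hc.emod]

theorem CycOrder.natCast_injOn {G : SimpleGraph (Fin n)} (hc : CycOrder G c) {k l : ℕ}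
    (hk : k < n) (hl : l < n) (h : c k = c l) : k = l := by
  rw [hc.eq_iff] at h
  have := Int.eq_zero_of_abs_lt_dvd h (by rw [abs_lt]; omega)
  omega

theorem CycOrder.exists_nat {G : SimpleGraph (Fin n)} (hc : CycOrder G c) (v : Fin n) :
    ∃ k < n, c (k : ℤ) = v := by
  obtain ⟨i, rfl⟩ := hc.surj v
  have hn : (0 : ℤ) < n := by have := (c i).pos; omega
  refine ⟨(i % n).toNat, ?_, ?_⟩
  · have := Int.emod_lt_of_pos i hn; have := Int.emod_nonneg i hn.ne'; omega
  · rw [Int.toNat_of_nonneg (Int.emod_nonneg i hn.ne'), hc.emod]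

theorem CycOrder.sum_eq {G : SimpleGraph (Fin n)} (hc : CycOrder G c) (f : Fin n → ℤ) :
    ∑ v, f v = ∑ k ∈ Finset.range n, f (c k) := by
  symm
  refine Finset.sum_bij (fun k _ => c k) (fun _ _ => Finset.mem_univ _) (fun k hk l hl h => ?_)
    (fun v _ => ?_) fun _ _ => rfl
  · exact hc.natCast_injOn (by simpa using hk) (by simpa using hl) h
  · obtain ⟨k, hk, h⟩ := hc.exists_nat v
    exact ⟨k, by simpa using hk, h⟩

theorem exists_counts (c : ℤ → Fin n) (d : Fin n → Bool) (N₀ : ℤ) :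
    ∃ N, Counts c d N ∧ N 0 = N₀ := by
  let f : ℤ → ℤ := fun i => if d (c i) then 1 else 0
  refine ⟨fun i => N₀ + if 0 ≤ i then ∑ k ∈ Finset.range i.toNat, f k
    else - ∑ k ∈ Finset.range (-i).toNat, f (-(k : ℤ) - 1), fun i => ?_, by simp⟩
  change _ = _ + f i
  beta_reduce
  rcases lt_trichotomy i (-1) with h | rfl | h
  · rw [if_neg (by omega), if_neg (by omega)]
    obtain ⟨k, rfl⟩ : ∃ k : ℕ, i = -(k : ℤ) - 1 - 1 := ⟨(-i - 2).toNat, by omega⟩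
    have h1 : (-(-(k : ℤ) - 1 - 1)).toNat = k + 1 + 1 := by omega
    have h2 : (-(-(k : ℤ) - 1 - 1 + 1)).toNat = k + 1 := by omega
    rw [h1, h2, Finset.sum_range_succ _ (k + 1)]
    push_cast
    rw [show -((k : ℤ) + 1) - 1 = -(k : ℤ) - 1 - 1 by ring]
    ring
  · simp
  · rw [if_pos (by omega), if_pos (by omega), Int.toNat_add (by omega) (by omega)]
    simp [Finset.sum_range_succ, show max i 0 = i by omega]
    ring

theorem Counts.natCast {d : Fin n → Bool} {N : ℤ → ℤ} (hN : Counts c d N) (k : ℕ) :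
    N k = N 0 + ∑ l ∈ Finset.range k, if d (c l) then 1 else 0 := by
  induction k with
  | zero => simp
  | succ k ih => rw [Finset.sum_range_succ, ← add_assoc, ← ih]; push_cast; exact hN k

/-- The increments of `N` are periodic, so every turn contributes the same number. -/
theorem Counts.add_period {G : SimpleGraph (Fin n)} (hc : CycOrder G c) {d : Fin n → Bool}
    {N : ℤ → ℤ} (hN : Counts c d N) (i : ℤ) : N (i + n) = N i + (N n - N 0) := by
  have key : ∀ j : ℤ, N (j + 1 + n) - N (j + 1) = N (j + n) - N j := fun j => by
    have h1 := hN j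
    have h2 := hN (j + n)
    rw [hc.add_period] at h2
    rw [show j + 1 + n = j + n + 1 by ring]
    omega
  have : N (i + n) - N i = N n - N 0 := by
    induction i using Int.induction_on with
    | zero => simp
    | succ k ih => rw [key, ih]
    | pred k ih => rw [← key, sub_add_cancel, ih]
  omega

theorem Counts.add_mul_period {G : SimpleGraph (Fin n)} (hc : CycOrder G c) {d : Fin n → Bool}
    {N : ℤ → ℤ} (hN : Counts c d N) (i j : ℤ) : N (i + n * j) = N i + (N n - N 0) * j := by
  induction j using Int.induction_on with
  | zero => simp
  | succ k ih =>
    rw [show i + n * ((k : ℤ) + 1) = i + n * k + n by ring, hN.add_period hc, ih]; ring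
  | pred k ih =>
    have := hN.add_period hc (i + n * (-(k : ℤ) - 1))
    rw [show i + n * (-(k : ℤ) - 1) + n = i + n * -(k : ℤ) by ring, ih] at this
    linarith

/-- The map `k ↦ (k + D k) % n` permutes the positions, so `∑ (k + D k)` and `∑ k` agree modulo `n`.
-/
theorem IsDisp.dvd_sum (hc : CycOrder I.graph c) (hD : IsDisp I c D) :
    n ∣ ∑ k ∈ Finset.range n, D k := by
  rcases Nat.eq_zero_or_pos n with rfl | hn
  · simp
  have h1 : ∑ k ∈ Finset.range n, (k + D k) % n = ∑ k ∈ Finset.range n, k := by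
    have hinj : Set.InjOn (fun k => (k + D k) % n) (Finset.range n : Set ℕ) := by
      intro k hk l hl h
      simp only [Finset.coe_range, Set.mem_Iio] at hk hl h
      have e : c ((k : ℤ) + D k) = c ((l : ℤ) + D l) := by
        rw [← hc.emod, ← hc.emod (_ + _)]
        congr 1
        exact_mod_cast h
      have h2 := (hD k hk).2
      rw [e, (hD l hl).2] at h2
      exact (hc.natCast_injOn hl hk (I.init.injective h2)).symm
    have himg : (Finset.range n).image (fun k => (k + D k) % n) = Finset.range n := by
      apply Finset.eq_of_subset_of_card_le
      · intro y
        simp only [Finset.mem_image, Finset.mem_range, forall_exists_index, and_imp]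
        rintro k _ rfl
        exact Nat.mod_lt _ hn
      · rw [Finset.card_image_of_injOn hinj]
    conv_rhs => rw [← himg, Finset.sum_image hinj]
  have h2 : ∑ k ∈ Finset.range n, (k + D k) ≡ ∑ k ∈ Finset.range n, k [MOD n] := by
    rw [← h1, Nat.ModEq, Finset.sum_nat_mod]
  rw [Finset.sum_add_distrib] at h2
  have h3 : ∑ k ∈ Finset.range n, k + ∑ k ∈ Finset.range n, D k ≡
      ∑ k ∈ Finset.range n, k + 0 [MOD n] := by simpa using h2
  exact (Nat.modEq_zero_iff_dvd).1 (Nat.ModEq.add_left_cancel' _ h3)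

/-- Consistent directions yield a sequence of rational swaps. -/
theorem Consistent.isYes (hn : 2 ≤ n) (hc : CycOrder I.graph c) (hD : IsDisp I c D)
    (hR : IsRank I c R) (hm : m = (∑ k ∈ Finset.range n, D k) / n) (hcl : ∀ u < 2 * n, cl u ≤ 2 * n)
    (hx : Consistent n D R m cl x) : I.IsYes := by
  obtain ⟨hx2, hx⟩ := hx
  choose idx hidx hcidx using hc.exists_nat
  have hidxc : ∀ k < n, idx (c k) = k := fun k hk =>
    hc.natCast_injOn (hidx _) hk (hcidx _)
  -- The count starts at whatever is claimed for object `0`; only differences of `N` enter the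
  -- meeting edges.
  obtain ⟨N, hN, hN0⟩ := exists_counts c (fun v => decide (x (idx v) = 1)) (cl (2 * 0 + x 0))
  have hNk : ∀ k < n, N k = cl (2 * k + x k) := by
    intro k hk
    induction k with
    | zero => simpa using hN0
    | succ k ih =>
      have h1 := hN k
      beta_reduce at h1
      rw [hidxc k (by omega), ih (by omega)] at h1
      have h2 := hx (k + 1) hk k (by omega)
      have h3 : cl (2 * k + x k) + x k = cl (2 * (k + 1) + x (k + 1)) := by
        by_contra h4
        exact h2 (.inr <| .inr <| .inr <| .inr <| .inr <| .inl ⟨rfl, h4⟩)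
      have := hx2 k (by omega)
      push_cast
      rw [h1, ← h3]
      push_cast
      congr 1
      obtain h | h : x k = 0 ∨ x k = 1 := by omega
      all_goals simp [h]
  have hNn : N n - N 0 = m := by
    obtain ⟨p, rfl⟩ : ∃ p, n = p + 1 := ⟨n - 1, by omega⟩
    have h1 := hN p
    beta_reduce at h1
    rw [hidxc p (by omega), hNk p (by omega)] at h1
    have h3 : cl (2 * p + x p) + x p = cl (2 * 0 + x 0) + m := by
      by_contra h4
      exact hx p (by omega) 0 (by omega)
        (.inr <| .inr <| .inr <| .inr <| .inr <| .inr ⟨rfl, rfl, h4⟩)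
    have := hx2 p (by omega)
    push_cast
    rw [h1, hN0]
    obtain h | h : x p = 0 ∨ x p = 1 := by omega
    all_goals simp [h] at h3 ⊢; omega
  have hmod : ∀ a : ℤ, ∃ k < n, ∃ s : ℤ, a = k + n * s := by
    intro a
    have hn0 : (0 : ℤ) < n := by omega
    have h1 := Int.emod_lt_of_pos a hn0
    have h2 := Int.emod_nonneg a hn0.ne'
    exact ⟨(a % n).toNat, by omega, a / n, by rw [Int.toNat_of_nonneg h2, Int.emod_add_mul_ediv]⟩
  -- Direction `1` replaces the clockwise distance `D` by `D - n`.
  refine Plan.reachable (δ := fun v => (D (idx v) : ℤ) - n * x (idx v)) hc hn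
    ⟨hN, fun i => ?_, fun a b hab hg => ?_, ?_⟩
  · obtain ⟨k, hk, s, rfl⟩ := hmod i
    simp only [hc.add_mul_period, hidxc k hk]
    rw [← (hD k hk).2]
    congr 1
    rw [hc.eq_iff]
    exact ⟨s - x k, by ring⟩
  · obtain ⟨k, hk, s, rfl⟩ := hmod a
    obtain ⟨l, hl, t, rfl⟩ := hmod b
    simp only [hc.add_mul_period, hidxc k hk, hidxc l hl] at hg ⊢
    rw [hN.add_mul_period hc, hN.add_mul_period hc, hNn, hNk k hk, hNk l hl]
    obtain ⟨j, rfl⟩ : ∃ j, t = s + j := ⟨t - s, by ring⟩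
    have hab' : (k : ℤ) < l + n * j := by linarith
    have hg' : (l : ℤ) + D l - n * x l + n * j < k + D k - n * x k := by linarith
    clear hab hg
    have hj0 : 0 ≤ j := by
      by_contra hj
      have : (n : ℤ) * j ≤ n * (-1) := mul_le_mul_of_nonneg_left (by omega) (by omega)
      omega
    have hnj : 0 ≤ (n : ℤ) * j := by positivity
    have hDk := (hD k hk).1
    have hDl := (hD l hl).1
    have hxk := hx2 k hk
    have hxl := hx2 l hl
    -- Here `e` is the number of turns between `k` and the translate of `l` that it meets.
    have fin : x k = 0 → x l = 1 → (∃ e : ℕ, (e : ℤ) = j ∧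
        EdgeOk n R (k + cl (2 * l + 1) + 2 * n - cl (2 * k) + e * m) k l) →
        decide (x k = 1) = false ∧ decide (x l = 1) = true ∧
        I.Prefers (c (k + n * s - (cl (2 * k + x k) + m * s) + (cl (2 * l + x l) + m * (s + j))))
          (I.init (c l)) (I.init (c k)) ∧
        I.Prefers (c (k + n * s - (cl (2 * k + x k) + m * s) + (cl (2 * l + x l) + m * (s + j)) + 1))
          (I.init (c k)) (I.init (c l)) := by
      rintro h0 h1 ⟨e, rfl, he⟩
      refine ⟨by simp [h0], by simp [h1], ?_⟩
      rw [edgeOk_iff hc hR hk hl] at he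
      have hle := hcl (2 * k) (by omega)
      rw [Nat.cast_add, Nat.cast_sub (by omega)] at he
      push_cast at he
      rw [h0, h1, add_zero]
      convert he using 2
      all_goals
        rw [hc.eq_iff]
        -- The sites differ by `n * s` from the translation of the pair and by the `2 * n` added
        -- against truncation.
        exact ⟨s - 2, by ring⟩
    rcases lt_trichotomy k l with hkl | rfl | hkl
    · have hcls := hx l hl k hkl
      obtain h0 | h0 : x k = 0 ∨ x k = 1 := by omega
      all_goals obtain h1 | h1 : x l = 0 ∨ x l = 1 := by omega
      all_goals rw [h0, h1] at hg' hcls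
      · exfalso
        apply hcls
        left
        refine ⟨rfl, fun h => ?_⟩
        push_cast at hg'
        omega
      · apply fin h0 h1
        push_cast at hg'
        -- Since `k < l` and `D k < n`, the destination of `k` lies before `l + n`, which leaves two
        -- translates of `l` to be met.
        have hj2 : j < 2 := by
          by_contra hj
          have : (n : ℤ) * 2 ≤ n * j := mul_le_mul_of_nonneg_left (by omega) (by omega)
          omega
        obtain rfl | rfl : j = 0 ∨ j = 1 := by omega
        · refine ⟨0, rfl, ?_⟩
          by_contra h
          exact hcls (.inr <| .inl ⟨rfl, rfl, by omega, by simpa using h⟩)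
        · refine ⟨1, rfl, ?_⟩
          by_contra h
          exact hcls (.inr <| .inr <| .inl ⟨rfl, rfl, by omega, by simpa using h⟩)
      · exfalso
        push_cast at hg'
        omega
      · exfalso
        apply hcls
        left
        refine ⟨rfl, fun h => ?_⟩
        push_cast at hg'
        omega
    · exfalso
      omega
    · have hcls := hx k hk l hkl
      have hj1 : 1 ≤ j := by
        by_contra hj
        obtain rfl : j = 0 := by omega
        omega
      have hnj' : (n : ℤ) * 1 ≤ n * j := mul_le_mul_of_nonneg_left hj1 (by omega)
      obtain h0 | h0 : x k = 0 ∨ x k = 1 := by omega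
      all_goals obtain h1 | h1 : x l = 0 ∨ x l = 1 := by omega
      all_goals rw [h0, h1] at hg' hcls
      · exfalso
        apply hcls
        left
        refine ⟨rfl, fun h => ?_⟩
        push_cast at hg'
        omega
      · apply fin h0 h1
        push_cast at hg'
        have hj2 : j < 3 := by
          by_contra hj
          have : (n : ℤ) * 3 ≤ n * j := mul_le_mul_of_nonneg_left (by omega) (by omega)
          omega
        obtain rfl | rfl : j = 1 ∨ j = 2 := by omega
        · refine ⟨1, rfl, ?_⟩
          by_contra h
          exact hcls (.inr <| .inr <| .inr <| .inl ⟨rfl, rfl, by omega, by simpa using h⟩)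
        · refine ⟨2, rfl, ?_⟩
          by_contra h
          exact hcls (.inr <| .inr <| .inr <| .inr <| .inl ⟨rfl, rfl, by omega, h⟩)
      · exfalso
        push_cast at hg'
        omega
      · exfalso
        apply hcls
        left
        refine ⟨rfl, fun h => ?_⟩
        push_cast at hg'
        omega
  · rw [hc.sum_eq]
    have h1 : ∑ k ∈ Finset.range n, ((D (idx (c k)) : ℤ) - n * x (idx (c k))) =
        ∑ k ∈ Finset.range n, (D k : ℤ) - n * ∑ k ∈ Finset.range n, (x k : ℤ) := by
      rw [Finset.mul_sum, ← Finset.sum_sub_distrib]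
      exact Finset.sum_congr rfl fun k hk => by rw [hidxc k (by simpa using hk)]
    -- The clashes of neighbouring claims have already fixed the number of counter-clockwise objects
    -- as `N n - N 0 = m`.
    have h2 : ∑ k ∈ Finset.range n, (x k : ℤ) = m := by
      rw [← hNn, hN.natCast, add_sub_cancel_left]
      refine Finset.sum_congr rfl fun k hk => ?_
      have hk' : k < n := by simpa using hk
      rw [hidxc k hk']
      have := hx2 k hk'
      obtain h | h : x k = 0 ∨ x k = 1 := by omega
      all_goals simp [h]
    rw [h1, h2, hm]
    have := Nat.mul_div_cancel' (hD.dvd_sum hc)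
    rw [sub_eq_zero]
    exact_mod_cast this.symm

end

/-! ### A sequence of swaps gives consistent directions for the right guess -/

section

variable {n : ℕ} {I : Inst n} {c : ℤ → Fin n} {D : ℕ → ℕ} {R : ℕ → ℕ → ℕ} {m : ℕ}
  {cl : ℕ → ℕ} {ρ : Fin n ≃ Fin n} {δ : Fin n → ℤ}

theorem Future.injective (F : Future I c ρ δ) {i j : ℤ} (h : i + δ (c i) = j + δ (c j)) :
    i = j := by
  have h1 := F.target i
  rw [h, F.target j] at h1
  rw [ρ.injective h1] at h
  linarith

theorem Future.shift (F : Future I c ρ δ) (s : ℤ) : Future I (fun i => c (s + i)) ρ δ where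
  target i := by simpa [add_assoc] using F.target (s + i)
  sum := F.sum
  lt := F.lt
  gt := F.gt
  visit j x h := F.visit (s + j) (s + x) (by omega)
  inv d N hN hp hm a b hab hg := by
    have hN' : Counts c d fun i => N (i - s) := fun i => by
      have := hN (i - s)
      beta_reduce at this ⊢
      rw [add_sub_cancel] at this
      rw [← this]; ring_nf
    obtain ⟨h1, h2, E, hE, h3, h4, h5, h6, h7, h8⟩ :=
      F.inv d _ hN' hp hm (s + a) (s + b) (by omega) (by omega)
    simp only [add_sub_cancel_left] at hE
    refine ⟨h1, h2, E - s, by omega, by omega, by omega, by omega, by omega, fun x hx hx' hx'' => ?_,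
      fun x hx hx' hx'' => ?_⟩
    · exact h7 _ (by omega) (by omega) (by omega)
    · exact h8 _ (by omega) (by omega) (by omega)

/-- Both sides are congruent modulo `n` by the target, and `-n < δ < n` leaves only one multiple of
`n`. -/
theorem Future.natCast_disp (hc : CycOrder I.graph c) (hD : IsDisp I c D)
    (F : Future I c I.init δ) {k : ℕ} (hk : k < n) :
    (D k : ℤ) = δ (c k) + n * if δ (c k) < 0 then 1 else 0 := by
  obtain ⟨h1, h2⟩ := hD k hk
  rw [← F.target k, I.target.injective.eq_iff, hc.eq_iff] at h2
  have h3 := F.lt (c k)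
  have h4 := F.gt (c k)
  have h5 : (n : ℤ) ∣ D k - (δ (c k) + n * if δ (c k) < 0 then 1 else 0) := by
    have : (D k : ℤ) - (δ (c k) + n * if δ (c k) < 0 then 1 else 0) =
      (k + D k - (k + δ (c k))) - n * if δ (c k) < 0 then 1 else 0 := by ring
    rw [this]
    exact dvd_sub h2 (dvd_mul_right _ _)
  have := Int.eq_zero_of_abs_lt_dvd h5 (by rw [abs_lt]; split_ifs <;> constructor <;> omega)
  omega

/-- A sequence of rational swaps in which object `0` moves clockwise and object `1` moves
counter-clockwise yields consistent directions. -/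
theorem Future.exists_consistent (hn : 3 ≤ n) (hc : CycOrder I.graph c) (hD : IsDisp I c D)
    (hR : IsRank I c R) (hm : m = (∑ k ∈ Finset.range n, D k) / n) (hcl : ClaimSpec n D R m cl)
    (F : Future I c I.init δ) (h0 : 0 ≤ δ (c 0)) (h1 : δ (c 1) < 0) :
    ∃ x, Consistent n D R m cl x := by
  let x : ℕ → ℕ := fun k => if δ (c k) < 0 then 1 else 0
  have hx2 : ∀ k, x k < 2 := fun k => by simp only [x]; split_ifs <;> omega
  have hx1 : ∀ k, x k = 1 ↔ δ (c k) < 0 := fun k => by simp [x]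
  have hx0 : ∀ k, x k = 0 ↔ 0 ≤ δ (c k) := fun k => by simp [x]
  have hDx : ∀ k < n, (D k : ℤ) = δ (c k) + n * x k := fun k hk => by
    rw [F.natCast_disp hc hD hk]; simp [x]
  obtain ⟨N, hN, hN0⟩ := exists_counts c (fun v => decide (δ v < 0)) 0
  let S : ℕ → ℕ := fun k => ∑ l ∈ Finset.range k, x l
  have hNS : ∀ k : ℕ, N k = S k := by
    intro k
    rw [hN.natCast, hN0]
    simp [S, x]
  -- Zero total displacement turns `D = δ + n * x` into `∑ D = n * ∑ x`.
  have hmS : m = S n := by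
    have h2 := F.sum
    rw [hc.sum_eq] at h2
    have h3 : ∑ k ∈ Finset.range n, (D k : ℤ) =
        ∑ k ∈ Finset.range n, (δ (c k) + n * x k) :=
      Finset.sum_congr rfl fun k hk => hDx k (by simpa using hk)
    rw [Finset.sum_add_distrib, h2, zero_add, ← Finset.mul_sum] at h3
    have h4 : ∑ k ∈ Finset.range n, D k = n * S n := by exact_mod_cast h3
    rw [hm, h4, Nat.mul_div_cancel_left _ (by omega)]
  have hNn : N n - N 0 = m := by rw [hNS, hN0, hmS]; simp
  have hinv := F.inv _ N hN (fun v hv => by simp; omega) (fun v hv => by simpa using hv)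
  simp only [decide_eq_false_iff_not, decide_eq_true_eq, not_lt] at hinv
  have hS0 : S 0 = 0 := by simp [S]
  have hx00 : x 0 = 0 := by rw [hx0]; exact_mod_cast h0
  have hx11 : x 1 = 1 := by rw [hx1]; exact_mod_cast h1
  have hS1 : S 1 = 0 := by simp [S, hx00]
  have hSs : ∀ k, S (k + 1) = S k + x k := fun k => Finset.sum_range_succ _ _
  have hSI : ∀ a b, a ≤ b → S b = S a + ∑ l ∈ Finset.Ico a b, x l := fun a b hab => by
    simp only [S, Finset.range_eq_Ico]
    rw [Finset.sum_Ico_consecutive _ (Nat.zero_le _) hab]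
  have hinj : ∀ k l : ℕ, ∀ j : ℤ, k + δ (c k) = l + n * j + δ (c l) → (k : ℤ) = l + n * j := by
    intro k l j h
    apply F.injective
    rw [hc.add_mul_period]; exact h
  have hpos : ∀ k j : ℕ, N (k + n * j) = S k + m * j := fun k j => by
    rw [hN.add_mul_period hc, hNn, hNS]
  -- Only the claim for the actual direction of each object has to be right.
  have hclaim : ∀ k < n, cl (2 * k + x k) = S k := by
    intro k hk
    have hDk := hDx k hk
    have hD0 := hDx 0 (by omega)
    have hD1 := hDx 1 (by omega)
    rw [hx00] at hD0
    rw [hx11] at hD1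
    simp only [Nat.cast_zero, Nat.cast_one] at hD0 hD1
    obtain e | e : x k = 0 ∨ x k = 1 := by have := hx2 k; omega
    · rw [e] at hDk ⊢
      rcases Nat.eq_zero_or_pos k with rfl | hk0
      · simp [hcl.zero, hS0]
      have hk2 : 2 ≤ k := by
        by_contra h
        obtain rfl : k = 1 := by omega
        omega
      -- The clockwise object `k` ends at `k + D k` and the translate of object `1` from site `n +
      -- 1` ends at `1 + D 1`. If these are in order, consider `l` between `1` and `k`: with `l + D
      -- l < 1 + D 1` it moves clockwise, or it would overtake `1`; otherwise it moves
      -- counter-clockwise, or it would overtake `k`.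
      by_cases hfar : k + D k < 1 + D 1
      · rw [add_zero, hcl.even_far k hk2 hk hfar, hSI 2 k hk2, hSs, hS1, hx11,
          Finset.card_filter]
        congr 1
        apply Finset.sum_congr rfl
        intro l hl
        rw [Finset.mem_Ico] at hl
        have hDl := hDx l (by omega)
        obtain e' | e' : x l = 0 ∨ x l = 1 := by have := hx2 l; omega
        · rw [e', if_neg]
          intro hfl
          rw [e'] at hDl
          have := (hinv l k (by omega) (by push_cast at *; omega)).2.1
          rw [← hx1] at this
          omega
        · rw [e', if_pos]
          intro hfl
          rw [e'] at hDl
          have := (hinv 1 l (by omega) (by push_cast at *; omega)).1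
          omega
      · have hne : (k : ℤ) + δ (c k) ≠ ((1 : ℕ) : ℤ) + n * (1 : ℤ) + δ (c (1 : ℕ)) := fun h => by
          have := hinj k 1 1 h
          omega
        push_cast at hne
        -- Here `k` meets the translate of object `1` at `n + 1`, where `N` equals `m`; thus `E = k
        -- - S k + m`, and the edge determines `S k`.
        obtain ⟨-, -, E, hE, i1, i2, i3, i4, i5, i6⟩ := hinv k (1 + n) (by omega) (by
          rw [hc.add_period]; omega)
        rw [hc.add_period] at i2 i5 i6
        have hp := hpos 1 1
        push_cast at hp
        rw [mul_one, hS1, mul_one] at hp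
        rw [hp, hNS] at hE
        lift E to ℕ using by omega
        have ok : EdgeOk n R E k 1 := by
          rw [edgeOk_iff hc hR hk (by omega)]
          exact ⟨i5 _ (by omega) (by omega) (by omega), i6 _ (by omega) (by omega) (by omega)⟩
        rw [add_zero, hcl.even_near k hk2 hk hfar E
          ⟨by omega, by omega, by omega, by omega, ok⟩ ?_]
        · omega
        -- The edge is unique: the agents that see both objects prefer object `1` up to `E` and `k`
        -- beyond, so at any other edge one of the two agents has the wrong preference.
        · rintro j ⟨j1, j2, j3, j4, j5⟩
          rw [edgeOk_iff hc hR hk (by omega)] at j5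
          rcases lt_trichotomy j E with hj | hj | hj
          · exact (j5.2.asymm (i5 (j + 1) (by omega) (by omega) (by omega))).elim
          · exact hj
          · exact (j5.1.asymm (i6 j (by omega) (by omega) (by omega))).elim
    · rw [e] at hDk ⊢
      have hk1 : 1 ≤ k := by
        by_contra h
        obtain rfl : k = 0 := by omega
        omega
      -- If the counter-clockwise object `k` stays ahead of object `0`, then every counter-clockwise
      -- `l` from `k` on does so too, whereas a clockwise `l` with `n + D 0 < l + D l` would
      -- overtake the translate of object `0` at `n`.
      by_cases hfar : n + D 0 < k + D k
      · rw [hcl.odd_far k hk1 hk hfar, hmS, hSI k n hk.le, Finset.card_filter]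
        have : ∑ l ∈ Finset.Ico k n, x l =
            ∑ l ∈ Finset.Ico k n, if n + D 0 < l + D l then 1 else 0 := by
          apply Finset.sum_congr rfl
          intro l hl
          rw [Finset.mem_Ico] at hl
          have hDl := hDx l (by omega)
          obtain e' | e' : x l = 0 ∨ x l = 1 := by have := hx2 l; omega
          · rw [e', if_neg]
            intro hfl
            rw [e'] at hDl
            have hp := hc.add_period 0
            rw [zero_add] at hp
            have := (hinv l n (by omega) (by rw [hp]; push_cast at *; omega)).2.1
            rw [hp] at this
            omega
          · rw [e', if_pos]
            by_contra hfl
            rw [e'] at hDl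
            rcases eq_or_lt_of_le hl.1 with rfl | hlk
            · exact hfl hfar
            have := (hinv k l (by omega) (by push_cast at *; omega)).1
            rw [← hx0] at this
            omega
        rw [this]; simp
      · have hne : (k : ℤ) + δ (c k) ≠ ((0 : ℕ) : ℤ) + n * (0 : ℤ) + δ (c (0 : ℕ)) := fun h => by
          have := hinj k 0 0 h
          omega
        push_cast at hne
        -- The count starts with `0` at the clockwise object `0`, so this meeting edge is `S k`
        -- itself.
        obtain ⟨-, -, E, hE, i1, i2, i3, i4, i5, i6⟩ := hinv 0 k (by omega) (by omega)
        rw [hN0, hNS] at hE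
        obtain rfl : E = S k := by omega
        have ok : EdgeOk n R (S k) 0 k := by
          rw [edgeOk_iff hc hR (by omega) hk]
          exact ⟨i5 _ (by omega) (by omega) (by omega), i6 _ (by omega) (by omega) (by omega)⟩
        refine hcl.odd_near k hk1 hk hfar _ ⟨by omega, by omega, by omega, ok⟩ ?_
        rintro j ⟨j2, j3, j4, j5⟩
        rw [edgeOk_iff hc hR (by omega) hk] at j5
        rcases lt_trichotomy j (S k) with hj | hj | hj
        · exact (j5.2.asymm (i5 (j + 1) (by omega) (by omega) (by omega))).elim
        · exact hj
        · exact (j5.1.asymm (i6 j (by omega) (by omega) (by omega))).elim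
  have hedge : ∀ a b j : ℕ, a < n → b < n → x a = 0 → x b = 1 → (a : ℤ) < b + n * j →
      (b : ℤ) + n * j + δ (c b) < a + δ (c a) →
      EdgeOk n R (a + cl (2 * b + 1) + 2 * n - cl (2 * a) + j * m) a b := by
    intro a b j ha hb e0 e1 hab hg
    obtain ⟨-, -, E, hE, i1, i2, i3, i4, i5, i6⟩ := hinv a (b + n * j) hab (by
      rw [hc.add_mul_period]; exact hg)
    rw [hc.add_mul_period] at i2 i5 i6
    rw [hpos, hNS] at hE
    have ca := hclaim a ha
    have cb := hclaim b hb
    rw [e0, add_zero] at ca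
    rw [e1] at cb
    have hle := hcl.le (2 * a) (by omega)
    rw [edgeOk_iff hc hR ha hb, cb, Nat.cast_add, Nat.cast_sub (by omega), ca]
    have e : (((a + S b + 2 * n : ℕ) : ℤ) - S a + (j * m : ℕ)) = E + n * 2 := by
      rw [hE]; push_cast; ring
    rw [e, show E + n * 2 + 1 = E + 1 + n * 2 by ring, hc.add_mul_period, hc.add_mul_period]
    exact ⟨i5 _ (by omega) (by omega) (by omega), i6 _ (by omega) (by omega) (by omega)⟩
  refine ⟨x, fun k _ => hx2 k, fun l hl k hkl => ?_⟩
  have hDk := hDx k (by omega)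
  have hDl := hDx l hl
  rintro (⟨e, h⟩ | ⟨e, e', h, h'⟩ | ⟨e, e', h, h'⟩ | ⟨e, e', h, h'⟩ | ⟨e, e', h, h'⟩ | ⟨e, h⟩ |
    ⟨rfl, rfl, h⟩)
  -- Objects with the same direction keep their order, both as they are numbered and across the
  -- period.
  · apply h
    constructor
    · by_contra hlt
      have hne : (k : ℤ) + δ (c k) ≠ (l : ℤ) + n * (0 : ℤ) + δ (c l) := fun h => by
        have := hinj k l 0 h
        omega
      rw [e] at hDk
      obtain ⟨i1, i2, -⟩ := hinv k l (by omega) (by push_cast at *; omega)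
      rw [← hx0] at i1
      rw [← hx1] at i2
      omega
    · by_contra hlt
      have hne : (l : ℤ) + δ (c l) ≠ (k : ℤ) + n * (1 : ℤ) + δ (c k) := fun h => by
        have := hinj l k 1 h
        omega
      rw [e] at hDk
      obtain ⟨i1, i2, -⟩ := hinv l (k + n) (by omega) (by
        rw [hc.add_period]; push_cast at *; omega)
      rw [hc.add_period, ← hx1] at i2
      rw [← hx0] at i1
      omega
  · rw [e] at hDk
    rw [e'] at hDl
    have := hedge k l 0 (by omega) hl e e' (by push_cast; omega) (by push_cast at *; omega)
    exact h' (by simpa using this)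
  · rw [e] at hDk
    rw [e'] at hDl
    have := hedge k l 1 (by omega) hl e e' (by push_cast; omega) (by push_cast at *; omega)
    exact h' (by simpa using this)
  · rw [e] at hDk
    rw [e'] at hDl
    have := hedge l k 1 hl (by omega) e' e (by push_cast; omega) (by push_cast at *; omega)
    exact h' (by simpa using this)
  · rw [e] at hDk
    rw [e'] at hDl
    have := hedge l k 2 hl (by omega) e' e (by push_cast; omega) (by push_cast at *; omega)
    exact h' this
  · subst e
    rw [hclaim k (by omega), hclaim (k + 1) hl, hSs] at h
    exact h rfl
  · rw [hclaim l (by omega), hclaim 0 (by omega), hmS, hSs, hS0] at h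
    omega

theorem isYes_of_eq (h : I.init = I.target) : I.IsYes := by
  unfold Inst.IsYes
  rw [h]

/-- Unless nothing has to move, some object moves clockwise across an edge which its neighbour
crosses counter-clockwise. -/
theorem Future.exists_opposite (hc : CycOrder I.graph c) (F : Future I c I.init δ)
    (hne : I.init ≠ I.target) : ∃ s : ℕ, s < n ∧ 0 ≤ δ (c s) ∧ δ (c (s + 1)) < 0 := by
  have hneg : ∃ v, δ v < 0 := by
    by_contra! h
    have h1 := (Finset.sum_eq_zero_iff_of_nonneg (fun v _ => h v)).1 F.sum
    apply hne
    ext v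
    obtain ⟨i, rfl⟩ := hc.surj v
    rw [← F.target i, h1 _ (Finset.mem_univ _), add_zero]
  have hpos : ∃ v, 0 ≤ δ v := by
    by_contra! h
    obtain ⟨v, -⟩ := hneg
    have := Finset.sum_neg (fun v _ => h v) ⟨v, Finset.mem_univ v⟩
    rw [F.sum] at this
    exact lt_irrefl _ this
  have key : ∃ i : ℤ, 0 ≤ δ (c i) ∧ δ (c (i + 1)) < 0 := by
    by_contra! h
    obtain ⟨v, hv⟩ := hneg
    obtain ⟨u, hu⟩ := hpos
    obtain ⟨i, -, rfl⟩ := hc.exists_nat u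
    obtain ⟨j, -, rfl⟩ := hc.exists_nat v
    have hall : ∀ k : ℕ, 0 ≤ δ (c ((i : ℤ) + k)) := by
      intro k
      induction k with
      | zero => simpa using hu
      | succ k ih =>
        have := h _ ih
        push_cast
        rwa [← add_assoc]
    have hn1 : (1 : ℤ) ≤ n := by have := (c 0).pos; omega
    -- Starting from `i`, this many steps lead to `j + n * i`, a translate of `j`.
    have h2 := hall (j + (n - 1) * i)
    have : (i : ℤ) + (j + (n - 1) * i : ℕ) = j + n * i := by
      rcases n with _ | n
      · omega
      · rw [Nat.add_sub_cancel]; push_cast; ring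
    rw [this, hc.add_mul_period] at h2
    omega
  obtain ⟨i, h1, h2⟩ := key
  obtain ⟨s, hs, hsi⟩ := hc.exists_nat (c i)
  refine ⟨s, hs, hsi ▸ h1, ?_⟩
  rw [hc.congr hsi 1]; exact h2

/-- Equal assignments are a case of their own, because then there need not be a counter-clockwise
object and hence no pair to guess. A solution found for any guess is accepted. -/
theorem isYes_iff (hn : 3 ≤ n) (hc : CycOrder I.graph c) {D : ℕ → ℕ → ℕ} {R : ℕ → ℕ → ℕ → ℕ}
    {cl : ℕ → ℕ → ℕ} (hD : ∀ s < n, IsDisp I (fun i => c (s + i)) (D s))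
    (hR : ∀ s < n, IsRank I (fun i => c (s + i)) (R s))
    (hcl : ∀ s < n, ClaimSpec n (D s) (R s) ((∑ k ∈ Finset.range n, D s k) / n) (cl s)) :
    I.IsYes ↔ I.init = I.target ∨ ∃ s < n, ∃ x,
      Consistent n (D s) (R s) ((∑ k ∈ Finset.range n, D s k) / n) (cl s) x := by
  constructor
  · intro h
    by_cases hne : I.init = I.target
    · exact .inl hne
    right
    obtain ⟨δ, F⟩ := Future.exists_of_reachable hc (by omega) h
    obtain ⟨s, hs, h0, h1⟩ := F.exists_opposite hc hne
    exact ⟨s, hs, (F.shift s).exists_consistent hn (hc.shift s) (hD s hs) (hR s hs) rfl (hcl s hs)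
      (by simpa using h0) h1⟩
  · rintro (h | ⟨s, hs, x, hx⟩)
    · exact isYes_of_eq h
    · exact hx.isYes (by omega) (hc.shift s) (hD s hs) (hR s hs) rfl (hcl s hs).le

end

/-! ### Reasoning about programs -/

@[simp] theorem Store.setVar_var (s : Store) (x v y : ℕ) :
    (s.setVar x v).var y = if y = x then v else s.var y := by
  simp [Store.setVar, Function.update_apply]

@[simp] theorem Store.setVar_arr (s : Store) (x v : ℕ) : (s.setVar x v).arr = s.arr := rfl

@[simp] theorem Store.setArr_var (s : Store) (a k v : ℕ) : (s.setArr a k v).var = s.var := rfl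

@[simp] theorem Store.setArr_arr (s : Store) (a k v b : ℕ) :
    (s.setArr a k v).arr b = if b = a then Function.update (s.arr a) k v else s.arr b := by
  simp [Store.setArr, Function.update_apply]

instance : Add Expr := ⟨.op .add⟩
instance : Sub Expr := ⟨.op .sub⟩
instance : Mul Expr := ⟨.op .mul⟩
instance : Div Expr := ⟨.op .div⟩
instance : Mod Expr := ⟨.op .mod⟩

/-- Words range below this bound. -/
def cap (w : ℕ) : ℕ := 2 ^ w

/-- The value of a comparison by `<`. -/
def ltB (a b : ℕ) : ℕ := if a < b then 1 else 0

/-- The value of a comparison by `=`. -/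
def eqB (a b : ℕ) : ℕ := if a = b then 1 else 0

@[simp] theorem ltB_eq_zero (a b : ℕ) : ltB a b = 0 ↔ b ≤ a := by
  unfold ltB; split_ifs <;> simp <;> omega

@[simp] theorem eqB_eq_zero (a b : ℕ) : eqB a b = 0 ↔ a ≠ b := by
  unfold eqB; split_ifs <;> simpa

theorem ltB_le (a b : ℕ) : ltB a b ≤ 1 := by unfold ltB; split_ifs <;> simp

theorem eqB_le (a b : ℕ) : eqB a b ≤ 1 := by unfold eqB; split_ifs <;> simp

/-- Value of a word operation without overflow. -/
def Op.evalN : Op → ℕ → ℕ → ℕ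
  | .add, a, b => a + b
  | .sub, a, b => a - b
  | .mul, a, b => a * b
  | .div, a, b => a / b
  | .mod, a, b => a % b
  | .lt, a, b => ltB a b
  | .eq, a, b => eqB a b

/-- Value of an expression without overflow. -/
def Expr.evalN (s : Store) : Expr → ℕ
  | .const k => k
  | .var x => s.var x
  | .get a e => s.arr a (e.evalN s)
  | .op o e₁ e₂ => o.evalN (e₁.evalN s) (e₂.evalN s)

/-- No intermediate result reaches `B`. -/
def Expr.Fits (B : ℕ) (s : Store) : Expr → Prop
  | .const k => k < B
  | .var _ => True
  | .get _ e => e.Fits B s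
  | .op .add e₁ e₂ => e₁.Fits B s ∧ e₂.Fits B s ∧ e₁.evalN s + e₂.evalN s < B
  | .op .mul e₁ e₂ => e₁.Fits B s ∧ e₂.Fits B s ∧ e₁.evalN s * e₂.evalN s < B
  | .op _ e₁ e₂ => e₁.Fits B s ∧ e₂.Fits B s

/-- Allows exact arithmetic in all later proofs, with overflow excluded by size bounds. The bound `1
< cap w` is for comparisons, whose value `1` is reduced as well. -/
theorem Expr.eval_eq_evalN {w : ℕ} (hw : 1 < cap w) {s : Store} {e : Expr}
    (h : e.Fits (cap w) s) : e.eval w s = e.evalN s := by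
  induction e with
  | const k => exact Nat.mod_eq_of_lt h
  | var x => rfl
  | get a e ih => simp only [Expr.eval, Expr.evalN, ih h]
  | op o a b iha ihb =>
    cases o <;> simp only [Expr.Fits] at h <;>
      simp only [Expr.eval, Expr.evalN, iha h.1, Op.eval, Op.evalN]
    case add => rw [ihb h.2.1]; exact Nat.mod_eq_of_lt h.2.2
    case mul => rw [ihb h.2.1]; exact Nat.mod_eq_of_lt h.2.2
    case lt => rw [ihb h.2, ltB]; split_ifs; exacts [Nat.mod_eq_of_lt hw, Nat.zero_mod _]
    case eq => rw [ihb h.2, eqB]; split_ifs; exacts [Nat.mod_eq_of_lt hw, Nat.zero_mod _]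
    all_goals rw [ihb h.2]

section

variable (s : Store) (a b : Expr) (B k : ℕ)

@[simp] theorem evalN_const : (Expr.const k).evalN s = k := rfl
@[simp] theorem evalN_var : (Expr.var k).evalN s = s.var k := rfl
@[simp] theorem evalN_get : (Expr.get k a).evalN s = s.arr k (a.evalN s) := rfl
@[simp] theorem evalN_add : (a + b).evalN s = a.evalN s + b.evalN s := rfl
@[simp] theorem evalN_sub : (a - b).evalN s = a.evalN s - b.evalN s := rfl
@[simp] theorem evalN_mul : (a * b).evalN s = a.evalN s * b.evalN s := rfl
@[simp] theorem evalN_div : (a / b).evalN s = a.evalN s / b.evalN s := rfl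
@[simp] theorem evalN_mod : (a % b).evalN s = a.evalN s % b.evalN s := rfl
@[simp] theorem evalN_lt : (Expr.op .lt a b).evalN s =
    ltB (a.evalN s) (b.evalN s) := rfl
@[simp] theorem evalN_eq : (Expr.op .eq a b).evalN s =
    eqB (a.evalN s) (b.evalN s) := rfl
@[simp] theorem cost_const : (Expr.const k).cost = 1 := rfl
@[simp] theorem cost_var : (Expr.var k).cost = 1 := rfl
@[simp] theorem cost_get : (Expr.get k a).cost = a.cost + 1 := rfl
@[simp] theorem cost_add : (a + b).cost = a.cost + b.cost + 1 := rfl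
@[simp] theorem cost_sub : (a - b).cost = a.cost + b.cost + 1 := rfl
@[simp] theorem cost_mul : (a * b).cost = a.cost + b.cost + 1 := rfl
@[simp] theorem cost_div : (a / b).cost = a.cost + b.cost + 1 := rfl
@[simp] theorem cost_mod : (a % b).cost = a.cost + b.cost + 1 := rfl
@[simp] theorem cost_lt : (Expr.op .lt a b).cost = a.cost + b.cost + 1 := rfl
@[simp] theorem cost_eq : (Expr.op .eq a b).cost = a.cost + b.cost + 1 := rfl
@[simp] theorem fits_const : (Expr.const k).Fits B s ↔ k < B := Iff.rfl
@[simp] theorem fits_var : (Expr.var k).Fits B s ↔ True := Iff.rfl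
@[simp] theorem fits_get : (Expr.get k a).Fits B s ↔ a.Fits B s := Iff.rfl
@[simp] theorem fits_add : (a + b).Fits B s ↔
    a.Fits B s ∧ b.Fits B s ∧ a.evalN s + b.evalN s < B := Iff.rfl
@[simp] theorem fits_sub : (a - b).Fits B s ↔ a.Fits B s ∧ b.Fits B s := Iff.rfl
@[simp] theorem fits_mul : (a * b).Fits B s ↔
    a.Fits B s ∧ b.Fits B s ∧ a.evalN s * b.evalN s < B := Iff.rfl
@[simp] theorem fits_div : (a / b).Fits B s ↔ a.Fits B s ∧ b.Fits B s := Iff.rfl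
@[simp] theorem fits_mod : (a % b).Fits B s ↔ a.Fits B s ∧ b.Fits B s := Iff.rfl
@[simp] theorem fits_lt : (Expr.op .lt a b).Fits B s ↔ a.Fits B s ∧ b.Fits B s := Iff.rfl
@[simp] theorem fits_eq : (Expr.op .eq a b).Fits B s ↔ a.Fits B s ∧ b.Fits B s := Iff.rfl

end

/-! ### Programs without loops -/

/-- The effect of a program without loops and overflows. -/
@[simp] def Prog.runN : Prog → Store → Store
  | .skip, s => s
  | .assign x e, s => s.setVar x (e.evalN s)
  | .put a i e, s => s.setArr a (i.evalN s) (e.evalN s)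
  | .seq p q, s => q.runN (p.runN s)
  | .ite b p q, s => if b.evalN s = 0 then q.runN s else p.runN s
  | .loop _ _, s => s

/-- The program is free of loops and runs without overflows. -/
@[simp] def Prog.Fits (B : ℕ) : Prog → Store → Prop
  | .skip, _ => True
  | .assign _ e, s => e.Fits B s
  | .put _ i e, s => i.Fits B s ∧ e.Fits B s
  | .seq p q, s => p.Fits B s ∧ q.Fits B (p.runN s)
  | .ite b p q, s => b.Fits B s ∧ (b.evalN s = 0 → q.Fits B s) ∧ (b.evalN s ≠ 0 → p.Fits B s)
  | .loop _ _, _ => False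

/-- An upper bound for the running time of a program without loops. -/
@[simp] def Prog.cost : Prog → ℕ
  | .skip => 1
  | .assign _ e => e.cost + 1
  | .put _ i e => i.cost + e.cost + 1
  | .seq p q => p.cost + q.cost
  | .ite b p q => b.cost + 1 + max p.cost q.cost
  | .loop _ _ => 0

theorem Prog.exec_of_fits {w : ℕ} (hw : 1 < cap w) {p : Prog} {s : Store}
    (h : p.Fits (cap w) s) : ∃ t, Exec w p s t (p.runN s) ∧ t ≤ p.cost := by
  induction p generalizing s with
  | skip => exact ⟨_, .skip s, le_rfl⟩
  | assign x e =>
    refine ⟨_, ?_, le_rfl⟩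
    rw [Prog.runN, ← Expr.eval_eq_evalN hw h]
    exact .assign s x e
  | put a i e =>
    refine ⟨_, ?_, le_rfl⟩
    rw [Prog.runN, ← Expr.eval_eq_evalN hw h.1, ← Expr.eval_eq_evalN hw h.2]
    exact .put s a i e
  | seq p q ihp ihq =>
    obtain ⟨t₁, h₁, l₁⟩ := ihp h.1
    obtain ⟨t₂, h₂, l₂⟩ := ihq h.2
    exact ⟨_, .seq h₁ h₂, Nat.add_le_add l₁ l₂⟩
  | ite b p q ihp ihq =>
    obtain ⟨hb, h0, h1⟩ := h
    have hb' := Expr.eval_eq_evalN hw hb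
    by_cases e : b.evalN s = 0
    · obtain ⟨t, ht, l⟩ := ihq (h0 e)
      refine ⟨_, ?_, Nat.add_le_add_left (l.trans (le_max_right _ _)) _⟩
      rw [Prog.runN, if_pos e]
      exact .ite_false (hb'.trans e) ht
    · obtain ⟨t, ht, l⟩ := ihp (h1 e)
      refine ⟨_, ?_, Nat.add_le_add_left (l.trans (le_max_left _ _)) _⟩
      rw [Prog.runN, if_neg e]
      exact .ite_true (hb' ▸ e) ht
  | loop => exact h.elim

/-- The variables that a program may write. -/
@[simp] def Prog.vars : Prog → List ℕ
  | .skip => []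
  | .assign x _ => [x]
  | .put _ _ _ => []
  | .seq p q => p.vars ++ q.vars
  | .ite _ p q => p.vars ++ q.vars
  | .loop _ p => p.vars

/-- The arrays that a program may write. -/
@[simp] def Prog.arrs : Prog → List ℕ
  | .skip => []
  | .assign _ _ => []
  | .put a _ _ => [a]
  | .seq p q => p.arrs ++ q.arrs
  | .ite _ p q => p.arrs ++ q.arrs
  | .loop _ p => p.arrs

/-- `s'` agrees with `s` outside the given variables and arrays. -/
structure Agree (V A : List ℕ) (s s' : Store) : Prop where
  var : ∀ x, x ∉ V → s'.var x = s.var x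
  arr : ∀ a, a ∉ A → s'.arr a = s.arr a

theorem Agree.refl (V A : List ℕ) (s : Store) : Agree V A s s := ⟨fun _ _ => rfl, fun _ _ => rfl⟩

theorem Agree.trans {V A V' A' : List ℕ} {s₁ s₂ s₃ : Store} (h : Agree V A s₁ s₂)
    (h' : Agree V' A' s₂ s₃) : Agree (V ++ V') (A ++ A') s₁ s₃ where
  var x hx := by
    simp only [List.mem_append, not_or] at hx
    rw [h'.var x hx.2, h.var x hx.1]
  arr a ha := by
    simp only [List.mem_append, not_or] at ha
    rw [h'.arr a ha.2, h.arr a ha.1]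

theorem Agree.mono {V A V' A' : List ℕ} {s₁ s₂ : Store} (h : Agree V A s₁ s₂) (hV : V ⊆ V')
    (hA : A ⊆ A') : Agree V' A' s₁ s₂ :=
  ⟨fun x hx => h.var x fun h' => hx (hV h'), fun a ha => h.arr a fun h' => ha (hA h')⟩

/-- A syntactic frame rule, so that invariants need to mention only what a program writes. -/
theorem Exec.agree {w t : ℕ} {p : Prog} {s s' : Store} (h : Exec w p s t s') :
    Agree p.vars p.arrs s s' := by
  induction h with
  | skip => exact .refl _ _ _
  | assign s x e => exact ⟨fun y hy => by simp at hy; simp [hy], fun _ _ => rfl⟩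
  | put s a i e => exact ⟨fun _ _ => rfl, fun b hb => by ext j; simp_all⟩
  | seq _ _ h₁ h₂ => exact h₁.trans h₂
  | ite_true _ _ h => exact h.mono (by simp) (by simp)
  | ite_false _ _ h => exact h.mono (by simp) (by simp)
  | loop_done => exact .refl _ _ _
  | loop_step _ _ _ h₁ h₂ => exact (h₁.trans h₂).mono (by simp) (by simp)

/-! ### Total correctness with running time -/

/-- `p`, started in `s`, halts after `t` steps in a memory `s'` such that `Q t s'`. -/
def Runs (w : ℕ) (p : Prog) (s : Store) (Q : ℕ → Store → Prop) : Prop :=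
  ∃ t s', Exec w p s t s' ∧ Agree p.vars p.arrs s s' ∧ Q t s'

theorem Runs.of_exec {w t : ℕ} {p : Prog} {s s' : Store} {Q : ℕ → Store → Prop}
    (h : Exec w p s t s') (hQ : Agree p.vars p.arrs s s' → Q t s') : Runs w p s Q :=
  ⟨t, s', h, h.agree, hQ h.agree⟩

theorem Runs.mono {w : ℕ} {p : Prog} {s : Store} {Q Q' : ℕ → Store → Prop} (h : Runs w p s Q)
    (hQ : ∀ t s', Agree p.vars p.arrs s s' → Q t s' → Q' t s') : Runs w p s Q' := by
  obtain ⟨t, s', h1, h2, h3⟩ := h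
  exact ⟨t, s', h1, h2, hQ t s' h2 h3⟩

theorem Runs.line {w : ℕ} (hw : 1 < cap w) {p : Prog} {s : Store} {Q : ℕ → Store → Prop}
    (h : p.Fits (cap w) s)
    (hQ : ∀ t ≤ p.cost, Agree p.vars p.arrs s (p.runN s) → Q t (p.runN s)) : Runs w p s Q := by
  obtain ⟨t, h1, h2⟩ := Prog.exec_of_fits hw h
  exact .of_exec h1 (hQ t h2)

theorem Runs.seq {w : ℕ} {p q : Prog} {s : Store} {Q : ℕ → Store → Prop}
    (h : Runs w p s fun t s' => Runs w q s' fun t' s'' => Q (t + t') s'') :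
    Runs w (.seq p q) s Q := by
  obtain ⟨t, s', h1, -, t', s'', h3, -, h5⟩ := h
  exact .of_exec (.seq h1 h3) fun _ => h5

theorem Runs.ite {w : ℕ} (hw : 1 < cap w) {b : Expr} {p q : Prog} {s : Store}
    {Q : ℕ → Store → Prop} (hb : b.Fits (cap w) s)
    (h1 : b.evalN s ≠ 0 → Runs w p s fun t s' => Q (b.cost + 1 + t) s')
    (h0 : b.evalN s = 0 → Runs w q s fun t s' => Q (b.cost + 1 + t) s') :
    Runs w (.ite b p q) s Q := by
  have hb' := Expr.eval_eq_evalN hw hb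
  by_cases e : b.evalN s = 0
  · obtain ⟨t, s', h2, -, h3⟩ := h0 e
    exact .of_exec (.ite_false (hb'.trans e) h2) fun _ => h3
  · obtain ⟨t, s', h2, -, h3⟩ := h1 e
    exact .of_exec (.ite_true (hb' ▸ e) h2) fun _ => h3

/-- A loop with an invariant that may mention the time that has passed, and a decreasing measure. -/
theorem Runs.loop {w : ℕ} (hw : 1 < cap w) {b : Expr} {p : Prog} {s : Store}
    {Q : ℕ → Store → Prop} (Inv : ℕ → Store → Prop) (μ : Store → ℕ)
    (h0 : Inv 0 s) (hb : ∀ t s', Inv t s' → b.Fits (cap w) s')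
    (hstep : ∀ t s', Agree p.vars p.arrs s s' → Inv t s' → b.evalN s' ≠ 0 →
      Runs w p s' fun t' s'' => Inv (t + (b.cost + 1 + t')) s'' ∧ μ s'' < μ s')
    (hQ : ∀ t s', Agree p.vars p.arrs s s' → Inv t s' → b.evalN s' = 0 →
      Q (t + (b.cost + 1)) s') :
    Runs w (.loop b p) s Q := by
  suffices ∀ m t s', μ s' = m → Agree p.vars p.arrs s s' → Inv t s' →
      ∃ t' s'', Exec w (.loop b p) s' t' s'' ∧ Q (t + t') s'' by
    obtain ⟨t', s'', h1, h2⟩ := this _ 0 s rfl (.refl _ _ _) h0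
    rw [Nat.zero_add] at h2
    exact .of_exec h1 fun _ => h2
  intro m
  induction m using Nat.strong_induction_on with
  | _ m ih =>
  rintro t s' rfl ha hI
  have hb' := Expr.eval_eq_evalN hw (hb t s' hI)
  by_cases e : b.evalN s' = 0
  · exact ⟨_, _, .loop_done (hb'.trans e), hQ t s' ha hI e⟩
  · obtain ⟨t₁, s₁, h1, h2, h3, h4⟩ := hstep t s' ha hI e
    obtain ⟨t₂, s₂, h5, h6⟩ := ih _ h4 _ s₁ rfl ((ha.trans h2).mono (by simp) (by simp)) h3
    refine ⟨_, _, .loop_step (hb' ▸ e) h1 h5, ?_⟩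
    rwa [← Nat.add_assoc]

/-- `for v = 0, …, var y - 1 do p`. -/
def forTo (v y : ℕ) (p : Prog) : Prog :=
  .seq (.assign v (.const 0))
    (.loop (.op .lt (.var v) (.var y)) (.seq p (.assign v (.var v + .const 1))))

@[simp] theorem vars_forTo (v y : ℕ) (p : Prog) : (forTo v y p).vars = v :: (p.vars ++ [v]) := rfl

@[simp] theorem arrs_forTo (v y : ℕ) (p : Prog) : (forTo v y p).arrs = p.arrs := by
  simp [forTo]

/-- Each round adds 4 steps for the test and 4 for the increment; 2 steps for the initialisation and
4 for the last test make the final 6. The invariant takes the elapsed time as an argument to permit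
amortised bounds. -/
theorem Runs.forTo_timed {w : ℕ} {v y : ℕ} {p : Prog} {s : Store} {Q : ℕ → Store → Prop} (n : ℕ)
    (hw : n + 1 < cap w) (hy : s.var y = n) (hyp : y ∉ v :: p.vars) (hv : v ∉ p.vars)
    (Inv : ℕ → ℕ → Store → Prop) (h0 : Inv 0 0 (s.setVar v 0))
    (hstep : ∀ i < n, ∀ t s', Agree (v :: p.vars) p.arrs s s' → s'.var v = i → Inv i t s' →
      Runs w p s' fun t' s'' => Inv (i + 1) (t + t' + 8) (s''.setVar v (i + 1)))
    (hQ : ∀ t s', Agree (v :: p.vars) p.arrs s s' → s'.var v = n → Inv n t s' → Q (t + 6) s') :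
    Runs w (forTo v y p) s Q := by
  have hw1 : 1 < cap w := by omega
  have hyv : y ≠ v := by rintro rfl; simp at hyp
  have key : ∀ j i, i + j = n → ∀ t s', Agree (v :: p.vars) p.arrs s s' → s'.var v = i →
      Inv i t s' → ∃ t' s'' T,
        Exec w (.loop (.op .lt (.var v) (.var y)) (.seq p (.assign v (.var v + .const 1))))
          s' t' s'' ∧ Agree (v :: p.vars) p.arrs s s'' ∧ s''.var v = n ∧ Inv n T s'' ∧
          t + t' = T + 4 := by
    intro j
    induction j with
    | zero =>
      rintro i rfl t s' ha hi hI
      refine ⟨_, s', t, .loop_done ?_, ha, hi, hI, rfl⟩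
      rw [Expr.eval_eq_evalN hw1 (by simp)]
      simp [hi, ha.var y hyp, hy]
    | succ j ih =>
      rintro i rfl t s' ha hi hI
      obtain ⟨t₁, s₁, h1, h2, h3⟩ := hstep i (by omega) t s' ha hi hI
      have hv1 : s₁.var v = i := by rw [h2.var v hv, hi]
      have ha1 : Agree (v :: p.vars) p.arrs s (s₁.setVar v (i + 1)) := by
        refine ⟨fun x hx => ?_, fun a h => ?_⟩
        · have hx' := hx
          simp only [List.mem_cons, not_or] at hx'
          rw [Store.setVar_var, if_neg hx'.1, h2.var x hx'.2, ha.var x hx]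
        · rw [Store.setVar_arr, h2.arr a h, ha.arr a h]
      obtain ⟨t₂, s₂, T, h4, h5, h6, h7, h8⟩ := ih (i + 1) (by omega) _ _ ha1 (by simp) h3
      have hass := Exec.assign (w := w) s₁ v (.var v + .const 1)
      rw [Expr.eval_eq_evalN hw1 (by simp [hv1]; omega)] at hass
      simp only [evalN_add, evalN_var, evalN_const, hv1] at hass
      refine ⟨_, s₂, T, .loop_step ?_ (.seq h1 hass) h4, h5, h6, h7, ?_⟩
      · rw [Expr.eval_eq_evalN hw1 (by simp)]
        simp [hi, ha.var y hyp, hy]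
      · rw [← h8]
        change t + (3 + 1 + (t₁ + (3 + 1)) + t₂) = _
        omega
  have ha0 : Agree (v :: p.vars) p.arrs s (s.setVar v 0) :=
    ⟨fun x hx => by simp at hx; simp [hx.1], fun _ _ => rfl⟩
  obtain ⟨t', s'', T, h1, h2, h3, h4, h5⟩ := key n 0 (by omega) 0 _ ha0 (by simp) h0
  have hass := Exec.assign (w := w) s v (.const 0)
  rw [Expr.eval_eq_evalN hw1 (by simp; omega)] at hass
  refine .of_exec (.seq hass h1) fun _ => ?_
  have : (Expr.const 0).cost + 1 + t' = T + 6 := by change 1 + 1 + t' = _; omega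
  rw [this]
  exact hQ T s'' h2 h3 h4

theorem Runs.forTo {w : ℕ} {v y : ℕ} {p : Prog} {s : Store} {Q : ℕ → Store → Prop} (n T : ℕ)
    (hw : n + 1 < cap w) (hy : s.var y = n) (hyp : y ∉ v :: p.vars) (hv : v ∉ p.vars)
    (Inv : ℕ → Store → Prop) (h0 : Inv 0 (s.setVar v 0))
    (hstep : ∀ i < n, ∀ s', Agree (v :: p.vars) p.arrs s s' → s'.var v = i → Inv i s' →
      Runs w p s' fun t' s'' => t' ≤ T ∧ Inv (i + 1) (s''.setVar v (i + 1)))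
    (hQ : ∀ t s', Agree (v :: p.vars) p.arrs s s' → s'.var v = n → Inv n s' →
      t ≤ (T + 8) * n + 6 → Q t s') :
    Runs w (forTo v y p) s Q := by
  refine .forTo_timed n hw hy hyp hv (fun i t s' => Inv i s' ∧ t ≤ (T + 8) * i) ⟨h0, by simp⟩
    (fun i hi t s' ha hv ⟨hI, ht⟩ => (hstep i hi s' ha hv hI).mono fun t' s'' _ ⟨h1, h2⟩ =>
      ⟨h2, by rw [Nat.mul_succ]; omega⟩)
    fun t s' ha hv ⟨hI, ht⟩ => hQ _ s' ha hv hI (by omega)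


/-! ### Two-satisfiability by simultaneous propagation

Literal `2 * k + d` says that variable `k` has value `d`; `Conf u v` says that the literals `u` and
`v` exclude each other. -/

/-- The opposite literal. -/
def neg (u : ℕ) : ℕ := u + 1 - 2 * (u % 2)

theorem neg_div (u : ℕ) : neg u / 2 = u / 2 := by unfold neg; omega
theorem neg_mod (u : ℕ) : neg u % 2 = 1 - u % 2 := by unfold neg; omega
theorem neg_neg (u : ℕ) : neg (neg u) = u := by unfold neg; omega
theorem neg_ne (u : ℕ) : neg u ≠ u := by unfold neg; omega
theorem neg_lt {n u : ℕ} (h : u < 2 * n) : neg u < 2 * n := by unfold neg; omega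

/-- `x` solves the instance restricted to the variables in `A`. -/
def IsSol (Conf : ℕ → ℕ → Prop) (A : ℕ → Prop) (x : ℕ → ℕ) : Prop :=
  (∀ k, A k → x k < 2) ∧ ∀ k l, A k → A l → ¬ Conf (2 * k + x k) (2 * l + x l)

/-- Unit propagation: a true literal forces the negation of every literal in conflict with it. -/
theorem IsSol.eq_neg {Conf : ℕ → ℕ → Prop} {A : ℕ → Prop} {x : ℕ → ℕ} (h : IsSol Conf A x)
    {u v : ℕ} (hu : A (u / 2)) (hv : A (v / 2)) (hc : Conf u v) (hx : x (u / 2) = u % 2) :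
    x (v / 2) = neg v % 2 := by
  have h1 := h.1 _ hv
  have h2 := h.2 _ _ hu hv
  rw [neg_mod]
  by_contra h3
  have e : x (v / 2) = v % 2 := by omega
  rw [hx, e, Nat.div_add_mod, Nat.div_add_mod] at h2
  exact h2 hc

/-- A closed consistent set of literals may be made true, whatever the other variables are. -/
theorem exists_isSol_iff {Conf : ℕ → ℕ → Prop} (hs : ∀ u v, Conf u v → Conf v u) {A T : ℕ → Prop}
    (hcons : ∀ u, T u → ¬ T (neg u))
    (hclosed : ∀ u v, T u → A (v / 2) → Conf u v → T (neg v)) :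
    (∃ x, IsSol Conf A x) ↔
      ∃ x, IsSol Conf (fun k => A k ∧ ¬ T (2 * k) ∧ ¬ T (2 * k + 1)) x := by
  constructor
  · rintro ⟨x, h1, h2⟩
    exact ⟨x, fun k hk => h1 k hk.1, fun k l hk hl => h2 k l hk.1 hl.1⟩
  rintro ⟨x, h1, h2⟩
  classical
  -- Variables decided by `T` follow `T`, the others keep the given solution. A conflict between the
  -- two kinds is impossible because `T` is closed under propagation.
  let y : ℕ → ℕ := fun k => if T (2 * k) then 0 else if T (2 * k + 1) then 1 else x k
  have hy : ∀ k, (T (2 * k + y k)) ∨ (¬ T (2 * k) ∧ ¬ T (2 * k + 1) ∧ y k = x k) := by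
    intro k
    by_cases e : T (2 * k)
    · left; simp [y, e]
    by_cases e' : T (2 * k + 1)
    · left; simp [y, e, e']
    · right; simp [y, e, e']
  have hy2 : ∀ k, A k → y k < 2 := by
    intro k hk
    rcases hy k with h | ⟨h3, h4, h5⟩
    · simp only [y]
      split_ifs with e e'
      · omega
      · omega
      · exact h1 k ⟨hk, e, e'⟩
    · rw [h5]; exact h1 k ⟨hk, h3, h4⟩
  have main : ∀ k l, A k → A l → T (2 * k + y k) → ¬ Conf (2 * k + y k) (2 * l + y l) := by
    intro k l hk hl h hc
    have hl2 := hy2 l hl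
    have e1 : (2 * l + y l) / 2 = l := by omega
    have h3 := hclosed _ _ h (by rwa [e1]) hc
    rcases hy l with h4 | ⟨h4, h5, -⟩
    · exact hcons _ h4 h3
    · have : neg (2 * l + y l) = 2 * l ∨ neg (2 * l + y l) = 2 * l + 1 := by unfold neg; omega
      rcases this with e | e
      · exact h4 (e ▸ h3)
      · exact h5 (e ▸ h3)
  refine ⟨y, hy2, fun k l hk hl hc => ?_⟩
  rcases hy k with h | ⟨h3, h4, h5⟩
  · exact main k l hk hl h hc
  rcases hy l with h | ⟨h6, h7, h8⟩
  · exact main l k hl hk h (hs _ _ hc)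
  · rw [h5, h8] at hc
    exact h2 k l ⟨hk, h3, h4⟩ ⟨hl, h6, h7⟩ hc

/-- Propagation from the literal `a`: `mk` marks the literals that have been derived, `q` lists
them in positions below `t`, those below `h` have been processed (the last one of these only
against the literals below `i`), and `f` reports a contradiction. -/
structure Propagation (n : ℕ) (Conf : ℕ → ℕ → Prop) (A : ℕ → Prop) (a : ℕ) (mk q : ℕ → ℕ)
    (h t f i : ℕ) : Prop where
  start : mk a ≠ 0
  le : h ≤ t
  f_le : f ≤ 1
  mk_iff : ∀ u < 2 * n, mk u ≠ 0 ↔ ∃ j < t, q j = u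
  q_lt : ∀ j < t, q j < 2 * n
  inj : ∀ j < t, ∀ j' < t, q j = q j' → j = j'
  alive : ∀ u < 2 * n, mk u ≠ 0 → A (u / 2)
  forced : ∀ x, IsSol Conf A x → x (a / 2) = a % 2 → ∀ u < 2 * n, mk u ≠ 0 → x (u / 2) = u % 2
  fail : f ≠ 0 → ∀ x, IsSol Conf A x → x (a / 2) ≠ a % 2
  cons : f = 0 → ∀ u < 2 * n, mk u ≠ 0 → mk (neg u) = 0
  closed : f = 0 → ∀ j < h, ∀ v < 2 * n, (j + 1 = h → v < i) → A (v / 2) → Conf (q j) v →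
    mk (neg v) ≠ 0

namespace Propagation

variable {n : ℕ} {Conf : ℕ → ℕ → Prop} {A : ℕ → Prop} {a : ℕ} {mk q : ℕ → ℕ} {h t f i : ℕ}

theorem init (hn : a < 2 * n) (hA : A (a / 2)) (hm : ∀ u < 2 * n, mk u = if u = a then 1 else 0)
    (hq : q 0 = a) : Propagation n Conf A a mk q 0 1 0 i where
  start := by simp [hm a hn]
  le := by omega
  f_le := by omega
  mk_iff u hu := by rw [hm u hu]; simp [hq, eq_comm]
  q_lt j hj := by obtain rfl : j = 0 := by omega
                  omega
  inj j hj j' hj' _ := by omega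
  alive u hu h := by
    rw [hm u hu] at h
    have : u = a := by simpa using h
    rwa [this]
  forced x _ hx u hu h := by
    rw [hm u hu] at h
    have : u = a := by simpa using h
    rwa [this]
  fail h := absurd rfl h
  cons _ u hu h := by
    rw [hm u hu] at h
    have e : u = a := by simpa using h
    rw [hm _ (neg_lt hu), if_neg (e ▸ neg_ne u)]
  closed _ j hj := by omega

theorem next (P : Propagation n Conf A a mk q h t f i) (hi : 2 * n ≤ i) (ht : h < t) :
    Propagation n Conf A a mk q (h + 1) t f 0 :=
  { P with
    le := ht
    closed := fun hf j hj v hv hji => P.closed hf j (by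
      by_contra h'
      exact absurd (hji (by omega)) (by omega)) v hv fun _ => by omega }

theorem miss (P : Propagation n Conf A a mk q h t f i) (hc : ¬ (Conf (q (h - 1)) i ∧ A (i / 2))) :
    Propagation n Conf A a mk q h t f (i + 1) :=
  { P with
    closed := fun hf j hj v hv hji hA hcf => by
      by_cases e : j + 1 = h ∧ v = i
      · obtain ⟨rfl, rfl⟩ := e
        exact absurd ⟨hcf, hA⟩ hc
      · exact P.closed hf j hj v hv (fun h' => by have := hji h'; omega) hA hcf }

/-- Two derived literals in conflict are both forced by the start literal, which is thereby refuted.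
After that, consistency and closedness are no longer maintained. -/
theorem contradiction (P : Propagation n Conf A a mk q h t f i) (hi : i < 2 * n) (hh : 0 < h)
    (hc : Conf (q (h - 1)) i) (hm : mk i ≠ 0) : Propagation n Conf A a mk q h t 1 i :=
  { P with
    f_le := le_rfl
    fail := fun _ x hx ha => by
      have hl := P.le
      have hq := P.q_lt (h - 1) (by omega)
      have hmq : mk (q (h - 1)) ≠ 0 := (P.mk_iff _ hq).2 ⟨h - 1, by omega, rfl⟩
      have h1 := hx.eq_neg (P.alive _ hq hmq) (P.alive _ hi hm) hc (P.forced x hx ha _ hq hmq)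
      rw [P.forced x hx ha _ hi hm, neg_mod] at h1
      omega
    cons := fun h => by omega
    closed := fun h => by omega }

theorem known (P : Propagation n Conf A a mk q h t f i) (hm : mk (neg i) ≠ 0) :
    Propagation n Conf A a mk q h t f (i + 1) :=
  { P with
    closed := fun hf j hj v hv hji hA hcf => by
      by_cases e : v = i
      · rwa [e]
      · exact P.closed hf j hj v hv (fun h' => by have := hji h'; omega) hA hcf }

/-- The new literal is forced by unit propagation; `hf` keeps the derived set consistent as long as
no contradiction is reported. -/
theorem add (P : Propagation n Conf A a mk q h t f i) (hi : i < 2 * n) (hh : 0 < h)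
    (hc : Conf (q (h - 1)) i) (hA : A (i / 2)) (hf : f = 0 → mk i = 0) (hm : mk (neg i) = 0) :
    Propagation n Conf A a (Function.update mk (neg i) 1) (Function.update q t (neg i)) h (t + 1) f
      (i + 1) := by
  have hl := P.le
  have hq := P.q_lt (h - 1) (by omega)
  have hmq : mk (q (h - 1)) ≠ 0 := (P.mk_iff _ hq).2 ⟨h - 1, by omega, rfl⟩
  have hmk : ∀ u, Function.update mk (neg i) 1 u ≠ 0 ↔ u = neg i ∨ mk u ≠ 0 := fun u => by
    rw [Function.update_apply]; split_ifs with e <;> simp [e]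
  have hqlt : ∀ j < t, Function.update q t (neg i) j = q j := fun j hj => by
    rw [Function.update_of_ne (by omega)]
  have hnew : ∀ j < t, q j ≠ neg i := fun j hj e =>
    (P.mk_iff _ (neg_lt hi)).2 ⟨j, hj, e⟩ hm
  refine ⟨(hmk _).2 (.inr P.start), by omega, P.f_le, fun u hu => ?_, fun j hj => ?_,
    fun j hj j' hj' e => ?_, fun u hu e => ?_, fun x hx ha u hu e => ?_, P.fail, fun hf' u hu e => ?_,
    fun hf' j hj v hv hji hAv hcf => ?_⟩
  · rw [hmk, P.mk_iff u hu]
    constructor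
    · rintro (rfl | ⟨j, hj, rfl⟩)
      · exact ⟨t, by omega, by simp⟩
      · exact ⟨j, by omega, hqlt j hj⟩
    · rintro ⟨j, hj, rfl⟩
      rcases Nat.lt_succ_iff_lt_or_eq.1 hj with hj | rfl
      · exact .inr ⟨j, hj, (hqlt j hj).symm⟩
      · left; simp
  · rcases Nat.lt_succ_iff_lt_or_eq.1 hj with hj | rfl
    · rw [hqlt j hj]; exact P.q_lt j hj
    · simpa using neg_lt hi
  · rcases Nat.lt_succ_iff_lt_or_eq.1 hj with hj | rfl <;>
      rcases Nat.lt_succ_iff_lt_or_eq.1 hj' with hj' | rfl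
    · rw [hqlt j hj, hqlt j' hj'] at e; exact P.inj j hj j' hj' e
    · rw [hqlt j hj, Function.update_self] at e; exact (hnew j hj e).elim
    · rw [hqlt j' hj', Function.update_self] at e; exact (hnew j' hj' e.symm).elim
    · rfl
  · rcases (hmk u).1 e with rfl | e
    · rwa [neg_div]
    · exact P.alive u hu e
  · rcases (hmk u).1 e with rfl | e
    · have := hx.eq_neg (P.alive _ hq hmq) hA hc (P.forced x hx ha _ hq hmq)
      rw [neg_div, this]
    · exact P.forced x hx ha u hu e
  · by_contra e'
    rcases (hmk u).1 e with rfl | e <;> rcases (hmk _).1 e' with e1 | e'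
    · exact neg_ne _ e1
    · rw [neg_neg] at e'; exact e' (hf hf')
    · have : u = i := by rw [← neg_neg u, e1, neg_neg]
      rw [this] at e; exact e (hf hf')
    · exact e' (P.cons hf' u hu e)
  · rw [hmk]
    by_cases e : v = i
    · left; rw [e]
    · right
      rw [hqlt j (by omega)] at hcf
      exact P.closed hf' j hj v hv (fun h' => by have := hji h'; omega) hAv hcf

/-- No literal enters the queue twice. -/
theorem t_le (P : Propagation n Conf A a mk q h t f i) : t ≤ 2 * n := by
  have : (Finset.range t).card ≤ (Finset.range (2 * n)).card :=
    Finset.card_le_card_of_injOn q (fun j hj => by simpa using P.q_lt j (by simpa using hj))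
      fun j hj j' hj' e => P.inj j (by simpa using hj) j' (by simpa using hj') e
  simpa using this

/-- The variables of the derived literals are pairwise different. -/
theorem div_inj (P : Propagation n Conf A a mk q h t f i) (hf : f = 0) {j j' : ℕ} (hj : j < t)
    (hj' : j' < t) (e : q j / 2 = q j' / 2) : j = j' := by
  apply P.inj j hj j' hj'
  by_contra hne
  have e' : q j' = neg (q j) := by unfold neg; omega
  have h1 := P.q_lt j hj
  have h2 := P.cons hf _ h1 ((P.mk_iff _ h1).2 ⟨j, hj, rfl⟩)
  rw [← e'] at h2
  exact (P.mk_iff _ (P.q_lt j' hj')).2 ⟨j', hj', rfl⟩ h2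

/-- A finished propagation without contradiction: its variables may be deleted. -/
theorem exists_isSol_iff (P : Propagation n Conf A a mk q h t f i) (hi : 2 * n ≤ i) (ht : h = t)
    (hf : f = 0) (hs : ∀ u v, Conf u v → Conf v u) (hA : ∀ k, A k → k < n) :
    (∃ x, IsSol Conf A x) ↔ ∃ x, IsSol Conf (fun k => A k ∧ ∀ j < t, q j / 2 ≠ k) x := by
  rw [ReachableAssignment.exists_isSol_iff hs (T := fun u => ∃ j < t, q j = u)]
  · have : (fun k => A k ∧ (¬ ∃ j < t, q j = 2 * k) ∧ ¬ ∃ j < t, q j = 2 * k + 1) =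
        fun k => A k ∧ ∀ j < t, q j / 2 ≠ k := by
      ext k
      refine and_congr_right fun _ => ⟨fun ⟨h1, h2⟩ j hj e => ?_, fun h => ⟨?_, ?_⟩⟩
      · rcases Nat.mod_two_eq_zero_or_one (q j) with e' | e'
        · exact h1 ⟨j, hj, by omega⟩
        · exact h2 ⟨j, hj, by omega⟩
      · rintro ⟨j, hj, e⟩; exact h j hj (by omega)
      · rintro ⟨j, hj, e⟩; exact h j hj (by omega)
    rw [this]
  · rintro u ⟨j, hj, rfl⟩ hn
    have h1 := P.q_lt j hj
    exact (P.mk_iff _ (neg_lt h1)).2 hn (P.cons hf _ h1 ((P.mk_iff _ h1).2 ⟨j, hj, rfl⟩))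
  · rintro u v ⟨j, hj, rfl⟩ hv hc
    have hv' := hA _ hv
    have hv2 : v < 2 * n := by omega
    exact (P.mk_iff _ (neg_lt hv2)).1
      (P.closed hf j (by omega) v hv2 (fun _ => by omega) hv hc)

end Propagation

/-- Both values of a live variable have been refuted. -/
theorem not_isSol_of_fail {n k : ℕ} {Conf : ℕ → ℕ → Prop} {A : ℕ → Prop} {mk q mk' q' : ℕ → ℕ}
    {h t f i h' t' f' i' : ℕ} (hk : A k) (P : Propagation n Conf A (2 * k) mk q h t f i)
    (P' : Propagation n Conf A (2 * k + 1) mk' q' h' t' f' i') (hf : f ≠ 0) (hf' : f' ≠ 0) :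
    ¬ ∃ x, IsSol Conf A x := by
  rintro ⟨x, hx⟩
  have h1 := P.fail hf x hx
  have h2 := P'.fail hf' x hx
  have h3 := hx.1 k hk
  rw [show 2 * k / 2 = k by omega] at h1
  rw [show (2 * k + 1) / 2 = k by omega] at h2
  omega


/-! ### The program for one propagation -/

theorem index_lt {i j a b : ℕ} (hi : i < a) (hj : j < b) : i * b + j < a * b := by
  calc i * b + j < i * b + b := by omega
    _ = (i + 1) * b := by ring
    _ ≤ a * b := Nat.mul_le_mul_right _ hi

theorem index_inj {i j i' j' b : ℕ} (hj : j < b) (hj' : j' < b) :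
    i * b + j = i' * b + j' ↔ i = i' ∧ j = j' := by
  constructor
  · intro h
    have h1 := congrArg (· / b) h
    have h2 := congrArg (· % b) h
    have hb : 0 < b := by omega
    simp only [Nat.mul_add_mod', Nat.mod_eq_of_lt hj, Nat.mod_eq_of_lt hj'] at h2
    simp only [Nat.add_comm (_ * b), Nat.add_mul_div_right _ _ hb, Nat.div_eq_of_lt hj,
      Nat.div_eq_of_lt hj'] at h1
    omega
  · rintro ⟨rfl, rfl⟩; rfl

/-- The literal opposite to the one in variable `14`. -/
def negExpr : Expr := .var 14 + .const 1 - .const 2 * (.var 14 % .const 2)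

/-- Process the literal in variable `13` against the literal in variable `14`. -/
def scanBody (mk q t f : ℕ) : Prog :=
  .ite (.get 11 (.var 13 * .var 1 + .var 14))
    (.ite (.get 12 (.var 14 / .const 2))
      (.seq (.ite (.get mk (.var 14)) (.assign f (.const 1)) .skip)
        (.ite (.get mk negExpr) .skip
          (.seq (.put mk negExpr (.const 1))
            (.seq (.put q (.var t) negExpr) (.assign t (.var t + .const 1))))))
      .skip)
    .skip

/-- Process the next literal of a queue. -/
def stepProg (mk q h t f : ℕ) : Prog :=
  .seq (.assign 13 (.get q (.var h)))
    (.seq (.assign h (.var h + .const 1)) (forTo 14 1 (scanBody mk q t f)))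

/-- The variables and arrays of either one of the two simultaneous propagations. -/
def Side (mk q h t f : ℕ) : Prop :=
  (mk = 13 ∧ q = 14 ∧ h = 7 ∧ t = 8 ∧ f = 9) ∨ (mk = 15 ∧ q = 16 ∧ h = 10 ∧ t = 11 ∧ f = 12)

/-- The variables that have not been deleted. -/
def Alive (n : ℕ) (s : Store) (k : ℕ) : Prop := k < n ∧ s.arr 12 k ≠ 0

/-- The memory holds the two-satisfiability instance `Conf` on `n` variables. -/
structure SatEnv (n : ℕ) (Conf : ℕ → ℕ → Prop) (w : ℕ) (s : Store) : Prop where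
  three_le : 3 ≤ n
  cap : 100 * (n * n) < cap w
  var0 : s.var 0 = n
  var1 : s.var 1 = 2 * n
  matrix : ∀ u < 2 * n, ∀ v < 2 * n, s.arr 11 (u * (2 * n) + v) ≠ 0 ↔ Conf u v

theorem SatEnv.le {n w : ℕ} {Conf : ℕ → ℕ → Prop} {s : Store} (E : SatEnv n Conf w s) :
    300 * n < ReachableAssignment.cap w := by
  have h1 := E.cap
  have h2 : 3 * n ≤ n * n := Nat.mul_le_mul_right _ E.three_le
  omega

theorem SatEnv.congr {n w : ℕ} {Conf : ℕ → ℕ → Prop} {s s' : Store} (E : SatEnv n Conf w s)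
    {V A : List ℕ} (h : Agree V A s s') (h0 : 0 ∉ V) (h1 : 1 ∉ V) (h11 : 11 ∉ A) :
    SatEnv n Conf w s' where
  three_le := E.three_le
  cap := E.cap
  var0 := by rw [h.var 0 h0, E.var0]
  var1 := by rw [h.var 1 h1, E.var1]
  matrix := by rw [h.arr 11 h11]; exact E.matrix

theorem scanBody_queue {mk q h t f j : ℕ} {s : Store} (hS : Side mk q h t f) (hj : j ≠ s.var t) :
    ((scanBody mk q t f).runN s).arr q j = s.arr q j := by
  simp only [scanBody, Prog.runN]
  rcases hS with ⟨rfl, rfl, rfl, rfl, rfl⟩ | ⟨rfl, rfl, rfl, rfl, rfl⟩ <;> split_ifs <;>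
    simp [Function.update_of_ne hj]

/-- The branches correspond to `miss`, `contradiction`, `known` and `add`. A contradiction only sets
the flag; the scan of the row goes on. -/
theorem runs_scanBody {n w : ℕ} {Conf : ℕ → ℕ → Prop} {A : ℕ → Prop} {s : Store}
    {mk q h t f a i : ℕ} (hS : Side mk q h t f) (E : SatEnv n Conf w s)
    (hA : ∀ k < n, s.arr 12 k ≠ 0 ↔ A k) (hi : i < 2 * n) (h14 : s.var 14 = i)
    (hh : 0 < s.var h) (h13 : s.var 13 = s.arr q (s.var h - 1))
    (P : Propagation n Conf A a (s.arr mk) (s.arr q) (s.var h) (s.var t) (s.var f) i) :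
    Runs w (scanBody mk q t f) s fun time s' => time ≤ 100 ∧
      s'.arr q (s.var h - 1) = s.arr q (s.var h - 1) ∧
      Propagation n Conf A a (s'.arr mk) (s'.arr q) (s'.var h) (s'.var t) (s'.var f) (i + 1) := by
  have hl := E.le
  have hcap := E.cap
  have htl := P.t_le
  have hq := P.q_lt (s.var h - 1) (by have := P.le; omega)
  rw [← h13] at hq
  have hidx := index_lt hq hi
  have e4 : 2 * n * (2 * n) = 4 * (n * n) := by ring
  have hM := E.matrix _ hq i hi
  have hAi := hA (i / 2) (by omega)
  have hneg : i + 1 - 2 * (i % 2) = neg i := rfl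
  have hidx' : s.var 13 * (2 * n) < cap w := by omega
  refine .line (by omega) ?_ fun time ht _ => ⟨?_, scanBody_queue hS (by have := P.le; omega), ?_⟩
  · rcases hS with ⟨rfl, rfl, rfl, rfl, rfl⟩ | ⟨rfl, rfl, rfl, rfl, rfl⟩ <;>
    · simp only [scanBody, negExpr, Prog.Fits, fits_get, fits_add, fits_mul, fits_var, fits_const,
        fits_div, fits_sub, fits_mod, evalN_mul, evalN_var, evalN_const, evalN_mod, E.var1, h14,
        true_and, Prog.runN]
      refine ⟨⟨hidx', by omega⟩, fun _ => trivial, fun _ => ⟨by omega, fun _ => trivial,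
        fun _ => ⟨⟨fun _ => trivial, fun _ => by omega⟩, ?_⟩⟩⟩
      split_ifs <;> simp [h14] <;> omega
  · refine ht.trans ?_
    rcases hS with ⟨rfl, rfl, rfl, rfl, rfl⟩ | ⟨rfl, rfl, rfl, rfl, rfl⟩ <;> decide
  · rw [h13] at hM
    by_cases c1 : s.arr 11 (s.var 13 * (2 * n) + i) = 0
    · have := P.miss fun hc => hM.2 hc.1 (h13 ▸ c1)
      simpa [scanBody, E.var1, h14, c1] using this
    by_cases c2 : s.arr 12 (i / 2) = 0
    · have := P.miss fun hc => hAi.2 hc.2 c2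
      simpa [scanBody, E.var1, h14, c1, c2] using this
    have hC := hM.1 (h13 ▸ c1)
    have hAi' := hAi.1 c2
    by_cases c3 : s.arr mk i = 0
    · by_cases c4 : s.arr mk (neg i) = 0
      · have := P.add hi hh hC hAi' (fun _ => c3) c4
        rcases hS with ⟨rfl, rfl, rfl, rfl, rfl⟩ | ⟨rfl, rfl, rfl, rfl, rfl⟩ <;>
          simpa [scanBody, negExpr, E.var1, h14, c1, c2, c3, hneg, c4] using this
      · have := P.known c4
        rcases hS with ⟨rfl, rfl, rfl, rfl, rfl⟩ | ⟨rfl, rfl, rfl, rfl, rfl⟩ <;>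
          simpa [scanBody, negExpr, E.var1, h14, c1, c2, c3, hneg, c4] using this
    · have P' := P.contradiction hi hh hC c3
      by_cases c4 : s.arr mk (neg i) = 0
      · have := P'.add hi hh hC hAi' (fun h => by omega) c4
        rcases hS with ⟨rfl, rfl, rfl, rfl, rfl⟩ | ⟨rfl, rfl, rfl, rfl, rfl⟩ <;>
          simpa [scanBody, negExpr, E.var1, h14, c1, c2, c3, hneg, c4] using this
      · have := P'.known c4
        rcases hS with ⟨rfl, rfl, rfl, rfl, rfl⟩ | ⟨rfl, rfl, rfl, rfl, rfl⟩ <;>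
          simpa [scanBody, negExpr, E.var1, h14, c1, c2, c3, hneg, c4] using this

/-- Processing a literal means reading one row of the conflict matrix, which takes linear time. -/
theorem runs_stepProg {n w : ℕ} {Conf : ℕ → ℕ → Prop} {A : ℕ → Prop} {s : Store}
    {mk q h t f a : ℕ} (hS : Side mk q h t f) (E : SatEnv n Conf w s)
    (hA : ∀ k < n, s.arr 12 k ≠ 0 ↔ A k) (hlt : s.var h < s.var t)
    (P : Propagation n Conf A a (s.arr mk) (s.arr q) (s.var h) (s.var t) (s.var f) (2 * n)) :
    Runs w (stepProg mk q h t f) s fun time s' => time ≤ 300 * n ∧ s'.var h = s.var h + 1 ∧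
      Propagation n Conf A a (s'.arr mk) (s'.arr q) (s'.var h) (s'.var t) (s'.var f) (2 * n) := by
  have hl := E.le
  have hn := E.three_le
  have htl := P.t_le
  refine .seq (.line (by omega) (by simp) fun t₁ ht₁ _ => ?_)
  have ht₁' : t₁ ≤ 3 := ht₁
  refine .seq (.line (by omega) ?_ fun t₂ ht₂ _ => ?_)
  · rcases hS with ⟨rfl, rfl, rfl, rfl, rfl⟩ | ⟨rfl, rfl, rfl, rfl, rfl⟩ <;> simp <;> omega
  have ht₂' : t₂ ≤ 4 := ht₂
  have P1 := P.next le_rfl hlt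
  set s₂ := (Prog.assign h (.var h + .const 1)).runN ((Prog.assign 13 (.get q (.var h))).runN s)
    with hs₂
  have A2 : Agree [13, h] [] s s₂ := by
    refine ⟨fun x hx => ?_, fun _ _ => by simp [hs₂]⟩
    simp at hx
    simp [hs₂, hx]
  have e2 : s₂.var 13 = s.arr q (s.var h) ∧ s₂.var h = s.var h + 1 ∧ s₂.var t = s.var t ∧
      s₂.var f = s.var f := by
    rcases hS with ⟨rfl, rfl, rfl, rfl, rfl⟩ | ⟨rfl, rfl, rfl, rfl, rfl⟩ <;> simp [hs₂]
  obtain ⟨e2, e3, e4, e5⟩ := e2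
  have E2 : SatEnv n Conf w s₂ := E.congr A2
    (by rcases hS with ⟨rfl, rfl, rfl, rfl, rfl⟩ | ⟨rfl, rfl, rfl, rfl, rfl⟩ <;> decide)
    (by rcases hS with ⟨rfl, rfl, rfl, rfl, rfl⟩ | ⟨rfl, rfl, rfl, rfl, rfl⟩ <;> decide) (by decide)
  rw [← e3, ← e4, ← e5] at P1
  refine .forTo (2 * n) 100 (by omega) E2.var1
    (by rcases hS with ⟨rfl, rfl, rfl, rfl, rfl⟩ | ⟨rfl, rfl, rfl, rfl, rfl⟩ <;> decide)
    (by rcases hS with ⟨rfl, rfl, rfl, rfl, rfl⟩ | ⟨rfl, rfl, rfl, rfl, rfl⟩ <;> decide)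
    (fun i s' => s'.var 13 = s'.arr q (s'.var h - 1) ∧
      Propagation n Conf A a (s'.arr mk) (s'.arr q) (s'.var h) (s'.var t) (s'.var f) i) ?_ ?_ ?_
  · rw [← A2.arr mk (by simp), ← A2.arr q (by simp)] at P1
    rw [← A2.arr q (by simp)] at e2
    rcases hS with ⟨rfl, rfl, rfl, rfl, rfl⟩ | ⟨rfl, rfl, rfl, rfl, rfl⟩ <;>
      exact ⟨by simp [e2, e3], by simpa using P1⟩
  · rintro i hi s₃ A3 h14 ⟨h13, P3⟩
    have eh : s₃.var h = s₂.var h := by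
      apply A3.var
      rcases hS with ⟨rfl, rfl, rfl, rfl, rfl⟩ | ⟨rfl, rfl, rfl, rfl, rfl⟩ <;> decide
    have e12 : s₃.arr 12 = s.arr 12 := by
      rw [A3.arr 12 (by
        rcases hS with ⟨rfl, rfl, rfl, rfl, rfl⟩ | ⟨rfl, rfl, rfl, rfl, rfl⟩ <;> decide), A2.arr 12 (by simp)]
    have E3 : SatEnv n Conf w s₃ := E2.congr A3
      (by rcases hS with ⟨rfl, rfl, rfl, rfl, rfl⟩ | ⟨rfl, rfl, rfl, rfl, rfl⟩ <;> decide)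
      (by rcases hS with ⟨rfl, rfl, rfl, rfl, rfl⟩ | ⟨rfl, rfl, rfl, rfl, rfl⟩ <;> decide)
      (by rcases hS with ⟨rfl, rfl, rfl, rfl, rfl⟩ | ⟨rfl, rfl, rfl, rfl, rfl⟩ <;> decide)
    refine (runs_scanBody hS E3 (by rwa [e12]) hi h14 (by omega) h13 P3).mono
      fun t' s₄ A4 ⟨l4, q4, P4⟩ => ⟨l4, ?_⟩
    have h13' : s₄.var 13 = s₄.arr q (s₄.var h - 1) := by
      rw [A4.var h, q4, ← h13, A4.var 13] <;>
        rcases hS with ⟨rfl, rfl, rfl, rfl, rfl⟩ | ⟨rfl, rfl, rfl, rfl, rfl⟩ <;> decide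
    rcases hS with ⟨rfl, rfl, rfl, rfl, rfl⟩ | ⟨rfl, rfl, rfl, rfl, rfl⟩ <;>
      exact ⟨by simpa using h13', by simpa using P4⟩
  · rintro t₃ s₃ A3 h14 ⟨h13, P3⟩ ht₃
    have eh : s₃.var h = s₂.var h := by
      apply A3.var
      rcases hS with ⟨rfl, rfl, rfl, rfl, rfl⟩ | ⟨rfl, rfl, rfl, rfl, rfl⟩ <;> decide
    exact ⟨by omega, by omega, P3⟩


/-! ### Two propagations in alternation, and their amortised cost -/

/-- Start the propagations from both literals of variable `k`, where `k` is in variable `6`. -/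
def startTrial : Prog :=
  .seq (forTo 13 1 (.seq (.put 13 (.var 13) (.const 0)) (.put 15 (.var 13) (.const 0))))
    (.seq (.seq (.put 13 (.const 2 * .var 6) (.const 1)) (.put 14 (.const 0) (.const 2 * .var 6)))
      (.seq (.seq (.put 15 (.const 2 * .var 6 + .const 1) (.const 1))
          (.put 16 (.const 0) (.const 2 * .var 6 + .const 1)))
        (.seq (.seq (.assign 7 (.const 0)) (.seq (.assign 8 (.const 1)) (.assign 9 (.const 0))))
          (.seq (.assign 10 (.const 0)) (.seq (.assign 11 (.const 1)) (.assign 12 (.const 0)))))))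

theorem runs_startTrial {n w k : ℕ} {Conf : ℕ → ℕ → Prop} {A : ℕ → Prop} {s : Store}
    (E : SatEnv n Conf w s) (h6 : s.var 6 = k) (hk : k < n) (hA : A k) :
    Runs w startTrial s fun time s' => time ≤ 100 * n ∧ s'.var 7 = 0 ∧ s'.var 10 = 0 ∧
      Propagation n Conf A (2 * k) (s'.arr 13) (s'.arr 14) (s'.var 7) (s'.var 8) (s'.var 9)
        (2 * n) ∧
      Propagation n Conf A (2 * k + 1) (s'.arr 15) (s'.arr 16) (s'.var 10) (s'.var 11) (s'.var 12)
        (2 * n) := by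
  have hl := E.le
  have hn := E.three_le
  refine .seq (.forTo (2 * n) 10 (by omega) E.var1 (by decide) (by decide)
    (fun i s' => ∀ u < i, s'.arr 13 u = 0 ∧ s'.arr 15 u = 0) (by simp) ?_ ?_)
  · intro i hi s₁ _ hv hI
    refine .line (by omega) (by simp; omega) fun t ht _ => ⟨ht.trans (by simp), fun u hu => ?_⟩
    by_cases e : u = i
    · simp [e, hv]
    · simp [hv, e, hI u (by omega)]
  · intro t s₁ A1 _ hI ht
    have h6' : s₁.var 6 = k := by rw [A1.var 6 (by decide), h6]
    refine .line (by omega) (by simp [h6']; omega) fun t' ht' _ => ?_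
    have ht' : t' ≤ 100 := ht'.trans (by simp)
    refine ⟨by omega, by simp, by simp, ?_, ?_⟩
    · simp only [Prog.runN, Store.setVar_var, Store.setVar_arr]
      refine .init (by omega) (by rwa [show 2 * k / 2 = k by omega]) (fun u hu => ?_) ?_
      · simp [Function.update_apply, h6', (hI u hu).1]
      · simp [h6']
    · simp only [Prog.runN, Store.setVar_var, Store.setVar_arr]
      refine .init (by omega) (by rwa [show (2 * k + 1) / 2 = k by omega]) (fun u hu => ?_) ?_
      · simp [Function.update_apply, h6', (hI u hu).2]
      · simp [h6']

/-- Run both propagations alternately until one of them is finished without contradiction or both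
have failed. -/
def lockstep : Prog :=
  .loop ((.var 9 + .op .lt (.var 7) (.var 8)) * (.var 12 + .op .lt (.var 10) (.var 11)) *
      (.const 1 - .var 9 * .var 12))
    (.seq (.ite (.var 9) .skip (stepProg 13 14 7 8 9))
      (.ite (.var 12) .skip (stepProg 15 16 10 11 12)))

/-- After `r` rounds of cost `O(n)`, each side that has not failed has processed exactly `r`
literals. So a side that finishes without contradiction has `r` equal to its own queue length,
however long the other queue is. If both fail, the number of rounds is bounded by the two queue
lengths together. -/
theorem runs_lockstep {n w k : ℕ} {Conf : ℕ → ℕ → Prop} {A : ℕ → Prop} {s : Store}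
    (E : SatEnv n Conf w s) (hA : ∀ k < n, s.arr 12 k ≠ 0 ↔ A k) (h7 : s.var 7 = 0)
    (h10 : s.var 10 = 0)
    (P : Propagation n Conf A (2 * k) (s.arr 13) (s.arr 14) (s.var 7) (s.var 8) (s.var 9)
        (2 * n))
    (P' : Propagation n Conf A (2 * k + 1) (s.arr 15) (s.arr 16) (s.var 10) (s.var 11) (s.var 12)
        (2 * n)) :
    Runs w lockstep s fun time s' =>
      Propagation n Conf A (2 * k) (s'.arr 13) (s'.arr 14) (s'.var 7) (s'.var 8) (s'.var 9)
        (2 * n) ∧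
      Propagation n Conf A (2 * k + 1) (s'.arr 15) (s'.arr 16) (s'.var 10) (s'.var 11) (s'.var 12)
        (2 * n) ∧
      (s'.var 9 = 0 → s'.var 7 = s'.var 8 → time ≤ 700 * n * (s'.var 8 + 1)) ∧
      (s'.var 12 = 0 → s'.var 10 = s'.var 11 → time ≤ 700 * n * (s'.var 11 + 1)) ∧
      (¬ (s'.var 9 = 0 ∧ s'.var 7 = s'.var 8) → ¬ (s'.var 12 = 0 ∧ s'.var 10 = s'.var 11) →
        s'.var 9 ≠ 0 ∧ s'.var 12 ≠ 0 ∧ time ≤ 700 * n * (4 * n + 1)) := by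
  have hl := E.le
  have hn := E.three_le
  refine .loop (by omega) (fun time s' => ∃ r, time ≤ 700 * n * r ∧ r ≤ s'.var 7 + s'.var 10 ∧
      (s'.var 9 = 0 → s'.var 7 = r) ∧ (s'.var 12 = 0 → s'.var 10 = r) ∧
      Propagation n Conf A (2 * k) (s'.arr 13) (s'.arr 14) (s'.var 7) (s'.var 8) (s'.var 9)
        (2 * n) ∧
      Propagation n Conf A (2 * k + 1) (s'.arr 15) (s'.arr 16) (s'.var 10) (s'.var 11) (s'.var 12)
        (2 * n)) (fun s' => 4 * n - s'.var 7 - s'.var 10)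
    ⟨0, by simp, by simp, fun _ => h7, fun _ => h10, P, P'⟩ ?_ ?_ ?_
  · rintro t s₁ ⟨r, -, -, -, -, P1, P1'⟩
    have h9 := P1.f_le
    have h12 := P1'.f_le
    have b7 := ltB_le (s₁.var 7) (s₁.var 8)
    have b10 := ltB_le (s₁.var 10) (s₁.var 11)
    have : s₁.var 9 * s₁.var 12 ≤ 1 * 1 := Nat.mul_le_mul h9 h12
    simp only [fits_mul, fits_add, fits_sub, fits_var, fits_lt, fits_const, evalN_mul, evalN_add,
      evalN_sub, evalN_var, evalN_lt, evalN_const, true_and]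
    refine ⟨⟨?_, ?_, ?_⟩, ⟨by omega, by omega⟩, ?_⟩
    · omega
    · omega
    · have := Nat.mul_le_mul (Nat.add_le_add h9 b7) (Nat.add_le_add h12 b10)
      omega
    · have := Nat.mul_le_mul (Nat.mul_le_mul (Nat.add_le_add h9 b7) (Nat.add_le_add h12 b10))
        (Nat.sub_le 1 (s₁.var 9 * s₁.var 12))
      omega
  · rintro t s₁ A1 ⟨r, ht, hr, hr9, hr12, P1, P1'⟩ hb
    have A1' : Agree [14, 13, 7, 8, 9, 10, 11, 12] [13, 14, 15, 16] s s₁ :=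
      A1.mono (by decide) (by decide)
    have E1 := E.congr A1' (by decide) (by decide) (by decide)
    have a1 := A1'.arr 12 (by decide)
    -- In the loop test sums act as disjunctions and products as conjunctions; the last factor stops
    -- the loop after a double failure.
    have hb' : (s₁.var 9 ≠ 0 ∨ s₁.var 7 < s₁.var 8) ∧ (s₁.var 12 ≠ 0 ∨ s₁.var 10 < s₁.var 11) ∧
        ¬ (s₁.var 9 ≠ 0 ∧ s₁.var 12 ≠ 0) := by
      have h9 := P1.f_le
      have h12 := P1'.f_le
      obtain e | e : s₁.var 9 = 0 ∨ s₁.var 9 = 1 := by omega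
      all_goals obtain e' | e' : s₁.var 12 = 0 ∨ s₁.var 12 = 1 := by omega
      all_goals simp [e, e'] at hb ⊢ <;> omega
    have l1 := P1.le
    have l2 := P1'.le
    have l3 := P1.t_le
    have l4 := P1'.t_le
    refine .seq (.ite (by omega) (by simp) (fun e => ?_) fun e => ?_)
    · simp only [evalN_var] at e
      refine .line (by omega) (by simp) fun t₂ ht₂ _ => ?_
      have ht₂ : t₂ ≤ 1 := ht₂
      refine .ite (by omega) (by simp) (fun e' => ?_) fun e' => ?_
      · exact (hb'.2.2 ⟨e, e'⟩).elim
      · simp only [Prog.runN, evalN_var] at e'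
        refine (runs_stepProg (.inr ⟨rfl, rfl, rfl, rfl, rfl⟩) E1 (by simpa [a1] using hA)
          (by omega) P1').mono fun t₃ s₃ A3 ⟨ht₃, h3, P3⟩ => ?_
        have A3' : Agree [14, 13, 10, 11, 12] [15, 16] s₁ s₃ := A3.mono (by decide) (by decide)
        have e3 : s₃.var 7 = s₁.var 7 := A3'.var 7 (by decide)
        refine ⟨⟨r + 1, ?_, by omega, fun h => ?_, fun h => ?_, ?_, P3⟩, by omega⟩
        · simp only [cost_mul, cost_add, cost_sub, cost_var, cost_lt, cost_const]
          rw [Nat.mul_succ]; omega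
        · rw [A3'.var 9 (by decide)] at h; omega
        · have := hr12 e'; omega
        · rwa [A3'.arr 13 (by decide), A3'.arr 14 (by decide), A3'.var 7 (by decide),
            A3'.var 8 (by decide), A3'.var 9 (by decide)]
    · simp only [evalN_var] at e
      refine (runs_stepProg (.inl ⟨rfl, rfl, rfl, rfl, rfl⟩) E1 (by simpa [a1] using hA)
          (by omega) P1).mono fun t₂ s₂ A2 ⟨ht₂, h2, P2⟩ => ?_
      have A2' : Agree [14, 13, 7, 8, 9] [13, 14] s₁ s₂ := A2.mono (by decide) (by decide)
      have E2 := E1.congr A2' (by decide) (by decide) (by decide)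
      have e10 : s₂.var 10 = s₁.var 10 := A2'.var 10 (by decide)
      have e11 : s₂.var 11 = s₁.var 11 := A2'.var 11 (by decide)
      have e12 : s₂.var 12 = s₁.var 12 := A2'.var 12 (by decide)
      have P2' : Propagation n Conf A (2 * k + 1) (s₂.arr 15) (s₂.arr 16) (s₂.var 10) (s₂.var 11)
          (s₂.var 12) (2 * n) := by
        rwa [A2'.arr 15 (by decide), A2'.arr 16 (by decide), e10, e11, e12]
      have hr1 := hr9 e
      refine .ite (by omega) (by simp) (fun e' => ?_) fun e' => ?_
      · simp only [evalN_var] at e'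
        refine .line (by omega) (by simp) fun t₃ ht₃ _ => ?_
        have ht₃ : t₃ ≤ 1 := ht₃
        refine ⟨⟨r + 1, ?_, by simp only [Prog.runN]; omega, fun _ => by simp only [Prog.runN]; omega,
          fun h => (e' h).elim, P2, P2'⟩, by simp only [Prog.runN]; omega⟩
        simp only [cost_mul, cost_add, cost_sub, cost_var, cost_lt, cost_const]
        rw [Nat.mul_succ]; omega
      · simp only [evalN_var] at e'
        have hr2 := hr12 (by omega)
        refine (runs_stepProg (.inr ⟨rfl, rfl, rfl, rfl, rfl⟩) E2
          (by rw [A2'.arr 12 (by decide), a1]; exact hA)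
          (by omega) P2').mono fun t₃ s₃ A3 ⟨ht₃, h3, P3⟩ => ?_
        have A3' : Agree [14, 13, 10, 11, 12] [15, 16] s₂ s₃ := A3.mono (by decide) (by decide)
        have e3 : s₃.var 7 = s₂.var 7 := A3'.var 7 (by decide)
        refine ⟨⟨r + 1, ?_, by omega, fun h => by omega, fun h => by omega, ?_, P3⟩, by omega⟩
        · simp only [cost_mul, cost_add, cost_sub, cost_var, cost_lt, cost_const]
          rw [Nat.mul_succ]; omega
        · rwa [A3'.arr 13 (by decide), A3'.arr 14 (by decide), A3'.var 7 (by decide),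
            A3'.var 8 (by decide), A3'.var 9 (by decide)]
  · rintro t s₁ A1 ⟨r, ht, hr, hr9, hr12, P1, P1'⟩ hb
    have l1 := P1.le
    have l2 := P1'.le
    have l3 := P1.t_le
    have l4 := P1'.t_le
    have hb' : (s₁.var 9 = 0 ∧ s₁.var 8 ≤ s₁.var 7) ∨ (s₁.var 12 = 0 ∧ s₁.var 11 ≤ s₁.var 10) ∨
        (s₁.var 9 ≠ 0 ∧ s₁.var 12 ≠ 0) := by
      have h9 := P1.f_le
      have h12 := P1'.f_le
      obtain e | e : s₁.var 9 = 0 ∨ s₁.var 9 = 1 := by omega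
      all_goals obtain e' | e' : s₁.var 12 = 0 ∨ s₁.var 12 = 1 := by omega
      all_goals simp [e, e'] at hb ⊢ <;> omega
    have key : ∀ b, r ≤ b → t + (17 + 1) ≤ 700 * n * (b + 1) := fun b hb => by
      have := Nat.mul_le_mul_left (700 * n) hb
      rw [Nat.mul_succ]; omega
    simp only [cost_mul, cost_add, cost_sub, cost_var, cost_lt, cost_const]
    exact ⟨P1, P1', fun h _ => key (s₁.var 8) (by have := hr9 h; omega),
      fun h _ => key (s₁.var 11) (by have := hr12 h; omega),
      fun _ _ => ⟨by omega, by omega, key (4 * n) (by omega)⟩⟩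

/-- Delete the variables of the derived literals. -/
def removeProg (q t : ℕ) : Prog := forTo 15 t (.put 12 (.get q (.var 15) / .const 2) (.const 0))

theorem runs_removeProg {w q t : ℕ} {s : Store} (hw : s.var t + 2 < cap w) (ht : t ≠ 15)
    (hq : q ≠ 12) : Runs w (removeProg q t) s fun time s' => time ≤ 14 * s.var t + 6 ∧
      ∀ k, s'.arr 12 k ≠ 0 ↔ s.arr 12 k ≠ 0 ∧ ∀ j < s.var t, s.arr q j / 2 ≠ k := by
  refine .forTo (s.var t) 6 (by omega) rfl (by simp [ht]) (by simp)
    (fun i s' => ∀ k, s'.arr 12 k ≠ 0 ↔ s.arr 12 k ≠ 0 ∧ ∀ j < i, s.arr q j / 2 ≠ k) (by simp) ?_ ?_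
  · intro i hi s₁ A1 hv hI
    refine .line (by omega) (by simp; omega) fun t ht _ => ⟨ht.trans (by simp), fun k => ?_⟩
    have := A1.arr q (by simp [hq])
    simp only [Prog.runN, evalN_div, evalN_get, evalN_var, hv, this, evalN_const,
      Store.setVar_arr, Store.setArr_arr, if_true, Function.update_apply]
    simp only [Nat.lt_succ_iff_lt_or_eq]
    split_ifs with e
    · simp only [ne_eq, not_true_eq_false, false_iff, not_and]
      exact fun _ h => h i (.inr rfl) e.symm
    · rw [hI k]
      refine and_congr_right fun _ => ⟨fun h j hj => ?_, fun h j hj => h j (.inl hj)⟩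
      rcases hj with hj | rfl
      · exact h j hj
      · exact fun h' => e h'.symm
  · exact fun t s₁ _ _ hI ht => ⟨ht, hI⟩

/-- The number of deleted variables. -/
noncomputable def dead (n : ℕ) (s : Store) : ℕ := {k ∈ Finset.range n | s.arr 12 k = 0}.card

theorem dead_le (n : ℕ) (s : Store) : dead n s ≤ n := by
  simpa [dead] using Finset.card_filter_le (Finset.range n) fun k => s.arr 12 k = 0

/-- The queued variables are alive and pairwise different, so the queue length is a lower bound for
the growth of `dead`. -/
theorem dead_add_le {n t : ℕ} {q : ℕ → ℕ} {s s' : Store}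
    (hq : ∀ j < t, q j < 2 * n) (ha : ∀ j < t, s.arr 12 (q j / 2) ≠ 0)
    (hinj : ∀ j < t, ∀ j' < t, q j / 2 = q j' / 2 → j = j')
    (h : ∀ k, s'.arr 12 k ≠ 0 ↔ s.arr 12 k ≠ 0 ∧ ∀ j < t, q j / 2 ≠ k) :
    dead n s + t ≤ dead n s' := by
  classical
  have hc : ((Finset.range t).image fun j => q j / 2).card = t := by
    rw [Finset.card_image_of_injOn, Finset.card_range]
    intro j hj j' hj' e
    exact hinj j (by simpa using hj) j' (by simpa using hj') e
  have hd : Disjoint {k ∈ Finset.range n | s.arr 12 k = 0}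
      ((Finset.range t).image fun j => q j / 2) := by
    rw [Finset.disjoint_left]
    intro k hk hk'
    simp only [Finset.mem_image, Finset.mem_range, Finset.mem_filter] at hk hk'
    obtain ⟨j, hj, rfl⟩ := hk'
    exact ha j hj hk.2
  unfold dead
  calc _ = _ := by rw [Finset.card_union_of_disjoint hd, hc]
    _ ≤ _ := Finset.card_le_card fun k hk => by
      simp only [Finset.mem_union, Finset.mem_image, Finset.mem_range, Finset.mem_filter] at hk ⊢
      rcases hk with hk | ⟨j, hj, rfl⟩
      · refine ⟨hk.1, ?_⟩
        by_contra h'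
        exact ((h k).1 h').1 hk.2
      · refine ⟨by have := hq j hj; omega, ?_⟩
        by_contra h'
        exact ((h _).1 h').2 j hj rfl

/-- Fix the variable in variable `6`, unless this is impossible. -/
def trial : Prog :=
  .seq startTrial <| .seq lockstep <|
    .ite (.op .lt (.var 9 + (.var 8 - .var 7)) (.const 1)) (removeProg 14 8) <|
    .ite (.op .lt (.var 12 + (.var 11 - .var 10)) (.const 1)) (removeProg 16 11)
    (.assign 3 (.const 0))

/-- A successful trial costs `O(n)` for each variable it deletes, plus `O(n)`; this is the first
bound, with `dead` as potential. A double failure may cost `O(n ^ 2)`, but it settles the instance.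
-/
theorem runs_trial {n w k : ℕ} {Conf : ℕ → ℕ → Prop} {s : Store} (hs : ∀ u v, Conf u v → Conf v u)
    (E : SatEnv n Conf w s) (h6 : s.var 6 = k) (hA : Alive n s k) :
    Runs w trial s fun time s' =>
      (s'.var 3 = s.var 3 ∧ s'.arr 12 k = 0 ∧ (∀ l, s.arr 12 l = 0 → s'.arr 12 l = 0) ∧
        ((∃ x, IsSol Conf (Alive n s) x) ↔ ∃ x, IsSol Conf (Alive n s') x) ∧
        time + 1000 * n * dead n s ≤ 1000 * n * (dead n s' + 1)) ∨
      (s'.var 3 = 0 ∧ (¬ ∃ x, IsSol Conf (Alive n s) x) ∧ s'.arr 12 = s.arr 12 ∧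
        time ≤ 1000 * n * (4 * n + 1)) := by
  have hl := E.le
  have hn := E.three_le
  refine .seq ((runs_startTrial E h6 hA.1 hA).mono fun t₁ s₁ A1 ⟨ht₁, h7, h10, P, P'⟩ => ?_)
  have A1' : Agree [7, 8, 9, 10, 11, 12, 13] [13, 14, 15, 16] s s₁ :=
    A1.mono (by decide) (by decide)
  have E1 := E.congr A1' (by decide) (by decide) (by decide)
  have a1 := A1'.arr 12 (by decide)
  refine .seq ((runs_lockstep E1 (by rw [a1]; exact fun l hl => ⟨fun h => ⟨hl, h⟩, fun h => h.2⟩)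
    h7 h10 P P').mono fun t₂ s₂ A2 ⟨P2, P2', c1, c2, c3⟩ => ?_)
  have A2' : Agree [14, 13, 7, 8, 9, 10, 11, 12] [13, 14, 15, 16] s₁ s₂ :=
    A2.mono (by decide) (by decide)
  have a2 : s₂.arr 12 = s.arr 12 := by rw [A2'.arr 12 (by decide), a1]
  have v3 : s₂.var 3 = s.var 3 := by rw [A2'.var 3 (by decide), A1'.var 3 (by decide)]
  have l2 := P2.t_le
  have l2' := P2'.t_le
  have done : ∀ {a mk h f : ℕ} {q t : ℕ}, Propagation n Conf (Alive n s) a (s₂.arr mk) (s₂.arr q)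
      (s₂.var h) (s₂.var t) (s₂.var f) (2 * n) → s₂.var f = 0 → s₂.var h = s₂.var t → a < 2 * n →
      t₂ ≤ 700 * n * (s₂.var t + 1) → a / 2 = k →
      ∀ t₃ s₃ u, u ≤ 20 → s₃.var 3 = s₂.var 3 → t₃ ≤ 14 * s₂.var t + 6 → 
        (∀ k, s₃.arr 12 k ≠ 0 ↔ s₂.arr 12 k ≠ 0 ∧ ∀ j < s₂.var t, s₂.arr q j / 2 ≠ k) →
      (s₃.var 3 = s.var 3 ∧ s₃.arr 12 k = 0 ∧ (∀ l, s.arr 12 l = 0 → s₃.arr 12 l = 0) ∧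
        ((∃ x, IsSol Conf (Alive n s) x) ↔ ∃ x, IsSol Conf (Alive n s₃) x) ∧
        t₁ + (t₂ + (u + t₃)) + 1000 * n * dead n s ≤ 1000 * n * (dead n s₃ + 1)) := by
    intro a mk h f q t P hf hht ha ht₂ hak t₃ s₃ u hu hv ht₃ hr
    rw [a2] at hr
    have hd := dead_add_le P.q_lt (s := s) (s' := s₃) (fun j hj => (P.alive _ (P.q_lt j hj)
      ((P.mk_iff _ (P.q_lt j hj)).2 ⟨j, hj, rfl⟩)).2) (fun j hj j' hj' => P.div_inj hf hj hj') hr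
    refine ⟨hv.trans v3, ?_, fun l hl => ?_, ?_, ?_⟩
    · obtain ⟨j, hj, e⟩ := (P.mk_iff a ha).1 P.start
      by_contra h'
      exact ((hr k).1 h').2 j hj (by rw [e, hak])
    · by_contra h'
      exact ((hr l).1 h').1 hl
    · rw [P.exists_isSol_iff le_rfl hht hf hs fun k hk => hk.1]
      have : Alive n s₃ = fun k => Alive n s k ∧ ∀ j < s₂.var t, s₂.arr q j / 2 ≠ k := by
        funext k
        simp only [Alive, hr, and_assoc]
      rw [this]
    · have h1 := Nat.mul_le_mul_left (1000 * n) hd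
      have h2 : s₂.var t ≤ n * s₂.var t := Nat.le_mul_of_pos_left _ (by omega)
      simp only [Nat.mul_add, Nat.mul_one] at h1 ht₂ ⊢
      simp only [Nat.mul_assoc] at h1 ht₂ ⊢
      omega
  have hc := P2.f_le
  have hc' := P2'.f_le
  have hle := P2.le
  have hle' := P2'.le
  refine .ite (by omega) (by simp; omega) (fun e => ?_) fun e => ?_
  · simp only [evalN_lt, evalN_add, evalN_sub, evalN_var, evalN_const, ne_eq, ltB_eq_zero] at e
    refine (runs_removeProg (by omega) (by decide) (by decide)).mono
      fun t₃ s₃ A3 ⟨ht₃, hr⟩ => .inl ?_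
    exact done P2 (by omega) (by omega) (by have := hA.1; omega) (c1 (by omega) (by omega)) (by omega)
      t₃ s₃ _ (by simp) (A3.var 3 (by decide)) ht₃ hr
  simp only [evalN_lt, evalN_add, evalN_sub, evalN_var, evalN_const, ltB_eq_zero] at e
  refine .ite (by omega) (by simp; omega) (fun e' => ?_) fun e' => ?_
  · simp only [evalN_lt, evalN_add, evalN_sub, evalN_var, evalN_const, ne_eq, ltB_eq_zero] at e'
    refine (runs_removeProg (by omega) (by decide) (by decide)).mono
      fun t₃ s₃ A3 ⟨ht₃, hr⟩ => .inl ?_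
    have := done P2' (by omega) (by omega) (by have := hA.1; omega) (c2 (by omega) (by omega))
      (by omega) t₃ s₃ 18 (by simp) (A3.var 3 (by decide)) ht₃ hr
    refine ⟨this.1, this.2.1, this.2.2.1, this.2.2.2.1, ?_⟩
    have := this.2.2.2.2
    simp only [cost_lt, cost_add, cost_sub, cost_var, cost_const]
    omega
  · simp only [evalN_lt, evalN_add, evalN_sub, evalN_var, evalN_const, ltB_eq_zero] at e'
    obtain ⟨f1, f2, ht₂⟩ := c3 (by omega) (by omega)
    refine .line (by omega) (by simp; omega) fun t₃ ht₃ _ => .inr ⟨by simp, ?_, by simp [a2], ?_⟩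
    · exact not_isSol_of_fail hA P2 P2' f1 f2
    · simp only [cost_lt, cost_add, cost_sub, cost_var, cost_const, Prog.cost] at ht₃ ⊢
      have := Nat.mul_le_mul_right (4 * n) (show 700 * n ≤ 1000 * n by omega)
      simp only [Nat.mul_add, Nat.mul_one] at ht₂ ⊢
      omega

/-- Decide the two-satisfiability instance. -/
def solver : Prog :=
  .seq (forTo 6 0 (.put 12 (.var 6) (.const 1)))
    (.seq (.assign 3 (.const 1))
      (forTo 6 0 (.ite (.var 3) (.ite (.get 12 (.var 6)) trial .skip) .skip)))

theorem runs_solver {n w : ℕ} {Conf : ℕ → ℕ → Prop} {s : Store} (hs : ∀ u v, Conf u v → Conf v u)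
    (E : SatEnv n Conf w s) : Runs w solver s fun time s' => time ≤ 10000 * (n * n) ∧
      (s'.var 3 ≠ 0 ↔ ∃ x, IsSol Conf (fun k => k < n) x) := by
  have hl := E.le
  have hn := E.three_le
  refine .seq (.forTo n 10 (by omega) E.var0 (by decide) (by decide)
    (fun i s' => ∀ k < i, s'.arr 12 k = 1) (by simp) ?_ ?_)
  · intro i hi s₁ _ hv hI
    refine .line (by omega) (by simp; omega) fun t ht _ => ⟨ht.trans (by simp), fun k hk => ?_⟩
    by_cases e : k = i
    · simp [e, hv]
    · simp [hv, e, hI k (by omega)]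
  intro t₁ s₁ A1 _ hI ht₁
  have E1 := E.congr (V := [6]) (A := [12]) (A1.mono (by decide) (by decide)) (by decide)
    (by decide) (by decide)
  refine .seq (.line (by omega) (by simp; omega) fun t₂ ht₂ A2 => ?_)
  have E2 := E1.congr A2 (by decide) (by decide) (by decide)
  have a2 : ((Prog.assign 3 (Expr.const 1)).runN s₁).arr = s₁.arr := by simp
  have v2 : ((Prog.assign 3 (Expr.const 1)).runN s₁).var 3 = 1 := by simp
  generalize (Prog.assign 3 (Expr.const 1)).runN s₁ = s₂ at E2 a2 v2
  have hal : Alive n s₂ = fun k => k < n := by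
    funext k
    simp only [Alive, a2, eq_iff_iff, and_iff_left_iff_imp]
    intro h; rw [hI k h]; simp
  rw [← hal]
  -- `B` is the cost of a failing trial. It is paid at most once, since no trial follows after
  -- variable `3` has become `0`.
  have B : ∃ B, B = 1000 * n * (4 * n + 1) := ⟨_, rfl⟩
  obtain ⟨B, hB⟩ := B
  refine .forTo_timed n (by omega) E2.var0 (by decide) (by decide) (fun i t s' =>
    (s'.var 3 ≠ 0 ∧ ((∃ x, IsSol Conf (Alive n s₂) x) ↔ ∃ x, IsSol Conf (Alive n s') x) ∧
      (∀ k < i, s'.arr 12 k = 0) ∧ t ≤ 1000 * n * dead n s' + 2000 * n * i) ∨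
    (s'.var 3 = 0 ∧ (¬ ∃ x, IsSol Conf (Alive n s₂) x) ∧
      t ≤ 1000 * n * n + 2000 * n * i + B)) ?_ ?_ ?_
  · exact .inl ⟨by simp [v2], Iff.rfl, by simp, by simp⟩
  · intro i hi t s₃ A3 hv hI
    have E3 := E2.congr (V := [6, 7, 8, 9, 10, 11, 12, 13, 14, 15, 3]) (A := [12, 13, 14, 15, 16])
      (A3.mono (by decide) (by decide)) (by decide) (by decide) (by decide)
    have hd := Nat.mul_le_mul_left (1000 * n) (dead_le n s₃)
    refine .ite (by omega) (by simp) (fun e => ?_) fun e => ?_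
    · simp only [evalN_var] at e
      obtain ⟨-, h1, h2, h3⟩ | h := hI
      swap; · exact (e h.1).elim
      refine .ite (by omega) (by simp) (fun e' => ?_) fun e' => ?_
      · simp only [evalN_var, evalN_get, hv] at e'
        refine (runs_trial hs E3 hv ⟨hi, e'⟩).mono fun t' s₄ A4 h => ?_
        rcases h with ⟨c1, c2, c3, c4, c5⟩ | ⟨c1, c2, c3, c4⟩
        · refine .inl ⟨by simp [c1, e], ?_, fun k hk => ?_, ?_⟩
          · exact h1.trans c4
          · by_cases ek : k = i
            · rw [ek]; exact c2
            · exact c3 k (h2 k (by omega))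
          · change _ ≤ 1000 * n * dead n s₄ + _
            simp only [cost_var, cost_get]
            simp only [Nat.mul_add, Nat.mul_one] at c5 ⊢
            omega
        · refine .inr ⟨by simp [c1], by rwa [h1], ?_⟩
          simp only [cost_var, cost_get]
          rw [← hB] at c4
          simp only [Nat.mul_add, Nat.mul_one]
          omega
      · simp only [evalN_var, evalN_get, hv] at e'
        refine .line (by omega) (by simp) fun t' ht' _ => .inl ⟨by simpa using e, ?_, fun k hk => ?_, ?_⟩
        · exact h1
        · by_cases ek : k = i
          · rw [ek]; exact e'
          · exact h2 k (by omega)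
        · change _ ≤ 1000 * n * dead n s₃ + _
          simp only [cost_var, cost_get, Prog.cost] at ht' ⊢
          simp only [Nat.mul_add, Nat.mul_one]
          omega
    · simp only [evalN_var] at e
      obtain h | ⟨-, h1, h2⟩ := hI
      · exact (h.1 e).elim
      refine .line (by omega) (by simp) fun t' ht' _ => .inr ⟨by simpa using e, h1, ?_⟩
      simp only [cost_var, Prog.cost] at ht' ⊢
      simp only [Nat.mul_add, Nat.mul_one]
      omega
  · intro t s₃ A3 hv hI
    have hd := Nat.mul_le_mul_left (1000 * n) (dead_le n s₃)
    have hnn : 3 * n ≤ n * n := Nat.mul_le_mul_right _ hn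
    have ht₂ : t₂ ≤ 2 := ht₂
    rw [show 1000 * n * (4 * n + 1) = 4000 * (n * n) + 1000 * n by ring] at hB
    rw [Nat.mul_assoc 1000 n n] at hd
    rw [Nat.mul_assoc 2000 n n, Nat.mul_assoc 1000 n n] at hI
    obtain ⟨h1, h2, h3, h4⟩ | ⟨h1, h2, h3⟩ := hI
    · refine ⟨by omega, ?_⟩
      rw [h2]
      -- All variables have been deleted, and the empty instance is solvable.
      refine ⟨fun _ => ⟨fun _ => 0, fun k hk => (hk.2 (h3 k hk.1)).elim,
        fun k _ hk => (hk.2 (h3 k hk.1)).elim⟩, fun _ => h1⟩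
    · exact ⟨by omega, by simp [h1, h2]⟩


/-! ### The conflict matrix of a guess -/

/-- The expression evaluates without overflow to `1` or `0`, depending on whether `p` holds. -/
structure Decides (B : ℕ) (s : Store) (e : Expr) (p : Prop) : Prop where
  fits : e.Fits B s
  le : e.evalN s ≤ 1
  iff : e.evalN s ≠ 0 ↔ p

namespace Decides

variable {B : ℕ} {s : Store} {a b : Expr} {p q : Prop}

theorem lt (ha : a.Fits B s) (hb : b.Fits B s) :
    Decides B s (.op .lt a b) (a.evalN s < b.evalN s) :=
  ⟨⟨ha, hb⟩, ltB_le _ _, by simp⟩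

theorem eq (ha : a.Fits B s) (hb : b.Fits B s) :
    Decides B s (.op .eq a b) (a.evalN s = b.evalN s) :=
  ⟨⟨ha, hb⟩, eqB_le _ _, by simp⟩

theorem and (hB : 1 < B) (ha : Decides B s a p) (hb : Decides B s b q) :
    Decides B s (a * b) (p ∧ q) := by
  have := Nat.mul_le_mul ha.le hb.le
  refine ⟨⟨ha.fits, hb.fits, by omega⟩, this, ?_⟩
  rw [← ha.iff, ← hb.iff]
  simp

theorem not (hB : 1 < B) (ha : Decides B s a p) : Decides B s (.const 1 - a) (¬ p) := by
  have := ha.le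
  refine ⟨⟨hB, ha.fits⟩, by simp, ?_⟩
  rw [← ha.iff]
  simp
  omega

theorem or (hB : 2 < B) (ha : Decides B s a p) (hb : Decides B s b q) :
    Decides B s (.op .lt (.const 0) (a + b)) (p ∨ q) := by
  have := ha.le
  have := hb.le
  refine ⟨⟨by simp; omega, ha.fits, hb.fits, by omega⟩, ltB_le _ _, ?_⟩
  rw [← ha.iff, ← hb.iff]
  simp
  omega

theorem congr (ha : Decides B s a p) (h : p ↔ q) : Decides B s a q := by
  rwa [← propext h]

end Decides

/-- The rank of the object at position `l` for the agent at position `x`, as stored in array `9`. -/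
def rankAt (n : ℕ) (s : Store) (x l : ℕ) : ℕ := s.arr 9 (x * n + l)

/-- The entry of array `9` for positions `x` and `l`. -/
def rankExpr (x l : Expr) : Expr := .get 9 (x * .var 0 + l)

/-- Tests whether the objects `r` and `q` can be exchanged across the edge at `E`. -/
def edgeExpr (E r q : Expr) : Expr :=
  (.op .lt (.const 0) (rankExpr (E % .var 0) q) *
      .op .lt (rankExpr (E % .var 0) q) (rankExpr (E % .var 0) r)) *
    (.op .lt (.const 0) (rankExpr ((E + .const 1) % .var 0) r) *
      .op .lt (rankExpr ((E + .const 1) % .var 0) r) (rankExpr ((E + .const 1) % .var 0) q))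

theorem fits_rankExpr {n B : ℕ} {s : Store} (hB : n * n < B) (h0 : s.var 0 = n) {x l : Expr}
    (hx : x.Fits B s) (hl : l.Fits B s) (hxn : x.evalN s < n) (hln : l.evalN s < n) :
    (rankExpr x l).Fits B s := by
  have := index_lt hxn hln
  simp only [rankExpr, fits_get, fits_add, fits_mul, fits_var, evalN_mul, evalN_var, h0, hx, hl,
    true_and]
  omega

theorem decides_edgeExpr {n B : ℕ} {s : Store} (hB : n * n < B) (hn : 2 ≤ n) (h0 : s.var 0 = n)
    {E r q : Expr} (hE : E.Fits B s) (hr : r.Fits B s) (hq : q.Fits B s)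
    (hEB : E.evalN s + 1 < B) (hrn : r.evalN s < n) (hqn : q.evalN s < n) :
    Decides B s (edgeExpr E r q)
      (EdgeOk n (rankAt n s) (E.evalN s) (r.evalN s) (q.evalN s)) := by
  have hnn : 2 * n ≤ n * n := Nat.mul_le_mul_right _ hn
  have f1 : (E % .var 0).Fits B s := by simp [hE]
  have f2 : ((E + .const 1) % .var 0).Fits B s := by simp [hE]; omega
  have l1 : (E % .var 0).evalN s < n := by simp [h0]; exact Nat.mod_lt _ (by omega)
  have l2 : ((E + .const 1) % .var 0).evalN s < n := by simp [h0]; exact Nat.mod_lt _ (by omega)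
  have f0 : (Expr.const 0).Fits B s := by simp; omega
  have e : ∀ x l : Expr, (rankExpr x l).evalN s = rankAt n s (x.evalN s) (l.evalN s) := by
    intro x l; simp [rankExpr, rankAt, h0]
  refine (Decides.and (by omega)
    (.and (by omega) (.lt f0 (fits_rankExpr hB h0 f1 hq l1 hqn))
      (.lt (fits_rankExpr hB h0 f1 hq l1 hqn) (fits_rankExpr hB h0 f1 hr l1 hrn)))
    (.and (by omega) (.lt f0 (fits_rankExpr hB h0 f2 hr l2 hrn))
      (.lt (fits_rankExpr hB h0 f2 hr l2 hrn) (fits_rankExpr hB h0 f2 hq l2 hqn)))).congr ?_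
  simp [e, EdgeOk, h0]

/-- The data of a guess in memory: displacements in array `8`, ranks in array `9`, claims in
array `10`. -/
structure GuessMem (n w : ℕ) (s : Store) : Prop where
  three_le : 3 ≤ n
  cap : 100 * (n * n) < cap w
  var0 : s.var 0 = n
  var1 : s.var 1 = 2 * n
  m_le : s.var 2 ≤ n
  disp_lt : ∀ k < n, s.arr 8 k < n

theorem GuessMem.congr {n w : ℕ} {s s' : Store} (G : GuessMem n w s) {V A : List ℕ}
    (h : Agree V A s s') (h0 : 0 ∉ V) (h1 : 1 ∉ V) (h2 : 2 ∉ V) (h8 : 8 ∉ A) :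
    GuessMem n w s' where
  three_le := G.three_le
  cap := G.cap
  var0 := by rw [h.var 0 h0, G.var0]
  var1 := by rw [h.var 1 h1, G.var1]
  m_le := by rw [h.var 2 h2]; exact G.m_le
  disp_lt := by rw [h.arr 8 h8]; exact G.disp_lt

theorem GuessMem.le {n w : ℕ} {s : Store} (G : GuessMem n w s) :
    300 * n < ReachableAssignment.cap w := by
  have h1 := G.cap
  have h2 : 3 * n ≤ n * n := Nat.mul_le_mul_right _ G.three_le
  omega

/-- The clash relation of the data in memory. -/
def ClashAt (n : ℕ) (s : Store) (k d l e : ℕ) : Prop :=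
  Clash n (s.arr 8) (rankAt n s) (s.var 2) (s.arr 10) k d l e

/-- Tests for a clash of direction `d` of object `k` with direction `e` of object `l`, where `k`, `d`,
`l`, `e` are in the variables `18` to `21`, the displaced positions in `22` and `23`, and the edges
of the first possible meetings in `24` and `25`. -/
def clashExpr : Expr :=
  let d01 := .op .eq (.var 19) (.const 0) * .op .eq (.var 21) (.const 1)
  let d10 := .op .eq (.var 19) (.const 1) * .op .eq (.var 21) (.const 0)
  let or (a b : Expr) : Expr := .op .lt (.const 0) (a + b)
  let not (a : Expr) : Expr := .const 1 - a
  or (.op .eq (.var 19) (.var 21) *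
      not (.op .lt (.var 22) (.var 23) * .op .lt (.var 23) (.var 22 + .var 0))) <|
  or (d01 * (.op .lt (.var 23) (.var 22 + .var 0) * not (edgeExpr (.var 24) (.var 18) (.var 20)))) <|
  or (d01 * (.op .lt (.var 23) (.var 22) *
      not (edgeExpr (.var 24 + .var 2) (.var 18) (.var 20)))) <|
  or (d10 * (.op .lt (.var 22) (.var 23) *
      not (edgeExpr (.var 25 + .var 2) (.var 20) (.var 18)))) <|
  or (d10 * (.op .lt (.var 22 + .var 0) (.var 23) *
      not (edgeExpr (.var 25 + .const 2 * .var 2) (.var 20) (.var 18)))) <|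
  or (.op .eq (.var 20) (.var 18 + .const 1) *
      not (.op .eq (.get 10 (.const 2 * .var 18 + .var 19) + .var 19)
        (.get 10 (.const 2 * .var 20 + .var 21)))) <|
  .op .eq (.var 18) (.const 0) * (.op .eq (.var 20 + .const 1) (.var 0) *
      not (.op .eq (.get 10 (.const 2 * .var 20 + .var 21) + .var 21)
        (.get 10 (.const 2 * .var 18 + .var 19) + .var 2)))

theorem decides_clashExpr {n w k d l e : ℕ} {s : Store} (G : GuessMem n w s)
    (hcl : ∀ u < 2 * n, s.arr 10 u ≤ 2 * n) (hk : k < n) (hl : l < n) (hd : d < 2) (he : e < 2)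
    (h18 : s.var 18 = k) (h19 : s.var 19 = d) (h20 : s.var 20 = l) (h21 : s.var 21 = e)
    (h22 : s.var 22 = k + s.arr 8 k) (h23 : s.var 23 = l + s.arr 8 l)
    (h24 : s.var 24 = k + s.arr 10 (2 * l + 1) + 2 * n - s.arr 10 (2 * k))
    (h25 : s.var 25 = l + s.arr 10 (2 * k + 1) + 2 * n - s.arr 10 (2 * l)) :
    Decides (cap w) s clashExpr (ClashAt n s k d l e) := by
  have hle := G.le
  have hn := G.three_le
  have hcap := G.cap
  have hm := G.m_le
  have hDk := G.disp_lt k hk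
  have hDl := G.disp_lt l hl
  have c1 := hcl (2 * l + 1) (by omega)
  have c2 := hcl (2 * k + 1) (by omega)
  have c3 := hcl (2 * k + d) (by omega)
  have c4 := hcl (2 * l + e) (by omega)
  have b24 : s.var 24 ≤ 5 * n := by omega
  have b25 : s.var 25 ≤ 5 * n := by omega
  have B1 : 1 < cap w := by omega
  have B2 : 2 < cap w := by omega
  have cst : ∀ i ≤ 2, (Expr.const i).Fits (cap w) s := fun i hi => by simp; omega
  have vr : ∀ i, (Expr.var i).Fits (cap w) s := fun i => trivial
  have ed : ∀ E : Expr, E.Fits (cap w) s → E.evalN s ≤ 10 * n → ∀ a b, s.var a < n → s.var b < n →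
      Decides (cap w) s (edgeExpr E (.var a) (.var b))
        (EdgeOk n (rankAt n s) (E.evalN s) (s.var a) (s.var b)) := fun E h1 h2 a b ha hb =>
    decides_edgeExpr (by omega) (by omega) G.var0 h1 (vr a) (vr b) (by omega) ha hb
  have fa : ∀ a b, s.var a + s.var b < cap w → (Expr.var a + Expr.var b).Fits (cap w) s :=
    fun a b h => ⟨trivial, trivial, h⟩
  have v0 := G.var0
  refine (Decides.or B2 (.and B1 (.eq (vr _) (vr _)) (.not B1 (.and B1 (.lt (vr _) (vr _))
      (.lt (vr _) (fa _ _ ?_)))))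
    (.or B2 (.and B1 (.and B1 (.eq (vr _) (cst _ ?_)) (.eq (vr _) (cst _ ?_)))
      (.and B1 (.lt (vr _) (fa _ _ ?_)) (.not B1 (ed _ (vr _) ?_ _ _ ?_ ?_))))
    (.or B2 (.and B1 (.and B1 (.eq (vr _) (cst _ ?_)) (.eq (vr _) (cst _ ?_)))
      (.and B1 (.lt (vr _) (vr _)) (.not B1 (ed _ (fa _ _ ?_) ?_ _ _ ?_ ?_))))
    (.or B2 (.and B1 (.and B1 (.eq (vr _) (cst _ ?_)) (.eq (vr _) (cst _ ?_)))
      (.and B1 (.lt (vr _) (vr _)) (.not B1 (ed _ (fa _ _ ?_) ?_ _ _ ?_ ?_))))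
    (.or B2 (.and B1 (.and B1 (.eq (vr _) (cst _ ?_)) (.eq (vr _) (cst _ ?_)))
      (.and B1 (.lt (fa _ _ ?_) (vr _)) (.not B1 (ed _ ?_ ?_ _ _ ?_ ?_))))
    (.or B2 (.and B1 (.eq (vr _) ?_) (.not B1 (.eq ?_ ?_)))
    (.and B1 (.eq (vr _) (cst _ ?_)) (.and B1 (.eq ?_ (vr _)) (.not B1 (.eq ?_ ?_)))))))))).congr ?_
  all_goals try simp only [fits_add, fits_mul, fits_get, fits_const, fits_var, evalN_add, evalN_mul,
    evalN_get, evalN_var, evalN_const, true_and, v0, h18, h19, h20, h21, h22, h23]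
  all_goals first | omega | skip
  rw [h24, h25]
  unfold ClashAt Clash
  simp only [and_assoc, ne_eq]

/-- `Conf` for the data in memory. -/
def ConfAt (n : ℕ) (s : Store) (u v : ℕ) : Prop :=
  (u / 2 < v / 2 ∧ ClashAt n s (u / 2) (u % 2) (v / 2) (v % 2)) ∨
  (v / 2 < u / 2 ∧ ClashAt n s (v / 2) (v % 2) (u / 2) (u % 2))

theorem ConfAt.symm {n : ℕ} {s : Store} (u v : ℕ) (h : ConfAt n s u v) : ConfAt n s v u :=
  Or.symm h

theorem exists_isSol_confAt {n : ℕ} {s : Store} :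
    (∃ x, IsSol (ConfAt n s) (fun k => k < n) x) ↔
      ∃ x, Consistent n (s.arr 8) (rankAt n s) (s.var 2) (s.arr 10) x := by
  refine exists_congr fun x => and_congr_right fun h2 => ⟨fun h l hl k hkl hc => ?_,
    fun h k l hk hl hc => ?_⟩
  · have e1 := h2 k (by omega)
    have e2 := h2 l hl
    refine h k l (by omega) hl (.inl ⟨by omega, ?_⟩)
    rwa [show (2 * k + x k) / 2 = k by omega, show (2 * l + x l) / 2 = l by omega,
      show (2 * k + x k) % 2 = x k by omega, show (2 * l + x l) % 2 = x l by omega]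
  · have e1 := h2 k hk
    have e2 := h2 l hl
    unfold ConfAt at hc
    rw [show (2 * k + x k) / 2 = k by omega, show (2 * l + x l) / 2 = l by omega,
      show (2 * k + x k) % 2 = x k by omega, show (2 * l + x l) % 2 = x l by omega] at hc
    rcases hc with ⟨h3, hc⟩ | ⟨h3, hc⟩
    · exact h l hl k h3 hc
    · exact h k hk l h3 hc

/-- Write the literals `a` and `b` (variables) and what depends on them to the variables `18` to
`25`. -/
def loadPair (a b : ℕ) : Prog :=
  .seq (.seq (.seq (.assign 18 (.var a / .const 2)) (.assign 19 (.var a % .const 2)))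
    (.seq (.assign 20 (.var b / .const 2)) (.assign 21 (.var b % .const 2))))
  (.seq (.seq (.assign 22 (.var 18 + .get 8 (.var 18))) (.assign 23 (.var 20 + .get 8 (.var 20))))
  (.seq (.assign 24 (.var 18 + .get 10 (.const 2 * .var 20 + .const 1) + .var 1 -
      .get 10 (.const 2 * .var 18)))
    (.assign 25 (.var 20 + .get 10 (.const 2 * .var 18 + .const 1) + .var 1 -
      .get 10 (.const 2 * .var 20)))))

/-- Compute one entry of the conflict matrix. -/
def matrixEntry (a b : ℕ) : Prog :=
  .seq (loadPair a b) (.put 11 (.var 16 * .var 1 + .var 17) clashExpr)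

/-- The target cell is always given by the variables `16` and `17`, whereas `a` and `b` are these
two in the order of the objects; thus the same code fills both halves of the symmetric matrix. -/
theorem runs_matrixEntry {n w u v a b x y : ℕ} {s : Store} (G : GuessMem n w s)
    (hcl : ∀ u < 2 * n, s.arr 10 u ≤ 2 * n) (hu : u < 2 * n) (hv : v < 2 * n)
    (h16 : s.var 16 = u) (h17 : s.var 17 = v) (ha : s.var a = x) (hb : s.var b = y)
    (ha' : a ∈ [16, 17]) (hb' : b ∈ [16, 17]) (hx : x < 2 * n) (hy : y < 2 * n) :
    Runs w (matrixEntry a b) s fun t s' => t ≤ 1000 ∧ ∃ z, (z ≠ 0 ↔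
      ClashAt n s (x / 2) (x % 2) (y / 2) (y % 2)) ∧
      s'.arr 11 = Function.update (s.arr 11) (u * (2 * n) + v) z := by
  have hle := G.le
  have hn := G.three_le
  have hcap := G.cap
  have v1 := G.var1
  have hDk := G.disp_lt (x / 2) (by omega)
  have hDl := G.disp_lt (y / 2) (by omega)
  have c1 := hcl (2 * (y / 2) + 1) (by omega)
  have c2 := hcl (2 * (x / 2) + 1) (by omega)
  have c3 := hcl (2 * (y / 2)) (by omega)
  have c4 := hcl (2 * (x / 2)) (by omega)
  have hidx := index_lt hu hv
  have e4 : 2 * n * (2 * n) = 4 * (n * n) := by ring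
  have na : ∀ i ∈ [18, 19, 20, 21], a ≠ i ∧ b ≠ i := by
    simp only [List.mem_cons, List.not_mem_nil, or_false] at ha' hb' ⊢
    rintro i (rfl | rfl | rfl | rfl) <;> omega
  have n18 := na 18 (by simp)
  have n19 := na 19 (by simp)
  have n20 := na 20 (by simp)
  refine .seq (.line (by omega) ?_ fun t₁ ht₁ A1 => ?_)
  · simp [loadPair, ha, hb, n18, n19, n20, v1]
    omega
  have e18 : ((loadPair a b).runN s).var 18 = x / 2 := by simp [loadPair, ha]
  have e19 : ((loadPair a b).runN s).var 19 = x % 2 := by simp [loadPair, ha, n18]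
  have e20 : ((loadPair a b).runN s).var 20 = y / 2 := by simp [loadPair, hb, n18, n19]
  have e21 : ((loadPair a b).runN s).var 21 = y % 2 := by simp [loadPair, hb, n18, n19, n20]
  have e22 : ((loadPair a b).runN s).var 22 = x / 2 + s.arr 8 (x / 2) := by simp [loadPair, ha]
  have e23 : ((loadPair a b).runN s).var 23 = y / 2 + s.arr 8 (y / 2) := by
    simp [loadPair, hb, n18, n19]
  have e24 : ((loadPair a b).runN s).var 24 =
      x / 2 + s.arr 10 (2 * (y / 2) + 1) + 2 * n - s.arr 10 (2 * (x / 2)) := by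
    simp [loadPair, ha, hb, n18, n19, v1]
  have e25 : ((loadPair a b).runN s).var 25 =
      y / 2 + s.arr 10 (2 * (x / 2) + 1) + 2 * n - s.arr 10 (2 * (y / 2)) := by
    simp [loadPair, ha, hb, n18, n19, v1]
  have ea : ((loadPair a b).runN s).arr = s.arr := by simp [loadPair]
  have A1' : Agree [18, 19, 20, 21, 22, 23, 24, 25] [] s ((loadPair a b).runN s) := A1
  have G1 := G.congr A1' (by decide) (by decide) (by decide) (by decide)
  have ht₁ : t₁ ≤ 100 := ht₁.trans (by simp [loadPair])
  have e16 := A1'.var 16 (by decide)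
  have e17 := A1'.var 17 (by decide)
  have e2 := A1'.var 2 (by decide)
  generalize (loadPair a b).runN s = s₁ at *
  have hC : ClashAt n s = ClashAt n s₁ := by
    unfold ClashAt rankAt
    rw [ea, e2]
  have hdec := decides_clashExpr (k := x / 2) (d := x % 2) (l := y / 2) (e := y % 2) G1 (ea ▸ hcl)
    (by omega) (by omega) (by omega) (by omega) e18 e19 e20 e21 (ea ▸ e22) (ea ▸ e23) (ea ▸ e24)
    (ea ▸ e25)
  refine .line (by omega) ⟨?_, hdec.fits⟩ fun t₂ ht₂ _ => ⟨?_, clashExpr.evalN s₁, ?_, ?_⟩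
  · simp [e16, e17, G1.var1, h16, h17]
    omega
  · have ht₂ : t₂ ≤ 900 := ht₂.trans (by decide)
    omega
  · rw [hC]; exact hdec.iff
  · simp [e16, e17, G1.var1, h16, h17, ea]

/-- Compute the conflict matrix. -/
def fillMatrix : Prog :=
  forTo 16 1 (forTo 17 1
    (.ite (.op .lt (.var 16 / .const 2) (.var 17 / .const 2)) (matrixEntry 16 17)
      (.ite (.op .lt (.var 17 / .const 2) (.var 16 / .const 2)) (matrixEntry 17 16)
        (.put 11 (.var 16 * .var 1 + .var 17) (.const 0)))))

theorem clashAt_congr {n : ℕ} {s s' : Store} {V A : List ℕ} (h : Agree V A s s') (h2 : 2 ∉ V)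
    (h8 : 8 ∉ A) (h9 : 9 ∉ A) (h10 : 10 ∉ A) : ClashAt n s' = ClashAt n s := by
  unfold ClashAt rankAt
  rw [h.var 2 h2, h.arr 8 h8, h.arr 9 h9, h.arr 10 h10]

theorem runs_fillMatrix {n w : ℕ} {s : Store} (G : GuessMem n w s)
    (hcl : ∀ u < 2 * n, s.arr 10 u ≤ 2 * n) :
    Runs w fillMatrix s fun t s' => t ≤ 5000 * (n * n) ∧ SatEnv n (ConfAt n s) w s' := by
  have hle := G.le
  have hn := G.three_le
  have hcap := G.cap
  have hAll : ∀ {s' : Store} {V A : List ℕ}, Agree V A s s' →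
      V ⊆ [16, 17, 18, 19, 20, 21, 22, 23, 24, 25] → A ⊆ [11] →
      Agree [16, 17, 18, 19, 20, 21, 22, 23, 24, 25] [11] s s' := fun h h1 h2 => h.mono h1 h2
  refine .forTo (2 * n) (2300 * n) (by omega) G.var1 (by decide) (by decide)
    (fun i s' => ∀ u < i, ∀ v < 2 * n, s'.arr 11 (u * (2 * n) + v) ≠ 0 ↔ ConfAt n s u v) (by simp) ?_ ?_
  · intro u hu s₁ A1 h16 hI
    have A1' := hAll A1 (by decide) (by decide)
    have G1 := G.congr A1' (by decide) (by decide) (by decide) (by decide)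
    refine .forTo (2 * n) 1100 (by omega) G1.var1 (by decide) (by decide)
      (fun i s' => (∀ u' < u, ∀ v < 2 * n, s'.arr 11 (u' * (2 * n) + v) ≠ 0 ↔ ConfAt n s u' v) ∧
        ∀ v < i, s'.arr 11 (u * (2 * n) + v) ≠ 0 ↔ ConfAt n s u v) ⟨by simpa using hI, by simp⟩ ?_ ?_
    · intro v hv s₂ A2 h17 ⟨hI1, hI2⟩
      have A2' := A2.mono (V' := [16, 17, 18, 19, 20, 21, 22, 23, 24, 25]) (A' := [11])
        (by decide) (by decide)
      have G2 := G1.congr A2' (by decide) (by decide) (by decide) (by decide)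
      have h16 : s₂.var 16 = u := by rw [A2.var 16 (by decide), h16]
      have hcl2 : ∀ u < 2 * n, s₂.arr 10 u ≤ 2 * n := by
        rwa [A2'.arr 10 (by decide), A1'.arr 10 (by decide)]
      have hC : ClashAt n s₂ = ClashAt n s := by
        rw [clashAt_congr A2' (by decide) (by decide) (by decide) (by decide),
          clashAt_congr A1' (by decide) (by decide) (by decide) (by decide)]
      have fin : ∀ z (s' : Store), (z ≠ 0 ↔ ConfAt n s u v) →
          s'.arr 11 = Function.update (s₂.arr 11) (u * (2 * n) + v) z →
          (∀ u' < u, ∀ v < 2 * n, s'.arr 11 (u' * (2 * n) + v) ≠ 0 ↔ ConfAt n s u' v) ∧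
          ∀ v' < v + 1, s'.arr 11 (u * (2 * n) + v') ≠ 0 ↔ ConfAt n s u v' := by
        intro z s' hz hs'
        rw [hs']
        refine ⟨fun u' hu' v' hv' => ?_, fun v' hv' => ?_⟩
        · rw [Function.update_of_ne, hI1 u' hu' v' hv']
          rw [Ne, index_inj hv' hv]
          omega
        · by_cases e : v' = v
          · rw [e, Function.update_self, hz]
          · rw [Function.update_of_ne, hI2 v' (by omega)]
            rw [Ne, index_inj (by omega) hv]
            omega
      refine .ite (by omega) (by simp; omega) (fun e => ?_) fun e => ?_
      · refine (runs_matrixEntry G2 hcl2 hu hv h16 h17 h16 h17 (by simp) (by simp) hu hv).mono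
          fun t s₃ _ ⟨ht, z, hz, hz'⟩ => ⟨by simp; omega, fin z s₃ ?_ hz'⟩
        simp only [evalN_lt, evalN_div, evalN_var, evalN_const, ne_eq, ltB_eq_zero, h16, h17] at e
        rw [hz, hC]
        exact ⟨fun h => .inl ⟨by omega, h⟩, fun h => h.elim (·.2) fun h => by omega⟩
      refine .ite (by omega) (by simp; omega) (fun e' => ?_) fun e' => ?_
      · refine (runs_matrixEntry G2 hcl2 hu hv h16 h17 h17 h16 (by simp) (by simp) hv hu).mono
          fun t s₃ _ ⟨ht, z, hz, hz'⟩ => ⟨by simp; omega, fin z s₃ ?_ hz'⟩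
        simp only [evalN_lt, evalN_div, evalN_var, evalN_const, ne_eq, ltB_eq_zero, h16, h17] at e'
        rw [hz, hC]
        exact ⟨fun h => .inr ⟨by omega, h⟩, fun h => h.elim (fun h => by omega) (·.2)⟩
      · simp only [evalN_lt, evalN_div, evalN_var, evalN_const, ltB_eq_zero, h16, h17] at e e'
        have hidx := index_lt hu hv
        have e4 : 2 * n * (2 * n) = 4 * (n * n) := by ring
        refine .line (by omega) ?_ fun t ht _ => ⟨?_, fin 0 _ ?_ ?_⟩
        · simp [h16, h17, G2.var1]; omega
        · simp at ht ⊢; omega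
        · simp only [ne_eq, not_true_eq_false, false_iff]
          rintro (h | h) <;> omega
        · simp [h16, h17, G2.var1]
    · rintro t s₂ A2 h17 ⟨hI1, hI2⟩ ht
      refine ⟨by omega, fun u' hu' => ?_⟩
      by_cases e : u' = u
      · rw [e]; exact hI2
      · exact hI1 u' (by omega)
  · intro t s₁ A1 h16 hI ht
    have A1' := hAll A1 (by decide) (by decide)
    have G1 := G.congr A1' (by decide) (by decide) (by decide) (by decide)
    refine ⟨?_, hn, hcap, G1.var0, G1.var1, hI⟩
    have h2 : 3 * n ≤ n * n := Nat.mul_le_mul_right _ hn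
    rw [show (2300 * n + 8) * (2 * n) + 6 = 4600 * (n * n) + 16 * n + 6 by ring] at ht
    omega


/-! ### The claims of a guess -/

open Classical in
theorem runs_condAssign {w x : ℕ} {b f : Expr} {s : Store} {p : Prop} (hw : 1 < cap w)
    (hb : Decides (cap w) s b p) (hf : p → f.Fits (cap w) s) :
    Runs w (.ite b (.assign x f) .skip) s fun t s' => t ≤ b.cost + f.cost + 3 ∧
      s' = if p then s.setVar x (f.evalN s) else s := by
  refine .ite hw hb.fits (fun h => ?_) fun h => ?_
  · have hp := hb.iff.1 h
    refine .line hw (hf hp) fun t ht _ => ⟨?_, by simp [hp]⟩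
    simp at ht; omega
  · have hp : ¬ p := fun hp => hb.iff.2 hp h
    refine .line hw trivial fun t ht _ => ⟨?_, by simp [hp]⟩
    simp at ht; omega

theorem card_filter_step {n i : ℕ} (p : ℕ → Prop) [DecidablePred p] :
    ({l ∈ Finset.range (i + 1) | l < n ∧ p l}).card =
      ({l ∈ Finset.range i | l < n ∧ p l}).card + if i < n ∧ p i then 1 else 0 := by
  rw [Finset.range_add_one, Finset.filter_insert]
  split_ifs with h
  · rw [Finset.card_insert_of_notMem (by simp)]
  · simp

theorem card_filter_range_le {n i : ℕ} (p : ℕ → Prop) [DecidablePred p] :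
    ({l ∈ Finset.range i | l < n ∧ p l}).card ≤ n := by
  calc _ ≤ (Finset.range n).card := Finset.card_le_card fun l hl => by
        simp only [Finset.mem_filter, Finset.mem_range] at hl ⊢; exact hl.2.1
    _ = n := Finset.card_range n

/-- Tests whether the object at `l` is counted for an odd claim at `k`. -/
def oddCountExpr : Expr :=
  (.const 1 - .op .lt (.var 17) (.var 16)) *
    .op .lt (.var 0 + .get 8 (.const 0)) (.var 17 + .get 8 (.var 17))

/-- Tests whether the object at `l` is counted for an even claim at `k`. -/
def evenCountExpr : Expr :=
  (.const 1 - .op .lt (.var 17) (.const 2)) * (.op .lt (.var 17) (.var 16) *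
    (.const 1 - .op .lt (.var 17 + .get 8 (.var 17)) (.const 1 + .get 8 (.const 1))))

/-- Tests for `MeetsFirst`. -/
def firstExpr : Expr :=
  .op .lt (.var 17) (.get 8 (.const 0)) *
    ((.const 1 - .op .lt (.var 17 + .var 0) (.var 16 + .get 8 (.var 16))) *
      ((.const 1 - .op .lt (.var 16) (.var 17 + .const 1)) *
        edgeExpr (.var 17) (.const 0) (.var 16)))

/-- Tests for `MeetsSecond`. -/
def secondExpr : Expr :=
  (.const 1 - .op .lt (.var 17) (.var 16)) *
    ((.const 1 - .op .lt (.var 17) (.const 1 + .get 8 (.const 1))) *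
      ((.const 1 - .op .lt (.var 16 + .get 8 (.var 16)) (.var 17 + .const 1)) *
        ((.const 1 - .op .lt (.var 0) (.var 17)) * edgeExpr (.var 17) (.var 16) (.const 1))))

section

variable {n w k l : ℕ} {s : Store}

theorem decides_oddCountExpr (G : GuessMem n w s) (hl : l < n) (h16 : s.var 16 = k)
    (h17 : s.var 17 = l) : Decides (cap w) s oddCountExpr
      (¬ l < k ∧ n + s.arr 8 0 < l + s.arr 8 l) := by
  have hle := G.le
  have hn := G.three_le
  have := G.disp_lt 0 (by omega)
  have := G.disp_lt l hl
  refine (Decides.and (by omega) (.not (by omega) (.lt ?_ ?_)) (.lt ?_ ?_)).congr ?_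
  any_goals exact trivial
  · simp [G.var0]; omega
  · simp [h17]; omega
  · simp [h16, h17, G.var0]

theorem decides_evenCountExpr (G : GuessMem n w s) (hl : l < n) (h16 : s.var 16 = k)
    (h17 : s.var 17 = l) : Decides (cap w) s evenCountExpr
      (¬ l < 2 ∧ l < k ∧ ¬ l + s.arr 8 l < 1 + s.arr 8 1) := by
  have hle := G.le
  have hn := G.three_le
  have := G.disp_lt 1 (by omega)
  have := G.disp_lt l hl
  refine (Decides.and (by omega) (.not (by omega) (.lt ?_ ?_)) (.and (by omega)
    (.lt ?_ ?_) (.not (by omega) (.lt ?_ ?_)))).congr ?_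
  any_goals exact trivial
  · simp; omega
  · simp [h17]; omega
  · simp; omega
  · simp [h16, h17]

theorem decides_firstExpr (G : GuessMem n w s) (hk : k < n) (hl : l < 2 * n)
    (h16 : s.var 16 = k) (h17 : s.var 17 = l) : Decides (cap w) s firstExpr
      (MeetsFirst n (s.arr 8) (rankAt n s) k l) := by
  have hle := G.le
  have hn := G.three_le
  have hcap := G.cap
  have := G.disp_lt 0 (by omega)
  have := G.disp_lt k hk
  refine (Decides.and (by omega) (.lt ?_ ?_) (.and (by omega) (.not (by omega) (.lt ?_ ?_))
    (.and (by omega) (.not (by omega) (.lt ?_ ?_)) (decides_edgeExpr (n := n) (by omega) (by omega)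
      G.var0 ?_ ?_ ?_ ?_ ?_ ?_)))).congr ?_
  any_goals exact trivial
  all_goals simp [h16, h17, G.var0]
  on_goal -1 => simp [MeetsFirst]
  all_goals omega

theorem decides_secondExpr (G : GuessMem n w s) (hk : k < n) (hl : l < 2 * n)
    (h16 : s.var 16 = k) (h17 : s.var 17 = l) : Decides (cap w) s secondExpr
      (MeetsSecond n (s.arr 8) (rankAt n s) k l) := by
  have hle := G.le
  have hn := G.three_le
  have hcap := G.cap
  have := G.disp_lt 1 (by omega)
  have := G.disp_lt k hk
  refine (Decides.and (by omega) (.not (by omega) (.lt ?_ ?_)) (.and (by omega)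
    (.not (by omega) (.lt ?_ ?_)) (.and (by omega) (.not (by omega) (.lt ?_ ?_))
    (.and (by omega) (.not (by omega) (.lt ?_ ?_)) (decides_edgeExpr (n := n) (by omega)
      (by omega) G.var0 ?_ ?_ ?_ ?_ ?_ ?_))))).congr ?_
  any_goals exact trivial
  all_goals simp [h16, h17, G.var0]
  on_goal -1 => simp [MeetsSecond]
  all_goals omega

end

/-- Collect the data for the claims on the object in variable `16`: the counts in variables `18` and
`20`, the meeting edges in `19` and `21`. -/
def claimScan : Prog :=
  .seq (.ite (.op .lt (.var 17) (.var 0))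
      (.seq (.ite oddCountExpr (.assign 18 (.var 18 + .const 1)) .skip)
        (.ite evenCountExpr (.assign 20 (.var 20 + .const 1)) .skip)) .skip)
    (.seq (.ite firstExpr (.assign 19 (.var 17)) .skip) (.ite secondExpr (.assign 21 (.var 17)) .skip))

/-- What `claimScan` has found after looking at the positions below `i`. -/
structure ClaimInv (n : ℕ) (D : ℕ → ℕ) (R : ℕ → ℕ → ℕ) (k i : ℕ) (s : Store) : Prop where
  odd : s.var 18 = {l ∈ Finset.range i | l < n ∧ (¬ l < k ∧ n + D 0 < l + D l)}.card
  even : s.var 20 = {l ∈ Finset.range i | l < n ∧ (¬ l < 2 ∧ l < k ∧ ¬ l + D l < 1 + D 1)}.card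
  first_lt : s.var 19 < 2 * n
  first : ∀ j < i, MeetsFirst n D R k j → MeetsFirst n D R k (s.var 19)
  second : ∀ j < i, MeetsSecond n D R k j → MeetsSecond n D R k (s.var 21)

/-- A later hit overwrites an earlier one. The invariant only promises that the remembered edge is a
possible one as soon as any has been seen, which is enough where the edge is unique. -/
theorem runs_claimScan {n w k i : ℕ} {s : Store} (G : GuessMem n w s) (hk : k < n)
    (hi : i < 2 * n) (h16 : s.var 16 = k) (h17 : s.var 17 = i)
    (hI : ClaimInv n (s.arr 8) (rankAt n s) k i s) :
    Runs w claimScan s fun t s' => t ≤ 400 ∧ ClaimInv n (s.arr 8) (rankAt n s) k (i + 1) s' := by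
  classical
  have hle := G.le
  have hn := G.three_le
  have h18 := hI.odd ▸ card_filter_range_le (n := n) (i := i) _
  have h20 := hI.even ▸ card_filter_range_le (n := n) (i := i) _
  refine .seq (.mono (Q := fun t s' => t ≤ 150 ∧
      s'.var 18 = {l ∈ Finset.range (i + 1) | l < n ∧ (¬ l < k ∧ n + s.arr 8 0 < l + s.arr 8 l)}.card ∧
      s'.var 20 = {l ∈ Finset.range (i + 1) | l < n ∧
        (¬ l < 2 ∧ l < k ∧ ¬ l + s.arr 8 l < 1 + s.arr 8 1)}.card) ?_ ?_)
  · rw [card_filter_step, card_filter_step, ← hI.odd, ← hI.even]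
    refine .ite (by omega) (by simp) (fun e => ?_) fun e => ?_
    · simp only [evalN_lt, evalN_var, h17, G.var0, ne_eq, ltB_eq_zero, not_le] at e
      refine .seq ((runs_condAssign (by omega) (decides_oddCountExpr G e h16 h17) (by simp; omega)).mono
        fun t₁ s₁ A1 ⟨ht₁, e₁⟩ => ?_)
      have A1' : Agree [18] [] s s₁ := A1
      have G1 := G.congr A1' (by decide) (by decide) (by decide) (by decide)
      refine (runs_condAssign (by omega) (decides_evenCountExpr (k := k) G1 e
        (by rw [A1'.var 16 (by decide), h16]) (by rw [A1'.var 17 (by decide), h17]))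
        (by simp [A1'.var 20]; omega)).mono fun t₂ s₂ A2 ⟨ht₂, e₂⟩ => ?_
      have A2' : Agree [20] [] s₁ s₂ := A2
      simp [oddCountExpr] at ht₁
      simp [evenCountExpr] at ht₂
      refine ⟨by simp; omega, ?_, ?_⟩
      · rw [A2'.var 18 (by decide), e₁]
        simp only [e, true_and]
        split_ifs <;> simp
      · rw [e₂, A1'.arr 8 (by decide)]
        simp only [e, true_and]
        split_ifs <;> simp [A1'.var 20]
    · simp only [evalN_lt, evalN_var, h17, G.var0, ltB_eq_zero] at e
      refine .line (by omega) trivial fun t ht _ => ?_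
      simp at ht
      simp [show ¬ i < n by omega]
      omega
  intro t₁ s₁ A1 ⟨ht₁, h1, h2⟩
  have A1' : Agree [18, 20] [] s s₁ := A1.mono (by decide) (by decide)
  have G1 := G.congr A1' (by decide) (by decide) (by decide) (by decide)
  have hR1 : rankAt n s₁ = rankAt n s := by unfold rankAt; rw [A1'.arr 9 (by decide)]
  have h16' : s₁.var 16 = k := by rw [A1'.var 16 (by decide), h16]
  have h17' : s₁.var 17 = i := by rw [A1'.var 17 (by decide), h17]
  refine .seq ((runs_condAssign (by omega) (decides_firstExpr G1 hk hi h16' h17') (by simp)).mono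
    fun t₂ s₂ A2 ⟨ht₂, e₂⟩ => ?_)
  rw [hR1, A1'.arr 8 (by decide)] at e₂
  have A2' : Agree [19] [] s₁ s₂ := A2
  have G2 := G1.congr A2' (by decide) (by decide) (by decide) (by decide)
  have hR2 : rankAt n s₂ = rankAt n s := by
    unfold rankAt; rw [A2'.arr 9 (by decide), A1'.arr 9 (by decide)]
  have h16'' : s₂.var 16 = k := by rw [A2'.var 16 (by decide), h16']
  have h17'' : s₂.var 17 = i := by rw [A2'.var 17 (by decide), h17']
  refine (runs_condAssign (by omega) (decides_secondExpr G2 hk hi h16'' h17'') (by simp)).mono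
    fun t₃ s₃ A3 ⟨ht₃, e₃⟩ => ?_
  rw [hR2, A2'.arr 8 (by decide), A1'.arr 8 (by decide)] at e₃
  have A3' : Agree [21] [] s₂ s₃ := A3
  have c2 : firstExpr.cost ≤ 100 := by decide
  have c3 : secondExpr.cost ≤ 100 := by decide
  simp at ht₂ ht₃
  refine ⟨by omega, ?_, ?_, ?_, ?_, ?_⟩
  · rw [A3'.var 18 (by decide), A2'.var 18 (by decide), h1]
  · rw [A3'.var 20 (by decide), A2'.var 20 (by decide), h2]
  · rw [A3'.var 19 (by decide), e₂]
    split_ifs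
    · simpa [h17'] using hi
    · rw [A1'.var 19 (by decide)]; exact hI.first_lt
  · intro j hj hm
    rw [A3'.var 19 (by decide), e₂]
    split_ifs with h
    · simpa [h17'] using h
    · rw [A1'.var 19 (by decide)]
      refine hI.first j ?_ hm
      have : j ≠ i := by rintro rfl; exact h hm
      omega
  · intro j hj hm
    rw [e₃]
    split_ifs with h
    · simpa [h17''] using h
    · rw [A2'.var 21 (by decide), A1'.var 21 (by decide)]
      refine hI.second j ?_ hm
      have : j ≠ i := by rintro rfl; exact h hm
      omega

/-- Write the claims on the object in variable `16`. -/
def claimWrite : Prog :=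
  .seq (.ite (.op .lt (.var 0 + .get 8 (.const 0)) (.var 16 + .get 8 (.var 16)))
      (.put 10 (.const 2 * .var 16 + .const 1) (.var 2 - .var 18))
      (.put 10 (.const 2 * .var 16 + .const 1) (.var 19)))
    (.ite (.op .lt (.var 16 + .get 8 (.var 16)) (.const 1 + .get 8 (.const 1)))
      (.put 10 (.const 2 * .var 16) (.const 1 + .var 20))
      (.put 10 (.const 2 * .var 16) (.var 16 + .var 2 - .var 21)))

theorem runs_claimWrite {n w k : ℕ} {s : Store} (G : GuessMem n w s) (hk : k < n)
    (h16 : s.var 16 = k) (h20 : s.var 20 ≤ n) : Runs w claimWrite s fun t s' => t ≤ 100 ∧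
      s'.arr 10 = Function.update (Function.update (s.arr 10) (2 * k + 1)
        (if n + s.arr 8 0 < k + s.arr 8 k then s.var 2 - s.var 18 else s.var 19)) (2 * k)
        (if k + s.arr 8 k < 1 + s.arr 8 1 then 1 + s.var 20 else k + s.var 2 - s.var 21) := by
  have hle := G.le
  have hn := G.three_le
  have := G.disp_lt 0 (by omega)
  have := G.disp_lt 1 (by omega)
  have := G.disp_lt k hk
  have := G.m_le
  refine .line (by omega) ?_ fun t ht _ => ⟨ht.trans (by decide), ?_⟩
  · simp only [claimWrite, Prog.Fits, Prog.runN, evalN_lt, ltB_eq_zero, evalN_add, evalN_var,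
      evalN_get, evalN_const, h16, G.var0]
    split_ifs <;> simp [h16, G.var0] <;> omega
  · simp only [claimWrite, Prog.runN, evalN_lt, ltB_eq_zero, evalN_add, evalN_var,
      evalN_get, evalN_const, h16, G.var0]
    by_cases h1 : n + s.arr 8 0 < k + s.arr 8 k <;> by_cases h2 : k + s.arr 8 k < 1 + s.arr 8 1 <;>
      simp [h16, h1, h2, Nat.not_le.2, Nat.not_lt.1]

/-- Compute the claims. -/
def fillClaims : Prog :=
  .seq (forTo 16 0 (.seq (.seq (.seq (.assign 18 (.const 0)) (.assign 19 (.const 0)))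
      (.seq (.assign 20 (.const 0)) (.assign 21 (.const 0))))
    (.seq (forTo 17 1 claimScan) claimWrite))) (.put 10 (.const 0) (.const 0))

/-- The claims on object `k` are as required. -/
structure ClaimsOn (n : ℕ) (D : ℕ → ℕ) (R : ℕ → ℕ → ℕ) (m : ℕ) (cl : ℕ → ℕ) (k : ℕ) : Prop where
  le : cl (2 * k) ≤ 2 * n ∧ cl (2 * k + 1) ≤ 2 * n
  odd_far : n + D 0 < k + D k →
    cl (2 * k + 1) = m - {l ∈ Finset.Ico k n | n + D 0 < l + D l}.card
  odd_near : ¬ n + D 0 < k + D k → ∀ j, MeetsFirst n D R k j →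
    (∀ j', MeetsFirst n D R k j' → j' = j) → cl (2 * k + 1) = j
  even_far : k + D k < 1 + D 1 →
    cl (2 * k) = 1 + {l ∈ Finset.Ico 2 k | ¬ l + D l < 1 + D 1}.card
  even_near : ¬ k + D k < 1 + D 1 → ∀ E, MeetsSecond n D R k E →
    (∀ E', MeetsSecond n D R k E' → E' = E) → cl (2 * k) = k + m - E

/-- The scan runs to `2 * n` because `MeetsSecond` admits the edge `n`; the counts ignore positions
from `n` on. -/
theorem ClaimInv.claimsOn {n k : ℕ} {D : ℕ → ℕ} {R : ℕ → ℕ → ℕ} {m : ℕ} {cl : ℕ → ℕ} {s : Store}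
    (hD : ∀ k < n, D k < n) (hm : m ≤ n) (hk : k < n) (h : ClaimInv n D R k (2 * n) s)
    (h1 : cl (2 * k + 1) = if n + D 0 < k + D k then m - s.var 18 else s.var 19)
    (h2 : cl (2 * k) = if k + D k < 1 + D 1 then 1 + s.var 20 else k + m - s.var 21) :
    ClaimsOn n D R m cl k := by
  have h20 := h.even ▸ card_filter_range_le (n := n) (i := 2 * n) _
  have h19 := h.first_lt
  refine ⟨⟨?_, ?_⟩, fun e => ?_, fun e j hj hu => ?_, fun e => ?_, fun e E hE hu => ?_⟩
  · rw [h2]; split_ifs <;> omega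
  · rw [h1]; split_ifs <;> omega
  · rw [h1, if_pos e, h.odd]
    congr 2
    ext l
    simp only [Finset.mem_filter, Finset.mem_range, Finset.mem_Ico]
    omega
  · rw [h1, if_neg e]
    exact hu _ (h.first j (by have := hj.1; have := hD 0 (by omega); omega) hj)
  · rw [h2, if_pos e, h.even]
    congr 2
    ext l
    simp only [Finset.mem_filter, Finset.mem_range, Finset.mem_Ico]
    omega
  · rw [h2, if_neg e]
    have := hE.2.2.2.1
    rw [hu _ (h.second E (by omega) hE)]

theorem ClaimsOn.congr {n k : ℕ} {D : ℕ → ℕ} {R : ℕ → ℕ → ℕ} {m : ℕ} {cl cl' : ℕ → ℕ}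
    (h : ClaimsOn n D R m cl k) (h0 : cl' (2 * k) = cl (2 * k))
    (h1 : cl' (2 * k + 1) = cl (2 * k + 1)) : ClaimsOn n D R m cl' k := by
  constructor
  · rw [h0, h1]; exact h.le
  · rw [h1]; exact h.odd_far
  · rw [h1]; exact h.odd_near
  · rw [h0]; exact h.even_far
  · rw [h0]; exact h.even_near

theorem runs_fillClaims {n w : ℕ} {s : Store} (G : GuessMem n w s) :
    Runs w fillClaims s fun t s' => t ≤ 1500 * (n * n) ∧
      ClaimSpec n (s.arr 8) (rankAt n s) (s.var 2) (s'.arr 10) := by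
  have hle := G.le
  have hn := G.three_le
  refine .seq (.forTo n (1000 * n) (by omega) G.var0 (by decide) (by decide)
    (fun i s' => ∀ k < i, ClaimsOn n (s.arr 8) (rankAt n s) (s.var 2) (s'.arr 10) k)
    (by simp) ?_ ?_)
  · intro k hk s₁ A1 h16 hI
    have A1' : Agree [16, 17, 18, 19, 20, 21] [10] s s₁ := A1.mono (by decide) (by decide)
    have G1 := G.congr A1' (by decide) (by decide) (by decide) (by decide)
    refine .seq (.line (by omega) (by simp; omega) fun t₂ ht₂ A2 => ?_)
    have A2' := A2.mono (V' := [18, 19, 20, 21]) (A' := []) (by decide) (by decide)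
    have z18 : ((((Prog.assign 18 (.const 0)).seq (.assign 19 (.const 0))).seq
      ((Prog.assign 20 (.const 0)).seq (.assign 21 (.const 0)))).runN s₁).var 18 = 0 := by simp
    have z19 : ((((Prog.assign 18 (.const 0)).seq (.assign 19 (.const 0))).seq
      ((Prog.assign 20 (.const 0)).seq (.assign 21 (.const 0)))).runN s₁).var 19 = 0 := by simp
    have z20 : ((((Prog.assign 18 (.const 0)).seq (.assign 19 (.const 0))).seq
      ((Prog.assign 20 (.const 0)).seq (.assign 21 (.const 0)))).runN s₁).var 20 = 0 := by simp
    generalize (((Prog.assign 18 (.const 0)).seq (.assign 19 (.const 0))).seq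
      ((Prog.assign 20 (.const 0)).seq (.assign 21 (.const 0)))).runN s₁ = s₂ at *
    have ht₂ : t₂ ≤ 10 := ht₂.trans (by decide)
    have G2 := G1.congr A2' (by decide) (by decide) (by decide) (by decide)
    have e8 : s₂.arr 8 = s.arr 8 := by rw [A2'.arr 8 (by decide), A1'.arr 8 (by decide)]
    have e9 : s₂.arr 9 = s.arr 9 := by rw [A2'.arr 9 (by decide), A1'.arr 9 (by decide)]
    have e10 : s₂.arr 10 = s₁.arr 10 := A2'.arr 10 (by decide)
    have em : s₂.var 2 = s.var 2 := by rw [A2'.var 2 (by decide), A1'.var 2 (by decide)]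
    have h16 : s₂.var 16 = k := by rw [A2'.var 16 (by decide), h16]
    refine .seq (.forTo (2 * n) 400 (by omega) G2.var1 (by decide) (by decide)
      (fun i s' => ClaimInv n (s.arr 8) (rankAt n s) k i s') ?_ ?_ ?_)
    · exact ⟨by simp [z18], by simp [z20], by simp [z19]; omega, by simp, by simp⟩
    · intro i hi s₃ A3 h17 hI3
      have A3' : Agree [17, 18, 19, 20, 21] [] s₂ s₃ := A3.mono (by decide) (by decide)
      have G3 := G2.congr A3' (by decide) (by decide) (by decide) (by decide)
      have e8' : s₃.arr 8 = s.arr 8 := by rw [A3'.arr 8 (by decide), e8]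
      have e9' : rankAt n s₃ = rankAt n s := by unfold rankAt; rw [A3'.arr 9 (by decide), e9]
      rw [← e8', ← e9'] at hI3 ⊢
      refine (runs_claimScan G3 hk hi (by rw [A3'.var 16 (by decide), h16]) h17 hI3).mono
        fun t s₄ _ ⟨ht, h⟩ => ⟨ht, h.1, h.2, h.3, h.4, h.5⟩
    · intro t₃ s₃ A3 _ hI3 ht₃
      have A3' : Agree [17, 18, 19, 20, 21] [] s₂ s₃ := A3.mono (by decide) (by decide)
      have G3 := G2.congr A3' (by decide) (by decide) (by decide) (by decide)
      refine (runs_claimWrite G3 hk (by rw [A3'.var 16 (by decide), h16])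
        (hI3.even ▸ card_filter_range_le (n := n) (i := 2 * n) _)).mono fun t₄ s₄ A4 ⟨ht₄, h4⟩ => ?_
      rw [A3'.arr 10 (by decide), A3'.arr 8 (by decide), A3'.var 2 (by decide), e8, e10, em] at h4
      refine ⟨by omega, fun k' hk' => ?_⟩
      change ClaimsOn n (s.arr 8) (rankAt n s) (s.var 2) (s₄.arr 10) k'
      rw [h4]
      by_cases e : k' = k
      · rw [e]
        refine hI3.claimsOn G.disp_lt G.m_le hk ?_ (by simp)
        rw [Function.update_of_ne (by omega)]; simp
      · refine (hI k' (by omega)).congr ?_ ?_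
        · rw [Function.update_of_ne (by omega), Function.update_of_ne (by omega)]
        · rw [Function.update_of_ne (by omega), Function.update_of_ne (by omega)]
  · intro t s₁ A1 _ hI ht
    refine .line (by omega) (by simp; omega) fun t₂ ht₂ _ => ?_
    have h2 : 3 * n ≤ n * n := Nat.mul_le_mul_right _ hn
    rw [show (1000 * n + 8) * n + 6 = 1000 * (n * n) + 8 * n + 6 by ring] at ht
    simp at ht₂
    -- The final write sets the claim for object `0` moving clockwise; the other requirements on
    -- exact values concern positive indices only.
    have hcl : ∀ u, ((Prog.put 10 (.const 0) (.const 0)).runN s₁).arr 10 u =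
        if u = 0 then 0 else s₁.arr 10 u := fun u => by simp [Function.update_apply]
    refine ⟨by omega, fun u hu => ?_, by simp, fun k h1 hk h => ?_, fun k h1 hk h => ?_,
      fun k h1 hk h => ?_, fun k h1 hk h => ?_⟩
    · rw [hcl]
      have := (hI (u / 2) (by omega)).le
      split_ifs
      · omega
      · obtain h | h : u = 2 * (u / 2) ∨ u = 2 * (u / 2) + 1 := by omega
        · rw [h]; exact this.1
        · rw [h]; exact this.2
    all_goals rw [hcl, if_neg (by omega)]
    · exact (hI k hk).odd_far h
    · exact (hI k hk).odd_near h
    · exact (hI k hk).even_far h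
    · exact (hI k hk).even_near h

/-! ### Cyclic orders from an isomorphism with the cycle graph -/

open SimpleGraph

/-- Identify the vertices with `ZMod n` by `φ`. Adjacent vertices differ by `ε = 1` or `ε = -1`, and
`i ↦ φ u + i * ε` runs through the cycle from `u` in the direction of `v`. -/
theorem CycOrder.exists_of_adj {n : ℕ} {G : SimpleGraph (Fin n)} (hn : 3 ≤ n)
    (ψ : G ≃g cycleGraph n) {u v : Fin n} (h : G.Adj u v) :
    ∃ c, CycOrder G c ∧ c 0 = u ∧ c 1 = v := by
  obtain ⟨m, rfl⟩ : ∃ m, n = m + 2 := ⟨n - 2, by omega⟩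
  have hadj : ∀ a b : ZMod (m + 2), (cycleGraph (m + 2)).Adj a b ↔ a - b = 1 ∨ b - a = 1 :=
    fun a b => cycleGraph_adj
  let φ : Fin (m + 2) ≃ ZMod (m + 2) := ψ.toEquiv
  have hφ : ∀ a b, G.Adj a b ↔ φ a - φ b = 1 ∨ φ b - φ a = 1 := fun a b => by
    rw [← hadj]; exact ψ.map_rel_iff.symm
  have key : ∀ i j : ℤ, ((i : ZMod (m + 2)) = j ↔ ((m + 2 : ℕ) : ℤ) ∣ i - j) := fun i j => by
    rw [eq_comm]
    exact ZMod.intCast_eq_intCast_iff_dvd_sub _ _ _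
  obtain ⟨ε, hε, hε1⟩ : ∃ ε : ZMod (m + 2), φ v = φ u + ε ∧ (ε = 1 ∨ ε = -1) := by
    refine ⟨φ v - φ u, by ring, ?_⟩
    rcases (hφ u v).1 h with h | h
    · right; rw [← h]; ring
    · left; exact h
  have hεε : ε * ε = 1 := by rcases hε1 with rfl | rfl <;> ring
  have hcan : ∀ a b : ZMod (m + 2), a * ε = b * ε ↔ a = b := fun a b =>
    ⟨fun h => by
      have := congrArg (· * ε) h
      simpa [mul_assoc, hεε] using this, fun h => by rw [h]⟩
  refine ⟨fun i => φ.symm (φ u + i * ε), ⟨fun i j => ?_, fun y => ?_, fun i j => ?_⟩, by simp,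
    by simp [← hε]⟩
  · rw [φ.symm.injective.eq_iff, add_right_inj, hcan, key]
  · obtain ⟨i, hi⟩ := ZMod.intCast_surjective ((φ y - φ u) * ε)
    refine ⟨i, ?_⟩
    simp [hi, mul_assoc, hεε]
  · rw [hφ, ← key, ← key]
    simp only [Equiv.apply_symm_apply, add_sub_add_left_eq_sub, ← sub_mul]
    push_cast
    rcases hε1 with rfl | rfl
    · rw [or_comm]
      simp only [mul_one]
    · simp only [mul_neg, mul_one, neg_sub]

theorem CycOrder.eq_of_adj {n : ℕ} {G : SimpleGraph (Fin n)} {c : ℤ → Fin n} (hc : CycOrder G c)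
    {i : ℤ} {y : Fin n} (h : G.Adj (c i) y) : y = c (i + 1) ∨ y = c (i - 1) := by
  obtain ⟨j, rfl⟩ := hc.surj y
  rw [hc.adj_iff] at h
  rw [hc.eq_iff, hc.eq_iff]
  rcases h with h | h
  · exact .inl (by rwa [← sub_sub])
  · exact .inr (by rwa [← dvd_neg, show -(j - (i - 1)) = i - j - 1 by ring])

theorem vec_val {n : ℕ} (f : Fin n → ℕ) (i : Fin n) : vec n f i = f i := by simp [vec]

theorem table_val {n : ℕ} (f : Fin n → Fin n → ℕ) (i j : Fin n) : table n f (i * n + j) = f i j := by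
  have h := index_lt i.2 j.2
  have hn : 0 < n := i.pos
  unfold table
  rw [dif_pos h]
  congr 1 <;> ext
  · simp [Nat.add_comm (_ * n), Nat.add_mul_div_right _ _ hn, Nat.div_eq_of_lt j.2]
  · simp [Nat.mod_eq_of_lt j.2]

/-! ### The cyclic order of the agents -/

/-- The input in memory. -/
structure InputMem {n : ℕ} (I : Inst n) (w : ℕ) (s : Store) : Prop where
  three_le : 3 ≤ n
  cap : 100 * (n * n) < cap w
  var0 : s.var 0 = n
  var1 : s.var 1 = 2 * n
  init : ∀ i, s.arr 0 (i : Fin n) = I.init i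
  target : ∀ i, s.arr 1 (i : Fin n) = I.target i
  length : ∀ i, s.arr 2 (i : Fin n) = (I.pref i).length
  pref : ∀ (i : Fin n) (j : ℕ) (h : j < (I.pref i).length), s.arr 3 (i * n + j) = (I.pref i)[j]
  adj : ∀ i j : Fin n, s.arr 4 (i * n + j) ≠ 0 ↔ I.graph.Adj i j

namespace InputMem

variable {n w : ℕ} {I : Inst n} {s s' : Store}

theorem congr (M : InputMem I w s) {V A : List ℕ} (h : Agree V A s s') (h0 : 0 ∉ V) (h1 : 1 ∉ V)
    (hA : ∀ a < 5, a ∉ A) : InputMem I w s' where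
  three_le := M.three_le
  cap := M.cap
  var0 := by rw [h.var 0 h0, M.var0]
  var1 := by rw [h.var 1 h1, M.var1]
  init := by rw [h.arr 0 (hA 0 (by omega))]; exact M.init
  target := by rw [h.arr 1 (hA 1 (by omega))]; exact M.target
  length := by rw [h.arr 2 (hA 2 (by omega))]; exact M.length
  pref := by rw [h.arr 3 (hA 3 (by omega))]; exact M.pref
  adj := by rw [h.arr 4 (hA 4 (by omega))]; exact M.adj

theorem le (M : InputMem I w s) : 300 * n < ReachableAssignment.cap w := by
  have h1 := M.cap
  have h2 : 3 * n ≤ n * n := Nat.mul_le_mul_right _ M.three_le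
  omega

end InputMem

theorem length_pref_le {n : ℕ} (I : Inst n) (i : Fin n) : (I.pref i).length ≤ n := by
  simpa using (I.pref_nodup i).length_le_card

/-- Find a neighbour of the agent in variable `27` other than the one in variable `26`. -/
def nextAgent : Prog :=
  .seq (.assign 28 (.const 0))
    (forTo 17 0 (.ite (.get 4 (.var 27 * .var 0 + .var 17))
      (.ite (.op .eq (.var 17) (.var 26)) .skip (.assign 28 (.var 17))) .skip))

/-- If several neighbours qualify, the last one found is kept; any of them will do. -/
theorem runs_nextAgent {n w : ℕ} {I : Inst n} {s : Store} (M : InputMem I w s) {u y : Fin n}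
    (h27 : s.var 27 = u) (hy : I.graph.Adj u y) (hy' : (y : ℕ) ≠ s.var 26) :
    Runs w nextAgent s fun t s' => t ≤ 60 * n ∧ ∃ z : Fin n, s'.var 28 = z ∧ I.graph.Adj u z ∧
      (z : ℕ) ≠ s.var 26 := by
  have hle := M.le
  have hn := M.three_le
  have hcap := M.cap
  refine .seq (.line (by omega) (by simp; omega) fun t₁ ht₁ A1 => ?_)
  have A1' : Agree [28] [] s ((Prog.assign 28 (.const 0)).runN s) := A1
  have M1 := M.congr A1' (by decide) (by decide) (by simp)
  have e26 := A1'.var 26 (by decide)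
  have e27 := A1'.var 27 (by decide)
  have z28 : ((Prog.assign 28 (.const 0)).runN s).var 28 = 0 := by simp
  generalize (Prog.assign 28 (.const 0)).runN s = s₁ at *
  have ht₁ : t₁ ≤ 2 := ht₁
  refine .forTo n 30 (by omega) M1.var0 (by decide) (by decide)
    (fun i s' => s'.var 28 < n ∧ ∀ j : Fin n, (j : ℕ) < i → I.graph.Adj u j → (j : ℕ) ≠ s.var 26 →
      ∃ z : Fin n, s'.var 28 = z ∧ I.graph.Adj u z ∧ (z : ℕ) ≠ s.var 26)
    ⟨by simp [z28]; omega, by simp⟩ ?_ ?_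
  · intro i hi s₂ A2 h17 ⟨hI1, hI2⟩
    have A2' : Agree [17, 28] [] s₁ s₂ := A2.mono (by decide) (by decide)
    have M2 := M1.congr A2' (by decide) (by decide) (by simp)
    have h27' : s₂.var 27 = u := by rw [A2'.var 27 (by decide), e27, h27]
    have h26' : s₂.var 26 = s.var 26 := by rw [A2'.var 26 (by decide), e26]
    have hidx := index_lt u.2 hi
    have hadj := M2.adj u ⟨i, hi⟩
    refine .line (by omega) ?_ fun t ht _ => ⟨ht.trans (by simp), ?_⟩
    · simp [h27', M2.var0, h17]; omega
    · simp only [Prog.runN, evalN_get, evalN_add, evalN_mul, evalN_var, evalN_eq, h27', M2.var0, h17,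
        h26', eqB_eq_zero]
      dsimp only at hadj
      by_cases c1 : s₂.arr 4 (u * n + i) = 0
      · rw [if_pos c1]
        refine ⟨by simpa using hI1, fun j hj hA hj' => ?_⟩
        have : (j : ℕ) ≠ i := by
          rintro rfl
          exact hadj.2 hA c1
        simpa using hI2 j (by omega) hA hj'
      rw [if_neg c1]
      by_cases c2 : i = s.var 26
      · rw [if_neg (by simp [c2])]
        refine ⟨by simpa using hI1, fun j hj hA hj' => ?_⟩
        simpa using hI2 j (by omega) hA hj'
      · rw [if_pos c2]
        exact ⟨by simpa using hi, fun j hj hA hj' => ⟨⟨i, hi⟩, by simp, hadj.1 c1, c2⟩⟩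
  · intro t s₂ _ _ hI ht
    exact ⟨by omega, hI.2 y y.2 hy hy'⟩

/-- List the agents along the cycle in array `5`. -/
def traverse : Prog :=
  .seq (.seq (.assign 26 (.var 0)) (.assign 27 (.const 0)))
    (forTo 16 0 (.seq (.put 5 (.var 16) (.var 27))
      (.seq nextAgent (.seq (.assign 26 (.var 27)) (.assign 27 (.var 28))))))

/-- The orientation is settled by the first neighbour that the program picks. Therefore the order
`c` is existentially quantified inside the invariant and may still be replaced in round `0`. -/
theorem runs_traverse {n w : ℕ} {I : Inst n} {s : Store} (M : InputMem I w s) (hI : I.OnCycle) :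
    Runs w traverse s fun t s' => t ≤ 100 * (n * n) ∧
      ∃ c, CycOrder I.graph c ∧ ∀ k < n, s'.arr 5 k = c k := by
  have hle := M.le
  have hn := M.three_le
  obtain ⟨ψ⟩ := hI
  have hadj0 : ∃ y, I.graph.Adj ⟨0, by omega⟩ y := by
    obtain ⟨m, rfl⟩ : ∃ m, n = m + 2 := ⟨n - 2, by omega⟩
    refine ⟨ψ.symm (ψ ⟨0, by omega⟩ + 1), ?_⟩
    rw [← ψ.map_rel_iff]
    simp [cycleGraph_adj]
  obtain ⟨y₀, hy₀⟩ := hadj0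
  refine .seq (.line (by omega) (by simp; omega) fun t₁ ht₁ A1 => ?_)
  have A1' : Agree [26, 27] [] s
    (((Prog.assign 26 (.var 0)).seq (.assign 27 (.const 0))).runN s) := A1
  have M1 := M.congr A1' (by decide) (by decide) (by simp)
  -- The value `n` is not an agent, so at the start no neighbour is excluded as predecessor.
  have e26 : (((Prog.assign 26 (.var 0)).seq (.assign 27 (.const 0))).runN s).var 26 = n := by
    simp [M.var0]
  have e27 : (((Prog.assign 26 (.var 0)).seq (.assign 27 (.const 0))).runN s).var 27 = 0 := by simp
  generalize ((Prog.assign 26 (.var 0)).seq (.assign 27 (.const 0))).runN s = s₁ at *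
  have ht₁ : t₁ ≤ 4 := ht₁
  refine .forTo n (70 * n) (by omega) M1.var0 (by decide) (by decide)
    (fun i s' => ∃ c, CycOrder I.graph c ∧ (∀ k < i, s'.arr 5 k = c k) ∧ s'.var 27 = c i ∧
      (i = 0 → s'.var 26 = n) ∧ (0 < i → s'.var 26 = c ((i : ℤ) - 1))) ?_ ?_ ?_
  · obtain ⟨c, hc, h0, -⟩ := CycOrder.exists_of_adj hn ψ hy₀
    refine ⟨c, hc, by simp, ?_, by simp [e26], by simp⟩
    simp [e27, h0]
  · rintro i hi s₂ A2 h16 ⟨c, hc, h5, h27, h26, h26'⟩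
    have A2' : Agree [16, 17, 26, 27, 28] [5] s₁ s₂ := A2.mono (by decide) (by decide)
    have M2 := M1.congr A2' (by decide) (by decide) (by simp; omega)
    refine .seq (.line (by omega) (by simp) fun t₃ ht₃ A3 => ?_)
    have A3' : Agree [] [5] s₂ ((Prog.put 5 (.var 16) (.var 27)).runN s₂) := A3
    have M3 := M2.congr A3' (by decide) (by decide) (by simp; omega)
    have e5 : ((Prog.put 5 (.var 16) (.var 27)).runN s₂).arr 5 =
      Function.update (s₂.arr 5) i (c i) := by simp [h16, h27]
    have v3 : ((Prog.put 5 (.var 16) (.var 27)).runN s₂).var = s₂.var := rfl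
    generalize (Prog.put 5 (.var 16) (.var 27)).runN s₂ = s₃ at *
    have ht₃ : t₃ ≤ 3 := ht₃
    have hnext : ((c ((i : ℤ) + 1) : Fin n) : ℕ) ≠ s₃.var 26 := by
      rw [v3]
      rcases Nat.eq_zero_or_pos i with h | h
      · rw [h26 h]; exact (c _).2.ne
      -- The two neighbours on the cycle are different agents because `3 ≤ n`.
      · rw [h26' h]
        intro e
        rw [Fin.val_inj, hc.eq_iff] at e
        have := Int.eq_zero_of_abs_lt_dvd e (by rw [abs_lt]; omega)
        omega
    have ha : I.graph.Adj (c i) (c ((i : ℤ) + 1)) := by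
      rw [hc.adj_iff]; left; simp
    refine .seq ((runs_nextAgent M3 (v3 ▸ h27) ha hnext).mono
      fun t₄ s₄ A4 ⟨ht₄, z, hz, hzA, hz'⟩ => ?_)
    have A4' : Agree [28, 17] [] s₃ s₄ := A4.mono (by decide) (by decide)
    refine .line (by omega) (by simp) fun t₅ ht₅ A5 => ⟨?_, ?_⟩
    · have ht₅ : t₅ ≤ 4 := ht₅
      omega
    simp only [Prog.runN, Store.setVar_arr, Store.setVar_var, evalN_var]
    rw [A4'.arr 5 (by decide), A4'.var 27 (by decide), e5, v3, h27, hz]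
    have h5' : ∀ k < i + 1, Function.update (s₂.arr 5) i (c i : ℕ) k = c k := fun k hk => by
      by_cases e : k = i
      · rw [e, Function.update_self]
      · rw [Function.update_of_ne e, h5 k (by omega)]
    rcases Nat.eq_zero_or_pos i with rfl | h
    · obtain ⟨c', hc', h0, h1⟩ := CycOrder.exists_of_adj hn ψ hzA
      refine ⟨c', hc', fun k hk => ?_, ?_, by simp, fun _ => ?_⟩
      · rw [h5' k hk]
        obtain rfl : k = 0 := by omega
        exact congrArg _ h0.symm
      · simp [h1]
      · simp [h0]
    · have hzc : z = c ((i : ℤ) + 1) := by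
        rcases hc.eq_of_adj hzA with h' | h'
        · exact h'
        · refine (hz' ?_).elim
          rw [v3, h26' h, h']
      refine ⟨c, hc, h5', ?_, by simp, fun _ => ?_⟩
      · simp [hzc]
      · simp
  · rintro t s₂ - - ⟨c, hc, h5, -⟩ ht
    have h2 : 3 * n ≤ n * n := Nat.mul_le_mul_right _ hn
    rw [show (70 * n + 8) * n + 6 = 70 * (n * n) + 8 * n + 6 by ring] at ht
    exact ⟨by omega, c, hc, h5⟩


/-! ### The data of a guess -/

/-- The agents along the cycle `c` are in array `6`, the positions of the objects in array `7`. -/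
structure OrderMem {n : ℕ} (I : Inst n) (c : ℤ → Fin n) (s : Store) : Prop where
  agent : ∀ k < n, s.arr 6 k = c k
  position : ∀ k < n, s.arr 7 (I.init (c k)) = k

theorem OrderMem.congr {n : ℕ} {I : Inst n} {c : ℤ → Fin n} {s s' : Store} (O : OrderMem I c s)
    {V A : List ℕ} (h : Agree V A s s') (h6 : 6 ∉ A) (h7 : 7 ∉ A) : OrderMem I c s' where
  agent := by rw [h.arr 6 h6]; exact O.agent
  position := by rw [h.arr 7 h7]; exact O.position

theorem OrderMem.exists_position {n : ℕ} {I : Inst n} {c : ℤ → Fin n} {s : Store}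
    (O : OrderMem I c s) (hc : CycOrder I.graph c) (o : Fin n) :
    ∃ k < n, s.arr 7 o = k ∧ I.init (c k) = o := by
  obtain ⟨k, hk, h⟩ := hc.exists_nat (I.init.symm o)
  have e : I.init (c k) = o := by rw [h, Equiv.apply_symm_apply]
  exact ⟨k, hk, by rw [← e, O.position k hk], e⟩

/-- Shift the cyclic order of the agents by the number in variable `5`. -/
def rotate : Prog :=
  forTo 16 0 (.seq (.put 6 (.var 16) (.get 5 ((.var 5 + .var 16) % .var 0)))
    (.put 7 (.get 0 (.get 6 (.var 16))) (.var 16)))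

theorem runs_rotate {n w g : ℕ} {I : Inst n} {c : ℤ → Fin n} {s : Store} (M : InputMem I w s)
    (hc : CycOrder I.graph c) (h5 : ∀ k < n, s.arr 5 k = c k) (hg : s.var 5 = g) (hgn : g < n) :
    Runs w rotate s fun t s' => t ≤ 40 * n ∧ OrderMem I (fun i => c (g + i)) s' := by
  have hle := M.le
  have hn := M.three_le
  have hcg := hc.shift g
  refine .forTo n 20 (by omega) M.var0 (by decide) (by decide)
    (fun i s' => (∀ k < i, s'.arr 6 k = c (g + k)) ∧ ∀ k < i, s'.arr 7 (I.init (c (g + k))) = k)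
    (by simp) ?_ ?_
  · rintro i hi s₁ A1 h16 ⟨hI1, hI2⟩
    have A1' : Agree [16] [6, 7] s s₁ := A1.mono (by decide) (by decide)
    have M1 := M.congr A1' (by decide) (by decide) (by simp; omega)
    have hg1 : s₁.var 5 = g := by rw [A1'.var 5 (by decide), hg]
    have e5 : s₁.arr 5 ((g + i) % n) = c (g + i) := by
      rw [A1'.arr 5 (by decide), h5 _ (Nat.mod_lt _ (by omega))]
      push_cast
      rw [hc.emod]
    refine .line (by omega) ?_ fun t ht _ => ⟨ht.trans (by simp), fun k hk => ?_, fun k hk => ?_⟩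
    · simp [hg1, h16]; omega
    · simp only [Prog.runN, Store.setVar_arr, Store.setArr_arr, evalN_var, evalN_get, evalN_mod,
        evalN_add, h16, hg1, M1.var0, e5]
      by_cases e : k = i
      · simp [e]
      · simpa [e] using hI1 k (by omega)
    · simp [Prog.runN, h16, hg1, M1.var0, e5, M1.init]
      by_cases e : k = i
      · simp [e]
      · rw [Function.update_of_ne, hI2 k (by omega)]
        rw [Ne, Fin.val_inj, I.init.injective.eq_iff]
        exact fun h => e (hcg.natCast_injOn (by omega) hi h)
  · intro t s₁ _ _ hI ht
    exact ⟨by omega, hI.1, hI.2⟩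

/-- Compute the displacements. -/
def fillDisp : Prog :=
  forTo 16 0 (.seq (.assign 17 (.get 7 (.get 1 (.get 6 (.var 16)))))
    (.put 8 (.var 17) ((.var 16 + .var 0 - .var 17) % .var 0)))

theorem runs_fillDisp {n w : ℕ} {I : Inst n} {c : ℤ → Fin n} {s : Store} (M : InputMem I w s)
    (hc : CycOrder I.graph c) (O : OrderMem I c s) :
    Runs w fillDisp s fun t s' => t ≤ 40 * n ∧ IsDisp I c (s'.arr 8) := by
  have hle := M.le
  have hn := M.three_le
  refine .forTo n 20 (by omega) M.var0 (by decide) (by decide)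
    -- Round `k` treats the object whose target is position `k`, so the entries are written in the
    -- order of the targets. Adding `n` prevents a truncated subtraction.
    (fun i s' => ∀ k < i, ∀ a < n, I.init (c (a : ℕ)) = I.target (c (k : ℕ)) →
      s'.arr 8 a = (k + n - a) % n)
    (by simp) ?_ ?_
  · rintro i hi s₁ A1 h16 hI
    have A1' : Agree [16, 17] [8] s s₁ := A1.mono (by decide) (by decide)
    have M1 := M.congr A1' (by decide) (by decide) (by simp; omega)
    have O1 := O.congr A1' (by decide) (by decide)
    obtain ⟨a, ha, e7, ea⟩ := O1.exists_position hc (I.target (c i))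
    refine .line (by omega) ?_ fun t ht _ => ⟨ht.trans (by simp), fun k hk b hb e => ?_⟩
    · simp [h16, M1.var0]; omega
    · simp [h16, O1.agent i hi, M1.target, e7, M1.var0]
      by_cases ek : k = i
      · subst ek
        have : b = a := hc.natCast_injOn hb ha (I.init.injective (e.trans ea.symm))
        simp [this]
      · rw [Function.update_of_ne, hI k (by omega) b hb e]
        rintro rfl
        refine ek (hc.natCast_injOn (by omega) hi (I.target.injective ?_))
        rw [← e, ea]
  · intro t s₁ _ _ hI ht
    refine ⟨by omega, fun a ha => ?_⟩
    obtain ⟨k, hk, e⟩ := hc.exists_nat (I.target.symm (I.init (c a)))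
    have e' : I.target (c k) = I.init (c a) := by rw [e, Equiv.apply_symm_apply]
    rw [hI k hk a ha e'.symm]
    refine ⟨Nat.mod_lt _ (by omega), ?_⟩
    rw [← e']
    congr 1
    rw [hc.eq_iff]
    have h1 := Int.emod_add_mul_ediv ((k : ℤ) + n - a) n
    refine ⟨1 - ((k : ℤ) + n - a) / n, ?_⟩
    push_cast [show a ≤ k + n by omega]
    linarith

/-- Compute the number of counter-clockwise objects. -/
def fillCount : Prog :=
  .seq (.assign 2 (.const 0))
    (.seq (forTo 16 0 (.assign 2 (.var 2 + .get 8 (.var 16)))) (.assign 2 (.var 2 / .var 0)))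

theorem runs_fillCount {n w : ℕ} {I : Inst n} {s : Store} (M : InputMem I w s)
    (hD : ∀ k < n, s.arr 8 k < n) : Runs w fillCount s fun t s' => t ≤ 40 * n ∧
      s'.var 2 = (∑ k ∈ Finset.range n, s.arr 8 k) / n := by
  have hle := M.le
  have hn := M.three_le
  have hcap := M.cap
  -- The partial sums stay below the word bound, as each displacement is less than `n`.
  have hsum : ∀ i ≤ n, ∑ k ∈ Finset.range i, s.arr 8 k ≤ n * n := fun i hi => by
    calc _ ≤ ∑ k ∈ Finset.range i, n := Finset.sum_le_sum fun k hk =>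
          (hD k (by have := Finset.mem_range.1 hk; omega)).le
      _ = i * n := by simp
      _ ≤ n * n := Nat.mul_le_mul_right _ hi
  refine .seq (.line (by omega) (by simp; omega) fun t₁ ht₁ A1 => ?_)
  have A1' : Agree [2] [] s ((Prog.assign 2 (.const 0)).runN s) := A1
  have M1 := M.congr A1' (by decide) (by decide) (by simp)
  have z2 : ((Prog.assign 2 (.const 0)).runN s).var 2 = 0 := by simp
  generalize (Prog.assign 2 (.const 0)).runN s = s₁ at *
  refine .seq (.forTo n 20 (by omega) M1.var0 (by decide) (by decide)
    (fun i s' => s'.var 2 = ∑ k ∈ Finset.range i, s.arr 8 k) (by simp [z2]) ?_ ?_)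
  · intro i hi s₂ A2 h16 hI
    have e8 : s₂.arr 8 = s.arr 8 := by rw [A2.arr 8 (by decide), A1'.arr 8 (by decide)]
    have h1 := hsum (i + 1) hi
    rw [Finset.sum_range_succ] at h1
    refine .line (by omega) ?_ fun t ht _ => ⟨ht.trans (by simp), ?_⟩
    · simp [h16, hI, e8]; omega
    · simp [h16, hI, e8, Finset.sum_range_succ]
  · intro t s₂ A2 _ hI ht
    have v0 : s₂.var 0 = n := by rw [A2.var 0 (by decide), M1.var0]
    refine .line (by omega) (by simp) fun t₂ ht₂ _ => ⟨?_, by simp [hI, v0]⟩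
    have ht₁ : t₁ ≤ 2 := ht₁
    have ht₂ : t₂ ≤ 4 := ht₂
    omega

/-- Compute the ranks. -/
def fillRanks : Prog :=
  forTo 16 0 (.seq (forTo 17 0 (.put 9 (.var 16 * .var 0 + .var 17) (.const 0)))
    (.seq (.seq (.assign 18 (.get 6 (.var 16))) (.assign 19 (.get 2 (.var 18))))
      (forTo 17 19 (.put 9 (.var 16 * .var 0 + .get 7 (.get 3 (.var 18 * .var 0 + .var 17)))
        (.var 17 + .const 1)))))

theorem runs_fillRanks {n w : ℕ} {I : Inst n} {c : ℤ → Fin n} {s : Store} (M : InputMem I w s)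
    (hc : CycOrder I.graph c) (O : OrderMem I c s) :
    Runs w fillRanks s fun t s' => t ≤ 100 * (n * n) ∧ IsRank I c (rankAt n s') := by
  classical
  have hle := M.le
  have hn := M.three_le
  have hcap := M.cap
  refine .forTo n (80 * n) (by omega) M.var0 (by decide) (by decide)
    (fun i s' => ∀ x < i, ∀ l < n, rankAt n s' x l = if I.init (c l) ∈ I.pref (c x) then
      (I.pref (c x)).idxOf (I.init (c l)) + 1 else 0) (by simp) ?_ ?_
  · rintro x hx s₁ A1 h16 hI
    have A1' : Agree [16, 17, 18, 19] [9] s s₁ := A1.mono (by decide) (by decide)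
    have M1 := M.congr A1' (by decide) (by decide) (by simp; omega)
    have O1 := O.congr A1' (by decide) (by decide)
    have hL := length_pref_le I (c x)
    refine .seq (.forTo n 20 (by omega) M1.var0 (by decide) (by decide)
      (fun i s' => (∀ y < x, ∀ l < n, rankAt n s' y l = rankAt n s₁ y l) ∧
        ∀ l < i, rankAt n s' x l = 0) ⟨fun _ _ _ _ => rfl, by simp⟩ ?_ ?_)
    · rintro l hl s₂ A2 h17 ⟨hI1, hI2⟩
      have h16' : s₂.var 16 = x := by rw [A2.var 16 (by decide), h16]
      have h0 : s₂.var 0 = n := by rw [A2.var 0 (by decide), M1.var0]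
      have hidx := index_lt hx hl
      refine .line (by omega) ?_ fun t ht _ => ⟨ht.trans (by simp), fun y hy l' hl' => ?_,
        fun l' hl' => ?_⟩
      · simp [h16', h17, h0]; omega
      · rw [← hI1 y hy l' hl']
        simp only [rankAt, Prog.runN, Store.setVar_arr, Store.setArr_arr, if_true, evalN_add,
          evalN_mul, evalN_var, h16', h17, h0]
        rw [Function.update_of_ne]
        rw [Ne, index_inj hl' hl]
        omega
      · simp only [rankAt, Prog.runN, Store.setVar_arr, Store.setArr_arr, if_true, evalN_add,
          evalN_mul, evalN_var, h16', h17, h0, evalN_const]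
        by_cases e : l' = l
        · rw [e, Function.update_self]
        · rw [Function.update_of_ne]
          · exact hI2 l' (by omega)
          · rw [Ne, index_inj (by omega) hl]
            omega
    rintro t₂ s₂ A2 _ ⟨hI1, hI2⟩ ht₂
    have A2' : Agree [17] [9] s₁ s₂ := A2.mono (by decide) (by decide)
    have M2 := M1.congr A2' (by decide) (by decide) (by simp; omega)
    have O2 := O1.congr A2' (by decide) (by decide)
    have h16' : s₂.var 16 = x := by rw [A2'.var 16 (by decide), h16]
    refine .seq (.line (by omega) (by simp) fun t₃ ht₃ A3 => ?_)
    have A3' : Agree [18, 19] [] s₂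
      (((Prog.assign 18 (.get 6 (.var 16))).seq (.assign 19 (.get 2 (.var 18)))).runN s₂) := A3
    have v18 : (((Prog.assign 18 (.get 6 (.var 16))).seq (.assign 19 (.get 2 (.var 18)))).runN
      s₂).var 18 = c x := by simp [h16', O2.agent x hx]
    have v19 : (((Prog.assign 18 (.get 6 (.var 16))).seq (.assign 19 (.get 2 (.var 18)))).runN
      s₂).var 19 = (I.pref (c x)).length := by simp [h16', O2.agent x hx, M2.length]
    generalize ((Prog.assign 18 (.get 6 (.var 16))).seq (.assign 19 (.get 2 (.var 18)))).runN
      s₂ = s₃ at *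
    have ht₃ : t₃ ≤ 10 := ht₃.trans (by decide)
    have M3 := M2.congr A3' (by decide) (by decide) (by simp)
    have O3 := O2.congr A3' (by decide) (by decide)
    have hr3 : rankAt n s₃ = rankAt n s₂ := by unfold rankAt; rw [A3'.arr 9 (by decide)]
    have h16'' : s₃.var 16 = x := by rw [A3'.var 16 (by decide), h16']
    refine .forTo _ 30 (by omega) v19 (by decide) (by decide)
      (fun i s' => (∀ y < x, ∀ l < n, rankAt n s' y l = rankAt n s₁ y l) ∧
        -- After `i` entries of the list, exactly the objects of index less than `i` have their
        -- rank; `idxOf` is the list length for objects that are not listed, so these keep `0`.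
        ∀ l < n, rankAt n s' x l = if (I.pref (c x)).idxOf (I.init (c l)) < i then
          (I.pref (c x)).idxOf (I.init (c l)) + 1 else 0) ?_ ?_ ?_
    · refine ⟨fun y hy l hl => ?_, fun l hl => ?_⟩
      · change rankAt n s₃ y l = _
        rw [hr3]; exact hI1 y hy l hl
      · change rankAt n s₃ x l = _
        rw [hr3]; simp [hI2 l hl]
    · rintro j hj s₄ A4 h17 ⟨hI1, hI2⟩
      have A4' : Agree [17] [9] s₃ s₄ := A4.mono (by decide) (by decide)
      have M4 := M3.congr A4' (by decide) (by decide) (by simp; omega)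
      have O4 := O3.congr A4' (by decide) (by decide)
      obtain ⟨l₀, hl₀, e7, e0⟩ := O4.exists_position hc (I.pref (c x))[j]
      have h16 : s₄.var 16 = x := by rw [A4'.var 16 (by decide), h16'']
      have h18 : s₄.var 18 = c x := by rw [A4'.var 18 (by decide), v18]
      have hidx := index_lt hx hl₀
      have hidx' := index_lt (c x).2 (show j < n by omega)
      have e3 := M4.pref (c x) j hj
      refine .line (by omega) ?_ fun t ht _ => ⟨ht.trans (by simp), ?_, fun l hl => ?_⟩
      · simp [h16, h17, h18, M4.var0, e3, e7]; omega
      · intro y hy l' hl'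
        rw [← hI1 y hy l' hl']
        simp only [rankAt, Prog.runN, Store.setVar_arr, Store.setArr_arr, if_true, evalN_add,
          evalN_mul, evalN_var, evalN_get, h16, h17, h18, M4.var0, e3, e7]
        rw [Function.update_of_ne]
        rw [Ne, index_inj hl' hl₀]
        omega
      · have hI2 := hI2 l hl
        simp only [rankAt, Prog.runN, Store.setVar_arr, Store.setArr_arr, if_true, evalN_add,
          evalN_mul, evalN_var, evalN_get, evalN_const, h16, h17, h18, M4.var0, e3, e7] at hI2 ⊢
        by_cases e : l = l₀
        · subst e
          rw [Function.update_self, e0, (I.pref_nodup _).idxOf_getElem, if_pos (by omega)]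
        · rw [Function.update_of_ne (by rw [Ne, index_inj hl hl₀]; omega), hI2]
          have : (I.pref (c x)).idxOf (I.init (c l)) ≠ j := by
            rintro rfl
            rw [List.getElem_idxOf] at e0
            exact e (hc.natCast_injOn hl hl₀ (I.init.injective e0.symm))
          simp only [Nat.lt_succ_iff_lt_or_eq, this, or_false]
    · rintro t₄ s₄ A4 _ ⟨hI1', hI2'⟩ ht₄
      have : 38 * (I.pref (c x)).length ≤ 38 * n := Nat.mul_le_mul_left _ hL
      refine ⟨by omega, fun y hy l hl => ?_⟩
      change rankAt n s₄ y l = _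
      by_cases e : y = x
      · subst e
        rw [hI2' l hl]
        simp only [List.idxOf_lt_length_iff]
      · rw [hI1' y (by omega) l hl, hI y (by omega) l hl]
  · intro t s₁ _ _ hI ht
    have h2 : 3 * n ≤ n * n := Nat.mul_le_mul_right _ hn
    rw [show (80 * n + 8) * n + 6 = 80 * (n * n) + 8 * n + 6 by ring] at ht
    exact ⟨by omega, hI⟩

/-- Check the guess in variable `5`. -/
def guess : Prog :=
  .seq rotate <| .seq fillDisp <| .seq fillCount <| .seq fillRanks <| .seq fillClaims <|
    .seq fillMatrix <| .seq solver <| .ite (.var 3) (.assign 4 (.const 1)) .skip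

open Classical in
-- Variable `4` is only ever raised to `1` here, so over all guesses it accumulates a disjunction.
theorem runs_guess {n w g : ℕ} {I : Inst n} {c : ℤ → Fin n} {s : Store} (M : InputMem I w s)
    (hc : CycOrder I.graph c) (h5 : ∀ k < n, s.arr 5 k = c k) (hg : s.var 5 = g) (hgn : g < n) :
    Runs w guess s fun t s' => t ≤ 20000 * (n * n) ∧
      ∃ D R cl, IsDisp I (fun i => c (g + i)) D ∧ IsRank I (fun i => c (g + i)) R ∧
        ClaimSpec n D R ((∑ k ∈ Finset.range n, D k) / n) cl ∧
        s'.var 4 = if ∃ x, Consistent n D R ((∑ k ∈ Finset.range n, D k) / n) cl x then 1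
          else s.var 4 := by
  have hle := M.le
  have hn := M.three_le
  have hnn : 3 * n ≤ n * n := Nat.mul_le_mul_right _ hn
  have hcg := hc.shift g
  refine .seq ((runs_rotate M hc h5 hg hgn).mono fun t₁ s₁ A1 ⟨ht₁, O1⟩ => ?_)
  have A1' : Agree [16] [6, 7] s s₁ := A1.mono (by decide) (by decide)
  have M1 := M.congr A1' (by decide) (by decide) (by simp; omega)
  refine .seq ((runs_fillDisp M1 hcg O1).mono fun t₂ s₂ A2 ⟨ht₂, hD⟩ => ?_)
  have A2' : Agree [16, 17] [8] s₁ s₂ := A2.mono (by decide) (by decide)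
  have M2 := M1.congr A2' (by decide) (by decide) (by simp; omega)
  have O2 := O1.congr A2' (by decide) (by decide)
  refine .seq ((runs_fillCount M2 fun k hk => (hD k hk).1).mono fun t₃ s₃ A3 ⟨ht₃, hm⟩ => ?_)
  have A3' : Agree [2, 16] [] s₂ s₃ := A3.mono (by decide) (by decide)
  have M3 := M2.congr A3' (by decide) (by decide) (by simp)
  have O3 := O2.congr A3' (by decide) (by decide)
  refine .seq ((runs_fillRanks M3 hcg O3).mono fun t₄ s₄ A4 ⟨ht₄, hR⟩ => ?_)
  have A4' : Agree [16, 17, 18, 19] [9] s₃ s₄ := A4.mono (by decide) (by decide)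
  have e8 : s₄.arr 8 = s₂.arr 8 := by rw [A4'.arr 8 (by decide), A3'.arr 8 (by decide)]
  have hm4 : s₄.var 2 = (∑ k ∈ Finset.range n, s₄.arr 8 k) / n := by
    rw [A4'.var 2 (by decide), hm, e8]
  rw [← e8] at hD
  have G4 : GuessMem n w s₄ := by
    have M4 := M3.congr A4' (by decide) (by decide) (by simp; omega)
    refine ⟨hn, M4.cap, M4.var0, M4.var1, ?_, fun k hk => (hD k hk).1⟩
    rw [hm4]
    refine Nat.div_le_of_le_mul ?_
    calc _ ≤ ∑ k ∈ Finset.range n, n := Finset.sum_le_sum fun k hk =>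
          (hD k (Finset.mem_range.1 hk)).1.le
      _ = n * n := by simp
  refine .seq ((runs_fillClaims G4).mono fun t₅ s₅ A5 ⟨ht₅, hC⟩ => ?_)
  have A5' : Agree [16, 17, 18, 19, 20, 21] [10] s₄ s₅ := A5.mono (by decide) (by decide)
  have G5 := G4.congr A5' (by decide) (by decide) (by decide) (by decide)
  refine .seq ((runs_fillMatrix G5 hC.le).mono fun t₆ s₆ A6 ⟨ht₆, E6⟩ => ?_)
  refine .seq ((runs_solver ConfAt.symm E6).mono fun t₇ s₇ A7 ⟨ht₇, hS⟩ => ?_)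
  have v4 : s₇.var 4 = s.var 4 := by
    rw [A7.var 4 (by decide), A6.var 4 (by decide), A5'.var 4 (by decide), A4'.var 4 (by decide),
      A3'.var 4 (by decide), A2'.var 4 (by decide), A1'.var 4 (by decide)]
  have hR5 : rankAt n s₅ = rankAt n s₄ := by unfold rankAt; rw [A5'.arr 9 (by decide)]
  rw [exists_isSol_confAt, A5'.arr 8 (by decide), hR5, A5'.var 2 (by decide), hm4] at hS
  rw [hm4] at hC
  refine .line (by omega) (by simp; omega) fun t₈ ht₈ _ => ⟨?_, _, _, _, hD, hR, hC, ?_⟩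
  · simp at ht₈
    omega
  · rw [← hS]
    simp only [Prog.runN, evalN_var, evalN_const]
    by_cases e : s₇.var 3 = 0 <;> simp [e, v4]


/-! ### The main program -/

theorem Inst.inputMem_encode {n w : ℕ} (I : Inst n) (hn : 3 ≤ n) (hw : 100 * (n * n) < cap w)
    {s : Store} (h0 : s.var 0 = n) (h1 : s.var 1 = 2 * n) (ha : s.arr = I.encode.arr) :
    InputMem I w s where
  three_le := hn
  cap := hw
  var0 := h0
  var1 := h1
  init i := by rw [ha]; simp [Inst.encode, vec_val]
  target i := by rw [ha]; simp [Inst.encode, vec_val]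
  length i := by rw [ha]; simp [Inst.encode, vec_val]
  pref i j h := by
    have := table_val (fun i (k : Fin n) => ((I.pref i).map Fin.val).getD k 0) i
      ⟨j, h.trans_le (length_pref_le I i)⟩
    rw [ha]
    simpa [Inst.encode, h] using this
  adj i j := by rw [ha]; simp [Inst.encode, table_val]

/-- Compare the initial and the target assignment. -/
def compareEnds : Prog :=
  .seq (.assign 4 (.const 1))
    (forTo 16 0 (.ite (.op .eq (.get 0 (.var 16)) (.get 1 (.var 16))) .skip (.assign 4 (.const 0))))

open Classical in
theorem runs_compareEnds {n w : ℕ} {I : Inst n} {s : Store} (M : InputMem I w s) :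
    Runs w compareEnds s fun t s' => t ≤ 40 * n ∧
      s'.var 4 = if I.init = I.target then 1 else 0 := by
  have hle := M.le
  have hn := M.three_le
  refine .seq (.line (by omega) (by simp; omega) fun t₁ ht₁ A1 => ?_)
  have A1' : Agree [4] [] s ((Prog.assign 4 (.const 1)).runN s) := A1
  have M1 := M.congr A1' (by decide) (by decide) (by simp)
  have z4 : ((Prog.assign 4 (.const 1)).runN s).var 4 = 1 := by simp
  generalize (Prog.assign 4 (.const 1)).runN s = s₁ at *
  have ht₁ : t₁ ≤ 2 := ht₁
  refine .forTo n 20 (by omega) M1.var0 (by decide) (by decide)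
    (fun i s' => s'.var 4 = if ∀ k : Fin n, (k : ℕ) < i → I.init k = I.target k then 1 else 0)
    (by simp [z4]) ?_ ?_
  · intro i hi s₂ A2 h16 hI
    have A2' : Agree [16, 4] [] s₁ s₂ := A2.mono (by decide) (by decide)
    have M2 := M1.congr A2' (by decide) (by decide) (by simp)
    have e0 := M2.init ⟨i, hi⟩
    have e1 := M2.target ⟨i, hi⟩
    dsimp only at e0 e1
    refine .line (by omega) (by simp; omega) fun t ht _ => ⟨ht.trans (by simp), ?_⟩
    have hiff : (∀ k : Fin n, (k : ℕ) < i + 1 → I.init k = I.target k) ↔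
        (∀ k : Fin n, (k : ℕ) < i → I.init k = I.target k) ∧ I.init ⟨i, hi⟩ = I.target ⟨i, hi⟩ := by
      refine ⟨fun h => ⟨fun k hk => h k (by omega), h _ (by simp)⟩, fun ⟨h1, h2⟩ k hk => ?_⟩
      rcases Nat.lt_succ_iff_lt_or_eq.1 hk with hk | rfl
      · exact h1 k hk
      · exact h2
    simp only [Prog.runN, evalN_eq, evalN_get, evalN_var, evalN_const, h16, e0, e1, eqB_eq_zero,
      hiff, ne_eq, Fin.val_inj]
    by_cases e : I.init ⟨i, hi⟩ = I.target ⟨i, hi⟩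
    · simp [e, hI]
    · simp [e]
  · intro t s₂ _ _ hI ht
    refine ⟨by omega, hI.trans (if_congr ?_ rfl rfl)⟩
    exact ⟨fun h => Equiv.ext fun k => h k k.2, fun h k _ => by rw [h]⟩

/-- The decision procedure. -/
def mainProg : Prog :=
  .seq (.assign 1 (.const 2 * .var 0)) <| .seq compareEnds <| .seq traverse <|
    .seq (forTo 5 0 guess) (.assign 0 (.var 4))

theorem ite_ite_one_zero (p q : Prop) [Decidable p] [Decidable q] [Decidable (p ∨ q)] :
    (if q then 1 else if p then 1 else 0) = if p ∨ q then 1 else 0 := by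
  split_ifs <;> tauto

/-- Uses `n < 2 ^ size n`, `100 < 2 ^ 7` and `7 + 2 * size n ≤ 6 * size n`; the last holds because
`size n` is at least `2`. -/
theorem cap_of_size_le {n w : ℕ} (hn : 3 ≤ n) (hw : 6 * Nat.size n ≤ w) :
    100 * (n * n) < cap w := by
  have h1 := Nat.lt_size_self n
  have h2 : 1 < Nat.size n := Nat.lt_size.2 (by omega)
  calc 100 * (n * n) < 2 ^ 7 * (2 ^ Nat.size n * 2 ^ Nat.size n) :=
        Nat.mul_lt_mul'' (by norm_num) (Nat.mul_lt_mul'' h1 h1)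
    _ = 2 ^ (7 + (Nat.size n + Nat.size n)) := by rw [pow_add, pow_add]
    _ ≤ 2 ^ w := Nat.pow_le_pow_right (by norm_num) (by omega)

theorem runs_mainProg {n w : ℕ} (I : Inst n) (hn : 3 ≤ n) (hI : I.OnCycle)
    (hw : 100 * (n * n) < cap w) : Runs w mainProg I.encode fun t s' => t ≤ 30000 * n ^ 3 ∧
      (I.IsYes → s'.var 0 = 1) ∧ (¬ I.IsYes → s'.var 0 = 0) := by
  classical
  have hnn : 3 * n ≤ n * n := Nat.mul_le_mul_right _ hn
  have v0 : I.encode.var 0 = n := by simp [Inst.encode]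
  refine .seq (.line (by omega) (by simp [v0]; omega) fun t₁ ht₁ A1 => ?_)
  have M1 : InputMem I w ((Prog.assign 1 (.const 2 * .var 0)).runN I.encode) :=
    I.inputMem_encode hn hw (by simp [v0]) (by simp [v0]) rfl
  have ht₁ : t₁ ≤ 4 := ht₁
  generalize (Prog.assign 1 (.const 2 * .var 0)).runN I.encode = s₁ at *
  refine .seq ((runs_compareEnds M1).mono fun t₂ s₂ A2 ⟨ht₂, h4⟩ => ?_)
  have M2 := M1.congr (V := [4, 16]) (A := []) (A2.mono (by decide) (by decide)) (by decide)
    (by decide) (by simp)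
  refine .seq ((runs_traverse M2 hI).mono fun t₃ s₃ A3 ⟨ht₃, c, hc, h5⟩ => ?_)
  have A3' : Agree [16, 17, 26, 27, 28] [5] s₂ s₃ := A3.mono (by decide) (by decide)
  have M3 := M2.congr A3' (by decide) (by decide) (by simp; omega)
  have h4' : s₃.var 4 = if I.init = I.target then 1 else 0 := by rw [A3'.var 4 (by decide), h4]
  refine .seq (.forTo n (20000 * (n * n)) (by omega) M3.var0 (by decide) (by decide)
    -- The arrays of a guess are overwritten by the next one, so the invariant keeps the data of
    -- past guesses as existential witnesses.
    (fun i s' => ∃ (D : ℕ → ℕ → ℕ) (R : ℕ → ℕ → ℕ → ℕ) (cl : ℕ → ℕ → ℕ),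
      (∀ g < i, IsDisp I (fun j => c (g + j)) (D g) ∧
      IsRank I (fun j => c (g + j)) (R g) ∧
      ClaimSpec n (D g) (R g) ((∑ k ∈ Finset.range n, D g k) / n) (cl g)) ∧
      s'.var 4 = if I.init = I.target ∨ ∃ g < i, ∃ x,
        Consistent n (D g) (R g) ((∑ k ∈ Finset.range n, D g k) / n) (cl g) x then 1 else 0)
    ?_ ?_ ?_)
  · exact ⟨fun _ _ => 0, fun _ _ _ => 0, fun _ _ => 0, by simp, by simpa using h4'⟩
  · rintro g hg s₄ A4 hv ⟨D, R, cl, hI1, hI2⟩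
    have A4' : Agree (5 :: guess.vars) [6, 7, 8, 9, 10, 11, 12, 13, 14, 15, 16] s₃ s₄ :=
      A4.mono (by decide) (by decide)
    have M4 := M3.congr A4' (by decide) (by decide) (by simp; omega)
    refine (runs_guess M4 hc (by rwa [A4'.arr 5 (by decide)]) hv hg).mono
      fun t s₅ _ ⟨ht, D', R', cl', hD, hR, hcl, h⟩ => ⟨ht, ?_⟩
    have upd : ∀ {α : Type} (f : ℕ → α) (a : α), ∀ g' < g, Function.update f g a g' = f g' :=
      fun f a g' h => Function.update_of_ne (by omega) _ _
    refine ⟨Function.update D g D', Function.update R g R', Function.update cl g cl',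
      fun g' hg' => ?_, ?_⟩
    · rcases Nat.lt_succ_iff_lt_or_eq.1 hg' with hg' | rfl
      · rw [upd _ _ g' hg', upd _ _ g' hg', upd _ _ g' hg']
        exact hI1 g' hg'
      · simp only [Function.update_self]
        exact ⟨hD, hR, hcl⟩
    · have hiff : (∃ g' < g + 1, ∃ x, Consistent n (Function.update D g D' g')
          (Function.update R g R' g') ((∑ k ∈ Finset.range n, Function.update D g D' g' k) / n)
          (Function.update cl g cl' g') x) ↔
          (∃ g' < g, ∃ x, Consistent n (D g') (R g') ((∑ k ∈ Finset.range n, D g' k) / n) (cl g') x) ∨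
          ∃ x, Consistent n D' R' ((∑ k ∈ Finset.range n, D' k) / n) cl' x := by
        constructor
        · rintro ⟨g', hg', h⟩
          rcases Nat.lt_succ_iff_lt_or_eq.1 hg' with hg' | rfl
          · rw [upd _ _ g' hg', upd _ _ g' hg', upd _ _ g' hg'] at h
            exact .inl ⟨g', hg', h⟩
          · simp only [Function.update_self] at h
            exact .inr h
        · rintro (⟨g', hg', h⟩ | h)
          · refine ⟨g', by omega, ?_⟩
            rwa [upd _ _ g' hg', upd _ _ g' hg', upd _ _ g' hg']
          · refine ⟨g, by omega, ?_⟩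
            simpa only [Function.update_self] using h
      simp only [Store.setVar_var, hiff]
      rw [if_neg (by omega), h, hI2]
      simp only [← or_assoc]
      exact ite_ite_one_zero _ _
  · rintro t₄ s₄ - - ⟨D, R, cl, hI1, hI2⟩ ht₄
    refine .line (by omega) (by simp) fun t₅ ht₅ _ => ?_
    have ht₅ : t₅ ≤ 2 := ht₅
    have key := isYes_iff hn hc (fun g hg => (hI1 g hg).1) (fun g hg => (hI1 g hg).2.1)
      fun g hg => (hI1 g hg).2.2
    simp only [← key] at hI2
    refine ⟨?_, fun h => by simp [hI2, h], fun h => by simp [hI2, h]⟩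
    have h3 : 3 * (n * n) ≤ n ^ 3 := by
      rw [show n ^ 3 = n * (n * n) by ring]; exact Nat.mul_le_mul_right _ hn
    rw [show (20000 * (n * n) + 8) * n + 6 = 20000 * n ^ 3 + 8 * n + 6 by ring] at ht₄
    omega

end ReachableAssignment

theorem mainTheorem1 :
    ∃ (P : ReachableAssignment.Prog) (c κ : ℕ),
      ∀ (n : ℕ), 3 ≤ n → ∀ I : ReachableAssignment.Inst n, I.OnCycle →
        ∀ w : ℕ, κ * Nat.size n ≤ w →
          ∃ (t : ℕ) (s : ReachableAssignment.Store),
            ReachableAssignment.Exec w P I.encode t s ∧ t ≤ c * n ^ 3 ∧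
              (I.IsYes → s.var 0 = 1) ∧ (¬ I.IsYes → s.var 0 = 0) := by
  refine ⟨ReachableAssignment.mainProg, 30000, 6, fun n hn I hI w hw => ?_⟩
  obtain ⟨t, s, h1, -, h2⟩ :=
    ReachableAssignment.runs_mainProg I hn hI (ReachableAssignment.cap_of_size_le hn hw)
  exact ⟨t, s, h1, h2⟩
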